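/- Let $\mathrm F$ be Thompson's group: the group, under composition, of all orientation-preserving piecewise-linear homeomorphisms $f$ of $[0,1]$ with finitely many breakpoints, all at dyadic rationals, and with all slopes integer powers of $2$ (such an $f$ induces a bijection of the dyadic rationals of $[0,1]$). Let $\mathrm F'$ be its derived subgroup. A bi-ordering on a group $\Gamma$ is a total order relation invariant under left and right multiplication. The set $\mathcal{BO}(\Gamma)$ of bi-orderings carries the topology in which a basis of neighbourhoods of $\preceq$ is given by the sets of bi-orderings that coincide with $\preceq$ on a given finite subset of $\Gamma$. For $f\in\mathrm F\setminus\{id\}$ let $x_f^-$ be the leftmost point of $[0,1)$ with $f'_+(x_f^-)\neq1$, and $x_f^+$ the rightmost point of $(0,1]$ with $f'_-(x_f^+)\neq1$, where $f'_\pm$ are the lateral derivatives. Consider the following eight relations, each described by its elements $f\succ id$, $f\ne id$ (with $f\succ g$ meaning $g^{-1}f\succ id$): * $\preceq_{x^-}^{+}$: $f'_+(x_f^-)>1$; * $\preceq_{x^-}^{-}$: $f'_+(x_f^-)<1$; * $\preceq_{x^+}^{+}$: $f'_-(x_f^+)<1$; * $\preceq_{x^+}^{-}$: $f'_-(x_f^+)>1$;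 * $\preceq_{0,x^-}^{+,-}$: either $x_f^-=0$ and $f'_+(0)>1$, or $x_f^-\ne0$ and $f'_+(x_f^-)<1$; * $\preceq_{0,x^-}^{-,+}$: either $x_f^-=0$ and $f'_+(0)<1$, or $x_f^-\ne0$ and $f'_+(x_f^-)>1$; * $\preceq_{1,x^+}^{+,-}$: either $x_f^+=1$ and $f'_-(1)<1$, or $x_f^+\ne1$ and $f'_-(x_f^+)>1$; * $\preceq_{1,x^+}^{-,+}$: either $x_f^+=1$ and $f'_-(1)>1$, or $x_f^+\ne1$ and $f'_-(x_f^+)<1$. Given a bi-ordering $\preceq_{\mathbb Z^2}$ on $\mathbb Z^2$ and a bi-ordering $\preceq_{\mathrm F'}$ on $\mathrm F'$, their extension to $\mathrm F$ is the relation for which $f\succ id$ if and only if either $f\notin\mathrm F'$ and $(\log_2 f'_+(0),\log_2 f'_-(1))\succ_{\mathbb Z^2}(0,0)$, or $f\in\mathrm F'$ and $f\succ_{\mathrm F'}id$. For $\ast\in\{x^-,x^+\}$ and $\epsilon\in\{+,-\}$, let $\Lambda_\ast^\epsilon$ be the set of all bi-orderings on $\mathrm F$ that are the extension of some bi-ordering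 on $\mathbb Z^2$ and of the restriction of $\preceq_\ast^\epsilon$ to $\mathrm F'$. **Theorem.** 1. The eight relations above are pairwise distinct bi-orderings on $\mathrm F$; let $\mathcal{BO}_{Isol}(\mathrm F)$ be the set of them. Each of them is an isolated point of $\mathcal{BO}(\mathrm F)$. 2. $\mathrm F'$ has exactly four bi-orderings, namely the restrictions of $\preceq_{x^-}^{+}$, $\preceq_{x^-}^{-}$, $\preceq_{x^+}^{+}$, $\preceq_{x^+}^{-}$, which are pairwise distinct. 3. For all $\ast$ and $\epsilon$, every bi-ordering on $\mathbb Z^2$ and the restriction of $\preceq_\ast^\epsilon$ to $\mathrm F'$ have an extension to $\mathrm F$ that is a bi-ordering, and this extension procedure is a homeomorphism $\mathcal{BO}(\mathbb Z^2)\to\Lambda_\ast^\epsilon$; moreover $\Lambda_\ast^\epsilon$ is homeomorphic to the Cantor set. 4. $\mathcal{BO}(\mathrm F)$ is the disjoint union of the five pairwise disjoint sets $\mathcal{BO}_{Isol}(\mathrm F)$, $\Lambda_{x^-}^{+}$, $\Lambda_{x^-}^{-}$, $\Lambda_{x^+}^{+}$, $\Lambda_{x^+}^{-}$. -/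

import Mathlib

namespace ThompsonBO

/-! ### Bi-orderings on a group and their space -/

/-- A bi-ordering on a group: a total order relation invariant under left and right
multiplications. -/
@[ext]
structure BiOrdering (G : Type*) [Group G] where
  le : G → G → Prop
  le_refl : ∀ g, le g g
  le_antisymm : ∀ g h, le g h → le h g → g = h
  le_trans : ∀ g h k, le g h → le h k → le g k
  le_total : ∀ g h, le g h ∨ le h g
  mul_left : ∀ a g h, le g h → le (a * g) (a * h)
  mul_right : ∀ a g h, le g h → le (g * a) (h * a)

namespace BiOrdering

variable {G : Type*} [Group G]

/-- The element `g` is positive, i.e. strictly larger than the identity. -/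
def Pos (r : BiOrdering G) (g : G) : Prop := r.le 1 g ∧ g ≠ 1

/-- The positive cone of the bi-ordering `r` is the set `C`. -/
def HasCone (r : BiOrdering G) (C : Set G) : Prop := ∀ g, r.Pos g ↔ g ∈ C

/-- The set of all bi-orderings which coincide with `r` on the finite set `A`. -/
def basicNhd (r : BiOrdering G) (A : Finset G) : Set (BiOrdering G) :=
  {r' | ∀ g ∈ A, ∀ h ∈ A, (r'.le g h ↔ r.le g h)}

/-- The topology of the space of bi-orderings, with basis the sets `basicNhd r A`. -/
instance : TopologicalSpace (BiOrdering G) :=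
  TopologicalSpace.generateFrom {U | ∃ r A, U = basicNhd r A}

end BiOrdering

/-! ### Thompson's group `F` -/

/-- Dyadic rational numbers. -/
def IsDyadic (x : ℝ) : Prop := ∃ (a : ℤ) (n : ℕ), x = a / 2 ^ n

/-- `f` is piecewise linear, with finitely many breakpoints, all of them dyadic, and the slope
of each linear piece is an integer power of `2`. -/
def IsDyadicPL (f : unitInterval ≃ₜ unitInterval) : Prop :=
  ∃ S : Finset unitInterval, (∀ s ∈ S, IsDyadic s) ∧
    ∀ x y : unitInterval, x < y → (∀ s ∈ S, s ∉ Set.Ioo x y) →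
      ∃ (k : ℤ) (c : ℝ), ∀ t ∈ Set.Icc x y, ((f t : unitInterval) : ℝ) = 2 ^ k * (t : ℝ) + c

/-- Membership in Thompson's group: `f` preserves the orientation, is dyadically piecewise
linear, and induces a bijection of the set of dyadic rational numbers in `[0,1]`. -/
def IsThompson (f : unitInterval ≃ₜ unitInterval) : Prop :=
  StrictMono f ∧ IsDyadicPL f ∧ ∀ x : unitInterval, IsDyadic (f x) ↔ IsDyadic x

theorem IsThompson.one : IsThompson 1 := by
  refine ⟨strictMono_id, ⟨∅, by simp, fun x y _ _ => ⟨0, 0, fun t _ => ?_⟩⟩, fun x => Iff.rfl⟩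
  simp

theorem IsThompson.mul {f g : unitInterval ≃ₜ unitInterval} (hf : IsThompson f)
    (hg : IsThompson g) : IsThompson (f * g) := by
  classical
  obtain ⟨hf1, ⟨S, hS, hSf⟩, hf3⟩ := hf
  obtain ⟨hg1, ⟨T, hT, hTg⟩, hg3⟩ := hg
  refine ⟨hf1.comp hg1, ⟨T ∪ S.image g.symm, ?_, ?_⟩, fun x => (hf3 (g x)).trans (hg3 x)⟩
  · intro s hs
    rcases Finset.mem_union.1 hs with h | h
    · exact hT s h
    · obtain ⟨u, hu, rfl⟩ := Finset.mem_image.1 h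
      rw [← hg3, g.apply_symm_apply]
      exact hS u hu
  · intro x y hxy hd
    obtain ⟨k, c, h1⟩ := hTg x y hxy fun s hs => hd s (Finset.mem_union_left _ hs)
    obtain ⟨l, d, h2⟩ := hSf (g x) (g y) (hg1 hxy) fun s hs hI => by
      refine hd (g.symm s) (Finset.mem_union_right _ (Finset.mem_image_of_mem _ hs)) ⟨?_, ?_⟩
      · rw [← hg1.lt_iff_lt, g.apply_symm_apply]; exact hI.1
      · rw [← hg1.lt_iff_lt, g.apply_symm_apply]; exact hI.2
    refine ⟨l + k, 2 ^ l * c + d, fun t ht => ?_⟩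
    have h3 := h2 (g t) ⟨hg1.monotone ht.1, hg1.monotone ht.2⟩
    have h4 : (f * g) t = f (g t) := rfl
    rw [h4, h3, h1 t ht, zpow_add₀ (by norm_num)]
    ring

theorem IsThompson.inv {f : unitInterval ≃ₜ unitInterval} (hf : IsThompson f) :
    IsThompson f⁻¹ := by
  classical
  obtain ⟨hf1, ⟨S, hS, hSf⟩, hf3⟩ := hf
  have hfi : ∀ x, f (f⁻¹ x) = x := fun x => f.apply_symm_apply x
  have hfj : ∀ x, f⁻¹ (f x) = x := fun x => f.symm_apply_apply x
  have hm : StrictMono (f⁻¹ : unitInterval ≃ₜ unitInterval) := fun x y hxy => by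
    rw [← hf1.lt_iff_lt, hfi, hfi]; exact hxy
  refine ⟨hm, ⟨S.image f, ?_, ?_⟩, fun x => by rw [← hf3, hfi]⟩
  · intro s hs
    obtain ⟨u, hu, rfl⟩ := Finset.mem_image.1 hs
    exact (hf3 u).2 (hS u hu)
  · intro x y hxy hd
    obtain ⟨k, c, h⟩ := hSf (f⁻¹ x) (f⁻¹ y) (hm hxy) fun s hs hI => by
      refine hd (f s) (Finset.mem_image_of_mem _ hs) ⟨?_, ?_⟩
      · rw [← hm.lt_iff_lt, hfj]; exact hI.1
      · rw [← hm.lt_iff_lt, hfj]; exact hI.2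
    refine ⟨-k, -(2 ^ (-k) * c), fun t ht => ?_⟩
    have h3 := h (f⁻¹ t) ⟨hm.monotone ht.1, hm.monotone ht.2⟩
    rw [hfi] at h3
    rw [h3, mul_add, ← mul_assoc, ← zpow_add₀ (by norm_num)]
    simp

/-- Thompson's group `F`, as a group of homeomorphisms of `[0,1]`. -/
def thompsonF : Subgroup (unitInterval ≃ₜ unitInterval) where
  carrier := {f | IsThompson f}
  one_mem' := IsThompson.one
  mul_mem' := IsThompson.mul
  inv_mem' := IsThompson.inv

/-- Thompson's group as a type. -/
abbrev F : Type := thompsonF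

/-- The derived subgroup of `F`. -/
abbrev F' : Subgroup F := commutator F

open Classical in
/-- The map of the real line equal to `f` on `[0,1]` and to the identity elsewhere. -/
noncomputable def extendReal (f : F) (x : ℝ) : ℝ :=
  if h : x ∈ unitInterval then (((f : unitInterval ≃ₜ unitInterval) ⟨x, h⟩ : unitInterval) : ℝ)
  else x

/-- The right derivative of `f` at `x`, for `0 ≤ x < 1`. -/
noncomputable def rightDeriv (f : F) (x : ℝ) : ℝ := derivWithin (extendReal f) (Set.Ici x) x

/-- The left derivative of `f` at `x`, for `0 < x ≤ 1`. -/
noncomputable def leftDeriv (f : F) (x : ℝ) : ℝ := derivWithin (extendReal f) (Set.Iic x) x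

/-- `x` is the leftmost point at which the right derivative of `f` is different from `1`.
Such a point exists exactly when `f` is non-trivial. -/
def IsXMinus (f : F) (x : ℝ) : Prop := IsLeast {t | t ∈ Set.Ico 0 1 ∧ rightDeriv f t ≠ 1} x

/-- `x` is the rightmost point at which the left derivative of `f` is different from `1`.
Such a point exists exactly when `f` is non-trivial. -/
def IsXPlus (f : F) (x : ℝ) : Prop := IsGreatest {t | t ∈ Set.Ioc 0 1 ∧ leftDeriv f t ≠ 1} x

/-! ### The positive cones of the eight special bi-orderings -/

/-- Labels of the four orderings `⪯_{x⁻}^+`, `⪯_{x⁻}^-`, `⪯_{x⁺}^+`, `⪯_{x⁺}^-`. -/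
inductive Main
  | xMinusPos
  | xMinusNeg
  | xPlusPos
  | xPlusNeg

/-- Labels of the four orderings `⪯_{0,x⁻}^{+,-}`, `⪯_{0,x⁻}^{-,+}`, `⪯_{1,x⁺}^{+,-}`,
`⪯_{1,x⁺}^{-,+}`. -/
inductive Exotic
  | zeroPosNeg
  | zeroNegPos
  | onePosNeg
  | oneNegPos

/-- The positive elements of `⪯_{x⁻}^+`, `⪯_{x⁻}^-`, `⪯_{x⁺}^+`, `⪯_{x⁺}^-`. -/
def mainCone : Main → Set F
  | .xMinusPos => {f | ∃ x, IsXMinus f x ∧ 1 < rightDeriv f x}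
  | .xMinusNeg => {f | ∃ x, IsXMinus f x ∧ rightDeriv f x < 1}
  | .xPlusPos => {f | ∃ x, IsXPlus f x ∧ leftDeriv f x < 1}
  | .xPlusNeg => {f | ∃ x, IsXPlus f x ∧ 1 < leftDeriv f x}

/-- The positive elements of `⪯_{0,x⁻}^{+,-}`, `⪯_{0,x⁻}^{-,+}`, `⪯_{1,x⁺}^{+,-}`,
`⪯_{1,x⁺}^{-,+}`. -/
def exoticCone : Exotic → Set F
  | .zeroPosNeg => {f | ∃ x, IsXMinus f x ∧
      ((x = 0 ∧ 1 < rightDeriv f 0) ∨ (x ≠ 0 ∧ rightDeriv f x < 1))}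
  | .zeroNegPos => {f | ∃ x, IsXMinus f x ∧
      ((x = 0 ∧ rightDeriv f 0 < 1) ∨ (x ≠ 0 ∧ 1 < rightDeriv f x))}
  | .onePosNeg => {f | ∃ x, IsXPlus f x ∧
      ((x = 1 ∧ leftDeriv f 1 < 1) ∨ (x ≠ 1 ∧ 1 < leftDeriv f x))}
  | .oneNegPos => {f | ∃ x, IsXPlus f x ∧
      ((x = 1 ∧ 1 < leftDeriv f 1) ∨ (x ≠ 1 ∧ leftDeriv f x < 1))}

/-- The eight cones together. -/
def isolCone : Main ⊕ Exotic → Set F := Sum.elim mainCone exoticCone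

/-- The set of the eight special bi-orderings on `F`. -/
def BOIsol : Set (BiOrdering F) := {r | ∃ i, r.HasCone (isolCone i)}

/-! ### Bi-orderings obtained by extension -/

/-- The group `ℤ²`, written multiplicatively. -/
abbrev Z2 : Type := Multiplicative (ℤ × ℤ)

/-- The map `f ↦ (log₂ f'_+(0), log₂ f'_-(1))`; both derivatives are integer powers of `2`, so
that the integer logarithm in base `2` is exact. -/
noncomputable def logDerivs (f : F) : Z2 :=
  Multiplicative.ofAdd (Int.log 2 (rightDeriv f 0), Int.log 2 (leftDeriv f 1))

/-- `r` is the bi-ordering on `F` determined by the bi-ordering `s` on `ℤ²` and the bi-ordering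
`r'` on `F'`: `f` is positive if and only if either `f ∉ F'` and
`(log₂ f'_+(0), log₂ f'_-(1))` is positive for `s`, or `f ∈ F'` and `f` is positive for `r'`. -/
def IsExtension (s : BiOrdering Z2) (r' : BiOrdering F') (r : BiOrdering F) : Prop :=
  ∀ f : F, r.Pos f ↔ (f ∉ F' ∧ s.Pos (logDerivs f)) ∨ ∃ h : f ∈ F', r'.Pos ⟨f, h⟩

/-- `r'` is the restriction to `F'` of the bi-ordering on `F` with label `i`. -/
def IsMainRestriction (r' : BiOrdering F') (i : Main) : Prop :=
  r'.HasCone {g : F' | (g : F) ∈ mainCone i}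

/-- The sets `Λ_{x⁻}^+`, `Λ_{x⁻}^-`, `Λ_{x⁺}^+`, `Λ_{x⁺}^-`: all bi-orderings on `F` obtained
from an arbitrary bi-ordering on `ℤ²` and the bi-ordering on `F'` with label `i`. -/
def Lambda (i : Main) : Set (BiOrdering F) :=
  {r | ∃ s r', IsMainRestriction r' i ∧ IsExtension s r' r}

end ThompsonBO

/-! Three facts about $F$ carry the proof. It is generated by `xZero` and its copy on $[1/2,1]$.
Hence every homomorphism to a commutative group depends only on the exponents of the slopes at $0$
and $1$ (`map_eq_zpow_mul_zpow`), and $F'$ consists of the elements that are the identity near both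
end points (`mem_derived_iff`). Finally, $F'$ contains the rescaled copy `midCopy` of $F$ and moves
interior dyadic points freely.

Orderings of $F'$. Restrict an ordering of $F'$ to the middle copy of $F$. Since $F$ is finitely
generated, some element has cofinal powers, and Hölder's argument gives a nonzero homomorphism
$\tau:F\to\mathbb R$ such that $\tau(g)>0$ implies $g\succ id$. It has the form
$\alpha\cdot$(exponent at $0$) $+\,\beta\cdot$(exponent at $1$). If $\alpha\ne0$, each nontrivial
element of $F'$ is conjugated into the middle copy with trivial germ at the right end, so its sign
is read off its first nontrivial germ. If $\beta\ne0$, the reflection $t\mapsto1-t$ reduces to this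
case. This gives the four orderings (`exists_firstRule`).

Orderings of $F$. If $F'$ is convex, the ordering descends to $F/F'=\mathbb Z^2$ and lies in some
$\Lambda$ (`mem_Lambda_of_convex`). Otherwise there are $f\notin F'$ and $g\in F'$ with $id\prec
f\prec g$. Say that $F'$ is ordered by first germs. A commutator argument shows that $f$ has slope
$1$ at $0$; powers of $f$ then make $F'$ cofinal among the elements of slope $1$ at $0$, and
comparison with $F'$ forces these to be ordered by first germs as well. Elements with another slope
at $0$ dominate them, so only the sign of `xZero` is left to choose
(`exists_firstCone_of_not_convex`). Two signs and the reflection give the eight special orderings.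

Topology. Non-convexity of $F'$ is an open condition, being witnessed by one pair $(f,g)$, and three
elements separate the eight orderings: these are therefore isolated. Orderings of $\mathbb Z^2$ are
encoded by binary sequences through the subtractive Euclidean algorithm, which identifies their
space with $2^{\mathbb N}$. Extension to $F$ is then a continuous bijection from a compact space to
a Hausdorff one. -/

namespace ThompsonBO

/-! ### Dyadic rational numbers -/

namespace IsDyadic

theorem intCast (a : ℤ) : IsDyadic a := ⟨a, 0, by simp⟩

theorem zero : IsDyadic 0 := by simpa using intCast 0

theorem one : IsDyadic 1 := by simpa using intCast 1

theorem zpow (k : ℤ) : IsDyadic ((2 : ℝ) ^ k) := by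
  obtain ⟨n, rfl | rfl⟩ := k.eq_nat_or_neg
  · exact ⟨2 ^ n, 0, by simp⟩
  · exact ⟨1, n, by simp⟩

theorem neg {x : ℝ} (hx : IsDyadic x) : IsDyadic (-x) := by
  obtain ⟨a, n, rfl⟩ := hx
  exact ⟨-a, n, by push_cast; ring⟩

theorem add {x y : ℝ} (hx : IsDyadic x) (hy : IsDyadic y) : IsDyadic (x + y) := by
  obtain ⟨a, n, rfl⟩ := hx
  obtain ⟨b, m, rfl⟩ := hy
  refine ⟨a * 2 ^ m + b * 2 ^ n, n + m, ?_⟩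
  push_cast
  rw [pow_add]
  field_simp

theorem sub {x y : ℝ} (hx : IsDyadic x) (hy : IsDyadic y) : IsDyadic (x - y) := by
  rw [sub_eq_add_neg]; exact hx.add hy.neg

theorem mul {x y : ℝ} (hx : IsDyadic x) (hy : IsDyadic y) : IsDyadic (x * y) := by
  obtain ⟨a, n, rfl⟩ := hx
  obtain ⟨b, m, rfl⟩ := hy
  refine ⟨a * b, n + m, ?_⟩
  push_cast
  rw [pow_add]
  field_simp

theorem inv_two_pow (n : ℕ) : IsDyadic (1 / 2 ^ n) := ⟨1, n, by simp⟩

theorem zpow_mul_add_iff {k : ℤ} {c x : ℝ} (hc : IsDyadic c) :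
    IsDyadic (2 ^ k * x + c) ↔ IsDyadic x := by
  refine ⟨fun h => ?_, fun h => ((zpow k).mul h).add hc⟩
  have h1 := (zpow (-k)).mul (h.sub hc)
  rwa [add_sub_cancel_right, ← mul_assoc, ← zpow_add₀ (by norm_num), neg_add_cancel, zpow_zero,
    one_mul] at h1

theorem exists_between {x y : ℝ} (h : x < y) : ∃ z, IsDyadic z ∧ x < z ∧ z < y := by
  obtain ⟨n, hn⟩ := exists_pow_lt_of_lt_one (sub_pos.2 h) (by norm_num : (1 / 2 : ℝ) < 1)
  have h2 : (0 : ℝ) < 2 ^ n := by positivity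
  rw [one_div, inv_pow] at hn
  have h3 : 1 < (y - x) * 2 ^ n := by
    rwa [inv_lt_iff_one_lt_mul₀ h2] at hn
  refine ⟨(⌊x * 2 ^ n⌋ + 1 : ℤ) / 2 ^ n, ⟨_, _, rfl⟩, ?_, ?_⟩
  · rw [lt_div_iff₀ h2]; push_cast; exact Int.lt_floor_add_one _
  · rw [div_lt_iff₀ h2]; push_cast
    have := Int.floor_le (x * 2 ^ n)
    nlinarith

end IsDyadic

/-! ### Dyadic piecewise linear functions -/

/-- `φ` is continuous, increasing and dyadically piecewise linear on `[a, b]`. -/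
inductive PL (φ : ℝ → ℝ) : ℝ → ℝ → Prop
  | aff {a b : ℝ} (k : ℤ) (c : ℝ) : a ≤ b → IsDyadic a → IsDyadic b → IsDyadic c →
      (∀ t ∈ Set.Icc a b, φ t = 2 ^ k * t + c) → PL φ a b
  | glue {a b c : ℝ} : PL φ a b → PL φ b c → PL φ a c

namespace PL

variable {φ ψ : ℝ → ℝ} {a b : ℝ}

theorem le (h : PL φ a b) : a ≤ b := by
  induction h with
  | aff => assumption
  | glue _ _ h1 h2 => exact h1.trans h2

theorem dyadic_right (h : PL φ a b) : IsDyadic b := by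
  induction h with
  | aff => assumption
  | glue _ _ h1 h2 => exact h2

theorem congr (h : PL φ a b) (he : ∀ t ∈ Set.Icc a b, ψ t = φ t) : PL ψ a b := by
  induction h with
  | aff k c h1 h2 h3 h4 h5 => exact aff k c h1 h2 h3 h4 fun t ht => (he t ht).trans (h5 t ht)
  | glue h1 h2 ih1 ih2 =>
    exact glue (ih1 fun t ht => he t ⟨ht.1, ht.2.trans h2.le⟩)
      (ih2 fun t ht => he t ⟨h1.le.trans ht.1, ht.2⟩)

theorem strictMonoOn (h : PL φ a b) : StrictMonoOn φ (Set.Icc a b) := by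
  induction h with
  | aff k c h1 h2 h3 h4 h5 =>
    intro x hx y hy hxy
    rw [h5 x hx, h5 y hy]
    have : (0 : ℝ) < 2 ^ k := by positivity
    nlinarith
  | @glue a b c h1 h2 ih1 ih2 =>
    intro x hx y hy hxy
    have hb1 : b ∈ Set.Icc a b := ⟨h1.le, le_rfl⟩
    have hb2 : b ∈ Set.Icc b c := ⟨le_rfl, h2.le⟩
    rcases le_total y b with hyb | hyb
    · exact ih1 ⟨hx.1, hxy.le.trans hyb⟩ ⟨hy.1, hyb⟩ hxy
    rcases le_total b x with hxb | hxb
    · exact ih2 ⟨hxb, hx.2⟩ ⟨hyb, hy.2⟩ hxy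
    · have e1 := ih1.monotoneOn ⟨hx.1, hxb⟩ hb1 hxb
      have e2 := ih2.monotoneOn hb2 ⟨hyb, hy.2⟩ hyb
      rcases hxb.lt_or_eq with hlt | rfl
      · exact (ih1 ⟨hx.1, hxb⟩ hb1 hlt).trans_le e2
      · exact ih2 hb2 ⟨hyb, hy.2⟩ hxy

theorem surjOn (h : PL φ a b) : Set.SurjOn φ (Set.Icc a b) (Set.Icc (φ a) (φ b)) := by
  induction h with
  | @aff a b k c h1 h2 h3 h4 h5 =>
    intro y hy
    rw [h5 a ⟨le_rfl, h1⟩, h5 b ⟨h1, le_rfl⟩] at hy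
    have hk : (0 : ℝ) < 2 ^ k := by positivity
    have hm : (y - c) / 2 ^ k ∈ Set.Icc a b :=
      ⟨by rw [le_div_iff₀ hk]; linarith [hy.1], by rw [div_le_iff₀ hk]; linarith [hy.2]⟩
    exact ⟨(y - c) / 2 ^ k, hm, by rw [h5 _ hm]; field_simp; ring⟩
  | @glue a b c h1 h2 ih1 ih2 =>
    intro y hy
    rcases le_total y (φ b) with h | h
    · obtain ⟨x, hx, e⟩ := ih1 ⟨hy.1, h⟩
      exact ⟨x, ⟨hx.1, hx.2.trans h2.le⟩, e⟩
    · obtain ⟨x, hx, e⟩ := ih2 ⟨h, hy.2⟩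
      exact ⟨x, ⟨h1.le.trans hx.1, hx.2⟩, e⟩

theorem dyadic_iff (h : PL φ a b) : ∀ t ∈ Set.Icc a b, (IsDyadic (φ t) ↔ IsDyadic t) := by
  induction h with
  | aff k c h1 h2 h3 h4 h5 =>
    intro t ht
    rw [h5 t ht, IsDyadic.zpow_mul_add_iff h4]
  | @glue a b c h1 h2 ih1 ih2 =>
    intro t ht
    rcases le_total t b with h | h
    · exact ih1 t ⟨ht.1, h⟩
    · exact ih2 t ⟨h, ht.2⟩

/-- Passage from the inductive description, convenient for constructions, to the one by finitely
many breakpoints in `IsDyadicPL`. Each junction is recorded as a breakpoint, so an interval avoiding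
the breakpoints stays on one side of it. -/
theorem exists_breakpoints (h : PL φ a b) : ∃ S : Finset ℝ, (∀ s ∈ S, IsDyadic s) ∧
    ∀ x y, a ≤ x → x < y → y ≤ b → (∀ s ∈ S, s ∉ Set.Ioo x y) →
      ∃ (k : ℤ) (c : ℝ), ∀ t ∈ Set.Icc x y, φ t = 2 ^ k * t + c := by
  classical
  induction h with
  | aff k c h1 h2 h3 h4 h5 =>
    exact ⟨∅, by simp, fun x y hx _ hy _ => ⟨k, c, fun t ht => h5 t ⟨hx.trans ht.1, ht.2.trans hy⟩⟩⟩
  | @glue a b c h1 h2 ih1 ih2 =>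
    obtain ⟨S, hS, hS'⟩ := ih1
    obtain ⟨T, hT, hT'⟩ := ih2
    refine ⟨insert b (S ∪ T), ?_, fun x y hx hxy hy hd => ?_⟩
    · intro s hs
      simp only [Finset.mem_insert, Finset.mem_union] at hs
      rcases hs with rfl | hs | hs
      · exact h1.dyadic_right
      · exact hS s hs
      · exact hT s hs
    · have hb := hd b (by simp)
      rcases le_total y b with h | h
      · exact hS' x y hx hxy h fun s hs => hd s (by simp [hs])
      rcases le_total b x with h' | h'
      · exact hT' x y h' hxy hy fun s hs => hd s (by simp [hs])
      rcases h'.lt_or_eq with h' | rfl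
      · rcases h.lt_or_eq with h | rfl
        · exact absurd ⟨h', h⟩ hb
        · exact hS' x _ hx hxy le_rfl fun s hs => hd s (by simp [hs])
      · exact hT' _ y le_rfl hxy hy fun s hs => hd s (by simp [hs])

theorem restrict (h : PL φ a b) {a' b' : ℝ} (ha : a ≤ a') (hab : a' ≤ b') (hb : b' ≤ b)
    (hda : IsDyadic a') (hdb : IsDyadic b') : PL φ a' b' := by
  induction h generalizing a' b' with
  | aff k c h1 h2 h3 h4 h5 =>
    exact aff k c hab hda hdb h4 fun t ht => h5 t ⟨ha.trans ht.1, ht.2.trans hb⟩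
  | @glue a m c h1 h2 ih1 ih2 =>
    rcases le_total b' m with h | h
    · exact ih1 ha hab h hda hdb
    rcases le_total m a' with h' | h'
    · exact ih2 h' hab hb hda hdb
    · exact glue (ih1 ha h' le_rfl hda h1.dyadic_right) (ih2 le_rfl h hb h1.dyadic_right hdb)

theorem id_on (hab : a ≤ b) (ha : IsDyadic a) (hb : IsDyadic b)
    (h : ∀ t ∈ Set.Icc a b, φ t = t) : PL φ a b :=
  aff 0 0 hab ha hb .zero fun t ht => by simp [h t ht]

/-- Conjugating by an affine map preserves piecewise linearity. -/
theorem conj_affine (h : PL φ a b) (k : ℤ) {p : ℝ} (hp : IsDyadic p)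
    (he : ∀ t ∈ Set.Icc a b, ψ (2 ^ k * t + p) = 2 ^ k * φ t + p) :
    PL ψ (2 ^ k * a + p) (2 ^ k * b + p) := by
  have hk : (0 : ℝ) < 2 ^ k := by positivity
  have hk' : (2 : ℝ) ^ k * 2 ^ (-k) = 1 := by
    rw [← zpow_add₀ (by norm_num)]; simp
  induction h with
  | @aff a b j c h1 h2 h3 h4 h5 =>
    refine aff j (2 ^ k * c + p - 2 ^ j * p) (by nlinarith)
      ((IsDyadic.zpow_mul_add_iff hp).2 h2) ((IsDyadic.zpow_mul_add_iff hp).2 h3)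
      ((((IsDyadic.zpow _).mul h4).add hp).sub ((IsDyadic.zpow _).mul hp)) fun t ht => ?_
    have e1 : t = 2 ^ k * (2 ^ (-k) * (t - p)) + p := by rw [← mul_assoc, hk']; ring
    have hm : 2 ^ (-k) * (t - p) ∈ Set.Icc a b := by
      constructor
      · rw [← mul_le_mul_iff_right₀ hk, ← mul_assoc, hk']; linarith [ht.1]
      · rw [← mul_le_mul_iff_right₀ hk, ← mul_assoc, hk']; linarith [ht.2]
    rw [e1, he _ hm, h5 _ hm]
    linear_combination (2 ^ j * p - 2 ^ j * t) * hk' + 2 ^ j * (t - p) * hk'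
  | glue h1 h2 ih1 ih2 =>
    exact glue (ih1 fun t ht => he t ⟨ht.1, ht.2.trans h2.le⟩)
      (ih2 fun t ht => he t ⟨h1.le.trans ht.1, ht.2⟩)

theorem flip (h : PL φ a b) (he : ∀ t ∈ Set.Icc a b, ψ (1 - t) = 1 - φ t) :
    PL ψ (1 - b) (1 - a) := by
  induction h with
  | @aff a b j c h1 h2 h3 h4 h5 =>
    refine aff j (1 - 2 ^ j - c) (by linarith) (IsDyadic.one.sub h3) (IsDyadic.one.sub h2)
      ((IsDyadic.one.sub (.zpow _)).sub h4) fun t ht => ?_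
    have hm : 1 - t ∈ Set.Icc a b := ⟨by linarith [ht.2], by linarith [ht.1]⟩
    have := he _ hm
    rw [h5 _ hm, sub_sub_cancel] at this
    rw [this]; ring
  | glue h1 h2 ih1 ih2 =>
    exact glue (ih2 fun t ht => he t ⟨h1.le.trans ht.1, ht.2⟩)
      (ih1 fun t ht => he t ⟨ht.1, ht.2.trans h2.le⟩)

/-- Either `φ` is the identity on `[a, b]`, or there is a first point where it leaves it. -/
theorem eq_id_or_exists_first (h : PL φ a b) (ha : φ a = a) :
    (∀ t ∈ Set.Icc a b, φ t = t) ∨ ∃ (x : ℝ) (k : ℤ), IsDyadic x ∧ a ≤ x ∧ x < b ∧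
      (∀ t ∈ Set.Icc a x, φ t = t) ∧ k ≠ 0 ∧
      ∃ y, x < y ∧ ∀ t ∈ Set.Icc x y, φ t = φ x + 2 ^ k * (t - x) := by
  induction h with
  | @aff a b j c h1 h2 h3 h4 h5 =>
    have h6 := h5 a ⟨le_rfl, h1⟩
    by_cases hj : j = 0
    · left
      intro t ht
      rw [h5 t ht]
      rw [ha, hj] at h6
      rw [hj]
      simp at h6 ⊢
      exact h6
    rcases h1.eq_or_lt with rfl | hlt
    · left; rintro t ⟨e1, e2⟩; rw [le_antisymm e2 e1, ha]
    · right
      refine ⟨a, j, h2, le_rfl, hlt, ?_, hj, b, hlt, fun t ht => ?_⟩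
      · rintro t ⟨e1, e2⟩; rw [le_antisymm e2 e1, ha]
      · rw [h5 t ht, h6]; ring
  | @glue a b c h1 h2 ih1 ih2 =>
    rcases ih1 ha with h | ⟨x, k, hx, hx1, hx2, hx3⟩
    · rcases ih2 (h b ⟨h1.le, le_rfl⟩) with h' | ⟨x, k, hx, hx1, hx2, hx3, hx4⟩
      · left
        intro t ht
        rcases le_total t b with e | e
        · exact h t ⟨ht.1, e⟩
        · exact h' t ⟨e, ht.2⟩
      · right
        refine ⟨x, k, hx, h1.le.trans hx1, hx2, fun t ht => ?_, hx4⟩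
        rcases le_total t b with e | e
        · exact h t ⟨ht.1, e⟩
        · exact hx3 t ⟨e, ht.2⟩
    · exact .inr ⟨x, k, hx, hx1, hx2.trans_le h2.le, hx3⟩

theorem exists_right_slope (h : PL φ a b) : ∀ x, a ≤ x → x < b →
    ∃ (k : ℤ) (y : ℝ), x < y ∧ ∀ t ∈ Set.Icc x y, φ t = φ x + 2 ^ k * (t - x) := by
  induction h with
  | @aff a b j c h1 h2 h3 h4 h5 =>
    intro x hx hxb
    refine ⟨j, b, hxb, fun t ht => ?_⟩
    rw [h5 t ⟨hx.trans ht.1, ht.2⟩, h5 x ⟨hx, hxb.le⟩]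
    ring
  | @glue a b c h1 h2 ih1 ih2 =>
    intro x hx hxb
    rcases lt_or_ge x b with h | h
    · exact ih1 x hx h
    · exact ih2 x h hxb

end PL

/-! ### Interpolation and gluing of piecewise linear maps -/

/-- Two slopes suffice: if $2^k\le(d-c)/(b-a)<2^{k+1}$, use slope $2^{k+1}$ up to a point $m$ and
$2^k$ afterwards. The total rise is $d-c$ exactly when $m-a=2^{-k}(d-c)-(b-a)$, which is dyadic, and
the bounds on the ratio place $m$ in $[a,b]$. -/
theorem exists_PL_interp {a b c d : ℝ} (ha : IsDyadic a) (hb : IsDyadic b) (hc : IsDyadic c)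
    (hd : IsDyadic d) (hab : a < b) (hcd : c < d) : ∃ φ, PL φ a b ∧ φ a = c ∧ φ b = d := by
  have hl : 0 < b - a := sub_pos.2 hab
  have hr : 0 < (d - c) / (b - a) := div_pos (sub_pos.2 hcd) hl
  obtain ⟨k, hk1, hk2⟩ := exists_mem_Ico_zpow hr one_lt_two
  rw [le_div_iff₀ hl] at hk1
  rw [div_lt_iff₀ hl] at hk2
  have hk : (0 : ℝ) < 2 ^ k := by positivity
  have hk' : (2 : ℝ) ^ k * 2 ^ (-k) = 1 := by
    rw [← zpow_add₀ (by norm_num)]; simp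
  have hk3 : (2 : ℝ) ^ (k + 1) = 2 ^ k * 2 := by rw [zpow_add₀ (by norm_num), zpow_one]
  rw [hk3] at hk2
  set m : ℝ := a + (2 ^ (-k) * (d - c) - (b - a)) with hm
  have hmd : IsDyadic m := ha.add (((IsDyadic.zpow _).mul (hd.sub hc)).sub (hb.sub ha))
  have e1 : (2 : ℝ) ^ k * m = 2 ^ k * a + (d - c) - 2 ^ k * (b - a) := by
    rw [hm]; linear_combination (d - c) * hk'
  have ham : a ≤ m := by
    rw [← mul_le_mul_iff_right₀ hk, e1]; linarith
  have hmb : m ≤ b := by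
    rw [← mul_le_mul_iff_right₀ hk, e1]; nlinarith
  refine ⟨fun t => if t ≤ m then 2 ^ (k + 1) * t + (c - 2 ^ (k + 1) * a)
    else 2 ^ k * t + (d - 2 ^ k * b), ?_, ?_, ?_⟩
  · refine .glue (.aff (b := m) (k + 1) (c - 2 ^ (k + 1) * a) ham ha hmd
      (hc.sub ((IsDyadic.zpow _).mul ha)) ?_)
      (.aff k (d - 2 ^ k * b) hmb hmd hb (hd.sub ((IsDyadic.zpow _).mul hb)) ?_)
    · intro t ht; simp [ht.2]
    · intro t ht
      split_ifs with h
      · obtain rfl := le_antisymm h ht.1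
        rw [hk3]
        linear_combination e1
      · rfl
  · simp [ham]
  · simp only
    split_ifs with h
    · rw [hk3]
      linear_combination e1 + 2 ^ k * le_antisymm h hmb
    · ring

theorem exists_PL_glue {φ ψ : ℝ → ℝ} {a b c : ℝ} (h1 : PL φ a b) (h2 : PL ψ b c)
    (hb : φ b = ψ b) : ∃ χ, PL χ a c ∧ (∀ t ≤ b, χ t = φ t) ∧ ∀ t ≥ b, χ t = ψ t := by
  have e : ∀ t ≥ b, (if t ≤ b then φ t else ψ t) = ψ t := fun t ht => by
    split_ifs with h
    · rw [le_antisymm h ht, hb]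
    · rfl
  refine ⟨fun t => if t ≤ b then φ t else ψ t, .glue (h1.congr fun t ht => ?_)
    (h2.congr fun t ht => e t ht.1), fun t ht => ?_, e⟩ <;> simp [*]
  intro h; exact absurd ht.2 (not_le.2 h)

/-! ### Elements of `F` as functions on the real line -/

theorem extendReal_of_mem (f : F) {t : ℝ} (h : t ∈ unitInterval) :
    extendReal f t = ((f : unitInterval ≃ₜ unitInterval) ⟨t, h⟩ : unitInterval) := by
  simp [extendReal, h]

theorem extendReal_of_notMem (f : F) {t : ℝ} (h : t ∉ unitInterval) : extendReal f t = t := by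
  simp [extendReal, h]

theorem extendReal_coe (f : F) (t : unitInterval) :
    extendReal f t = ((f : unitInterval ≃ₜ unitInterval) t : unitInterval) :=
  extendReal_of_mem f t.2

theorem extendReal_mem (f : F) {t : ℝ} (h : t ∈ unitInterval) :
    extendReal f t ∈ unitInterval := by
  rw [extendReal_of_mem f h]; exact Subtype.coe_prop _

@[simp] theorem extendReal_one (t : ℝ) : extendReal 1 t = t := by
  by_cases h : t ∈ unitInterval
  · rw [extendReal_of_mem _ h]; rfl
  · exact extendReal_of_notMem _ h

theorem extendReal_mul (f g : F) (t : ℝ) :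
    extendReal (f * g) t = extendReal f (extendReal g t) := by
  by_cases h : t ∈ unitInterval
  · rw [extendReal_of_mem _ h, extendReal_of_mem _ h, extendReal_coe]; rfl
  · simp [extendReal_of_notMem _ h]

@[simp] theorem extendReal_inv_apply (f : F) (t : ℝ) :
    extendReal f⁻¹ (extendReal f t) = t := by
  rw [← extendReal_mul]; simp

@[simp] theorem extendReal_apply_inv (f : F) (t : ℝ) :
    extendReal f (extendReal f⁻¹ t) = t := by
  rw [← extendReal_mul]; simp

theorem F_ext {f g : F} (h : ∀ t ∈ unitInterval, extendReal f t = extendReal g t) : f = g := by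
  refine Subtype.ext (Homeomorph.ext fun t => Subtype.ext ?_)
  rw [← extendReal_coe, ← extendReal_coe]
  exact h t t.2

theorem extendReal_strictMono (f : F) : StrictMono (extendReal f) := by
  have hf : StrictMono (f : unitInterval ≃ₜ unitInterval) := f.2.1
  intro x y hxy
  by_cases hx : x ∈ unitInterval <;> by_cases hy : y ∈ unitInterval
  · rw [extendReal_of_mem _ hx, extendReal_of_mem _ hy]
    exact hf (a := ⟨x, hx⟩) (b := ⟨y, hy⟩) hxy
  · rw [extendReal_of_notMem _ hy]
    have h1 := (extendReal_mem f hx).2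
    have h2 : 1 < y := by
      by_contra h; exact hy ⟨hx.1.trans hxy.le, not_lt.1 h⟩
    linarith
  · rw [extendReal_of_notMem _ hx]
    have h1 := (extendReal_mem f hy).1
    have h2 : x < 0 := by
      by_contra h; exact hx ⟨not_lt.1 h, hxy.le.trans hy.2⟩
    linarith
  · rwa [extendReal_of_notMem _ hx, extendReal_of_notMem _ hy]

theorem extendReal_zero (f : F) : extendReal f 0 = 0 := by
  have h0 : (0 : ℝ) ∈ unitInterval := ⟨le_rfl, zero_le_one⟩
  refine le_antisymm ?_ (extendReal_mem f h0).1
  have := (extendReal_strictMono f).monotone (extendReal_mem f⁻¹ h0).1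
  simpa using this

theorem extendReal_one_right (f : F) : extendReal f 1 = 1 := by
  have h0 : (1 : ℝ) ∈ unitInterval := ⟨zero_le_one, le_rfl⟩
  refine le_antisymm (extendReal_mem f h0).2 ?_
  have := (extendReal_strictMono f).monotone (extendReal_mem f⁻¹ h0).2
  simpa using this

theorem extendReal_of_nonpos (f : F) {t : ℝ} (h : t ≤ 0) : extendReal f t = t := by
  rcases h.lt_or_eq with h | rfl
  · exact extendReal_of_notMem f fun h' => absurd h'.1 (not_le.2 h)
  · exact extendReal_zero f

theorem extendReal_of_one_le (f : F) {t : ℝ} (h : 1 ≤ t) : extendReal f t = t := by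
  rcases h.lt_or_eq with h | rfl
  · exact extendReal_of_notMem f fun h' => absurd h'.2 (not_le.2 h)
  · exact extendReal_one_right f

theorem extendReal_dyadic_iff (f : F) (t : ℝ) : IsDyadic (extendReal f t) ↔ IsDyadic t := by
  by_cases h : t ∈ unitInterval
  · rw [extendReal_of_mem f h]; exact f.2.2.2 ⟨t, h⟩
  · rw [extendReal_of_notMem f h]

/-- Induction on the number of breakpoints inside the interval, splitting at one of them. On an
interval without breakpoints the map is affine, and its constant term is dyadic because `f` sends
the dyadic point `a` to a dyadic point. -/
theorem PL_extendReal_unit (f : F) {a b : ℝ} (ha : 0 ≤ a) (hb : b ≤ 1) (hab : a ≤ b)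
    (hda : IsDyadic a) (hdb : IsDyadic b) : PL (extendReal f) a b := by
  classical
  obtain ⟨S, hS, hSf⟩ := f.2.2.1
  set T : Finset ℝ := S.image (fun s : unitInterval => (s : ℝ)) with hT
  have hT' : ∀ s ∈ T, IsDyadic s := by
    intro s hs
    obtain ⟨u, hu, rfl⟩ := Finset.mem_image.1 hs
    exact hS u hu
  induction hn : (T.filter fun s => s ∈ Set.Ioo a b).card using Nat.strong_induction_on
    generalizing a b with
  | _ n ih =>
    rcases hab.eq_or_lt with rfl | hlt
    · exact .aff 0 (extendReal f a - a) le_rfl hda hda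
        (((extendReal_dyadic_iff f a).2 hda).sub hda) fun t ht => by
          rw [le_antisymm ht.2 ht.1]; simp
    by_cases hne : (T.filter fun s => s ∈ Set.Ioo a b).Nonempty
    · obtain ⟨s, hs⟩ := hne
      obtain ⟨hs1, hs2⟩ := Finset.mem_filter.1 hs
      refine .glue (b := s) (ih _ ?_ ha (hs2.2.le.trans hb) hs2.1.le hda (hT' s hs1) rfl)
        (ih _ ?_ (ha.trans hs2.1.le) hb hs2.2.le (hT' s hs1) hdb rfl)
      all_goals
        rw [← hn]
        refine Finset.card_lt_card ⟨fun u hu => ?_, fun h => ?_⟩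
      · rw [Finset.mem_filter] at hu ⊢
        exact ⟨hu.1, hu.2.1, hu.2.2.trans hs2.2⟩
      · exact lt_irrefl _ (Finset.mem_filter.1 (h hs)).2.2
      · rw [Finset.mem_filter] at hu ⊢
        exact ⟨hu.1, hs2.1.trans hu.2.1, hu.2.2⟩
      · exact lt_irrefl _ (Finset.mem_filter.1 (h hs)).2.1
    · obtain ⟨k, c, h⟩ := hSf ⟨a, ha, hab.trans hb⟩ ⟨b, ha.trans hab, hb⟩ hlt fun s hs hI =>
        hne ⟨s, Finset.mem_filter.2 ⟨Finset.mem_image_of_mem _ hs, hI.1, hI.2⟩⟩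
      have h' : ∀ t ∈ Set.Icc a b, extendReal f t = 2 ^ k * t + c := fun t ht => by
        have hm : t ∈ unitInterval := ⟨ha.trans ht.1, ht.2.trans hb⟩
        rw [extendReal_of_mem f hm]
        exact h ⟨t, hm⟩ ht
      refine .aff k c hab hda hdb ?_ h'
      have h2 := h' a ⟨le_rfl, hab⟩
      have h3 : c = extendReal f a - 2 ^ k * a := by rw [h2]; ring
      rw [h3]
      exact ((extendReal_dyadic_iff f a).2 hda).sub ((IsDyadic.zpow _).mul hda)

/-- Outside $[0,1]$ the extension is the identity, so no restriction on the interval is needed.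
Rescaling arguments use this on intervals larger than $[0,1]$. -/
theorem PL_extendReal (f : F) {a b : ℝ} (hab : a ≤ b) (hda : IsDyadic a) (hdb : IsDyadic b) :
    PL (extendReal f) a b := by
  have h1 : PL (extendReal f) (min a 0) 0 :=
    .id_on (min_le_right _ _) (by rcases min_choice a 0 with h | h <;> simp [h, hda, IsDyadic.zero])
      .zero fun t ht => extendReal_of_nonpos f ht.2
  have h2 : PL (extendReal f) 1 (max b 1) :=
    .id_on (le_max_right _ _) .one
      (by rcases max_choice b 1 with h | h <;> simp [h, hdb, IsDyadic.one])
      fun t ht => extendReal_of_one_le f ht.1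
  exact ((h1.glue (PL_extendReal_unit f le_rfl le_rfl zero_le_one .zero .one)).glue h2).restrict
    (min_le_left _ _) hab (le_max_left _ _) hda hdb

/-- A piecewise linear function is strictly increasing and onto, hence an order isomorphism of
$[0,1]$, and order isomorphisms are homeomorphisms; continuity needs no separate check. -/
theorem exists_extendReal_eq {φ : ℝ → ℝ} (h : PL φ 0 1) (h0 : φ 0 = 0) (h1 : φ 1 = 1) :
    ∃ f : F, ∀ t ∈ unitInterval, extendReal f t = φ t := by
  have hm := h.strictMonoOn
  have hmem : ∀ t ∈ unitInterval, φ t ∈ unitInterval := fun t ht => by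
    constructor
    · rw [← h0]; exact hm.monotoneOn ⟨le_rfl, zero_le_one⟩ ht ht.1
    · rw [← h1]; exact hm.monotoneOn ht ⟨zero_le_one, le_rfl⟩ ht.2
  let u : unitInterval → unitInterval := fun t => ⟨φ t, hmem t t.2⟩
  have hu : StrictMono u := fun x y hxy => hm x.2 y.2 hxy
  have hs : Function.Surjective u := fun y => by
    have hy : (y : ℝ) ∈ Set.Icc (φ 0) (φ 1) := by rw [h0, h1]; exact y.2
    obtain ⟨x, hx, e⟩ := h.surjOn hy
    exact ⟨⟨x, hx⟩, Subtype.ext e⟩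
  let w : unitInterval ≃ₜ unitInterval := (hu.orderIsoOfSurjective u hs).toHomeomorph
  have hw : ∀ t, ((w t : unitInterval) : ℝ) = φ t := fun t => rfl
  have hwF : w ∈ thompsonF := by
    refine ⟨hu, ?_, fun x => ?_⟩
    · obtain ⟨S, hS, hSf⟩ := h.exists_breakpoints
      refine ⟨S.preimage Subtype.val Subtype.val_injective.injOn, fun s hs => ?_, ?_⟩
      · exact hS s (Finset.mem_preimage.1 hs)
      · intro x y hxy hd
        obtain ⟨k, c, e⟩ := hSf x y x.2.1 hxy y.2.2 fun s hs hI =>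
          hd ⟨s, x.2.1.trans hI.1.le, hI.2.le.trans y.2.2⟩ (Finset.mem_preimage.2 hs)
            ⟨hI.1, hI.2⟩
        exact ⟨k, c, fun t ht => by rw [hw]; exact e t ht⟩
    · rw [hw]; exact h.dyadic_iff x x.2
  exact ⟨⟨w, hwF⟩, fun t ht => by rw [extendReal_of_mem _ ht]; exact hw ⟨t, ht⟩⟩

/-! ### Rescaled copies, and the flip -/

theorem two_zpow_mul_neg (k : ℤ) : (2 : ℝ) ^ k * 2 ^ (-k) = 1 := by
  rw [← zpow_add₀ (by norm_num)]; simp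

/-- Conjugation of the extended map by $t\mapsto2^kt+p$. The equation is required for every real
`t`, so that the affine map can be cancelled without case distinctions when products are compared.
-/
theorem exists_copy (k : ℤ) {p : ℝ} (hp : IsDyadic p) (h0 : 0 ≤ p) (h1 : 2 ^ k + p ≤ 1) (f : F) :
    ∃ g : F, ∀ t, extendReal g (2 ^ k * t + p) = 2 ^ k * extendReal f t + p := by
  have hk : (0 : ℝ) < 2 ^ k := by positivity
  have hk' := two_zpow_mul_neg k
  have e : ∀ t : ℝ, 2 ^ k * (2 ^ (-k) * (t - p)) + p = t := fun t => by
    rw [← mul_assoc, hk']; ring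
  have e' : ∀ t : ℝ, 2 ^ (-k) * ((2 ^ k * t + p) - p) = t := fun t => by
    linear_combination t * hk'
  set ψ : ℝ → ℝ := fun t => 2 ^ k * extendReal f (2 ^ (-k) * (t - p)) + p with hψ
  have hψ' : ∀ t, ψ (2 ^ k * t + p) = 2 ^ k * extendReal f t + p := fun t => by
    simp only [hψ]; rw [e']
  have hk2 : (0 : ℝ) < 2 ^ (-k) := by positivity
  have hlo : ∀ t ≤ p, ψ t = t := fun t ht => by
    simp only [hψ]
    rw [extendReal_of_nonpos _ (by nlinarith), e]
  have hhi : ∀ t ≥ 2 ^ k + p, ψ t = t := fun t ht => by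
    simp only [hψ]
    rw [extendReal_of_one_le _ ?_, e]
    rw [← mul_le_mul_iff_right₀ hk, ← mul_assoc, hk']; linarith
  -- The end points chosen for `f` are the preimages of $0$ and $1$ under the affine map; they may
  -- lie outside $[0,1]$.
  have hPL : PL ψ 0 1 := by
    have := (PL_extendReal f (a := 2 ^ (-k) * (0 - p)) (b := 2 ^ (-k) * (1 - p)) (by nlinarith)
      ((IsDyadic.zpow _).mul (IsDyadic.zero.sub hp))
      ((IsDyadic.zpow _).mul (IsDyadic.one.sub hp))).conj_affine (ψ := ψ) k hp fun t _ => hψ' t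
    rwa [e, e] at this
  obtain ⟨g, hg⟩ := exists_extendReal_eq hPL (hlo 0 h0) (hhi 1 h1)
  refine ⟨g, fun t => ?_⟩
  rw [← hψ']
  by_cases h : 2 ^ k * t + p ∈ unitInterval
  · exact hg _ h
  rw [extendReal_of_notMem _ h]
  rcases lt_or_ge (2 ^ k * t + p) 0 with h' | h'
  · rw [hlo]; linarith
  · rw [hhi]
    by_contra h''
    exact h ⟨h', by linarith⟩

theorem exists_affine_eq (k : ℤ) (p t : ℝ) : ∃ s, t = 2 ^ k * s + p :=
  ⟨2 ^ (-k) * (t - p), by rw [← mul_assoc, two_zpow_mul_neg]; ring⟩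

/-- The copy of Thompson's group supported in the dyadic interval `[p, p + 2 ^ k]`. -/
noncomputable def copy (k : ℤ) (p : ℝ) (hp : IsDyadic p) (h0 : 0 ≤ p) (h1 : 2 ^ k + p ≤ 1) :
    F →* F :=
  MonoidHom.mk' (fun f => (exists_copy k hp h0 h1 f).choose) fun f g => by
    have h := fun f => (exists_copy k hp h0 h1 f).choose_spec
    refine F_ext fun t _ => ?_
    obtain ⟨s, rfl⟩ := exists_affine_eq k p t
    rw [extendReal_mul, h, h, h, extendReal_mul]

section copy

variable {k : ℤ} {p : ℝ} {hp : IsDyadic p} {h0 : 0 ≤ p} {h1 : 2 ^ k + p ≤ 1}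

theorem extendReal_copy (f : F) (t : ℝ) :
    extendReal (copy k p hp h0 h1 f) (2 ^ k * t + p) = 2 ^ k * extendReal f t + p :=
  (exists_copy k hp h0 h1 f).choose_spec t

theorem copy_injective : Function.Injective (copy k p hp h0 h1) := fun f g h => by
  refine F_ext fun t _ => ?_
  have e := extendReal_copy (hp := hp) (h0 := h0) (h1 := h1) f t
  rw [h, extendReal_copy] at e
  have hk : (2 : ℝ) ^ k ≠ 0 := by positivity
  exact (mul_left_cancel₀ hk (add_right_cancel e)).symm

theorem extendReal_copy_of_le (f : F) {t : ℝ} (ht : t ≤ p) :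
    extendReal (copy k p hp h0 h1 f) t = t := by
  obtain ⟨s, rfl⟩ := exists_affine_eq k p t
  have hk : (0 : ℝ) < 2 ^ k := by positivity
  rw [extendReal_copy, extendReal_of_nonpos]
  nlinarith

theorem extendReal_copy_of_ge (f : F) {t : ℝ} (ht : 2 ^ k + p ≤ t) :
    extendReal (copy k p hp h0 h1 f) t = t := by
  obtain ⟨s, rfl⟩ := exists_affine_eq k p t
  have hk : (0 : ℝ) < 2 ^ k := by positivity
  rw [extendReal_copy, extendReal_of_one_le]
  nlinarith

theorem exists_copy_eq (g : F) (hlo : ∀ t ≤ p, extendReal g t = t)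
    (hhi : ∀ t ≥ 2 ^ k + p, extendReal g t = t) : ∃ f, copy k p hp h0 h1 f = g := by
  have hk : (0 : ℝ) < 2 ^ k := by positivity
  have hk' := two_zpow_mul_neg k
  have e : ∀ t : ℝ, 2 ^ k * (2 ^ (-k) * (t - p)) + p = t := fun t => by
    rw [← mul_assoc, hk']; ring
  have e' : ∀ t : ℝ, 2 ^ (-k) * ((2 ^ k * t + p) - p) = t := fun t => by
    linear_combination t * hk'
  set ψ : ℝ → ℝ := fun t => 2 ^ (-k) * (extendReal g (2 ^ k * t + p) - p) with hψ
  have hPL : PL ψ 0 1 := by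
    have := (PL_extendReal g (a := 2 ^ k * 0 + p) (b := 2 ^ k * 1 + p) (by linarith)
      ((IsDyadic.zpow_mul_add_iff hp).2 .zero)
      ((IsDyadic.zpow_mul_add_iff hp).2 .one)).conj_affine (ψ := ψ) (-k)
      (p := 2 ^ (-k) * -p) ((IsDyadic.zpow _).mul hp.neg) fun t _ => by
        simp only [hψ]
        rw [← mul_add, ← sub_eq_add_neg, e]; ring
    rw [← mul_add, ← sub_eq_add_neg, e', ← mul_add, ← sub_eq_add_neg, e'] at this
    exact this
  obtain ⟨f, hf⟩ := exists_extendReal_eq hPL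
    (by simp only [hψ]; rw [hlo _ (by linarith), e'])
    (by simp only [hψ]; rw [hhi _ (by linarith), e'])
  refine ⟨f, F_ext fun t _ => ?_⟩
  obtain ⟨s, rfl⟩ := exists_affine_eq k p t
  rw [extendReal_copy]
  by_cases h : s ∈ unitInterval
  · rw [hf s h]; exact e _
  rw [extendReal_of_notMem _ h]
  rcases lt_or_ge s 0 with h' | h'
  · rw [hlo]; nlinarith
  · have h2 : 1 < s := by
      by_contra h''
      exact h ⟨h', by linarith⟩
    rw [hhi]; nlinarith

end copy

theorem exists_flip (f : F) : ∃ g : F, ∀ t, extendReal g (1 - t) = 1 - extendReal f t := by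
  set ψ : ℝ → ℝ := fun t => 1 - extendReal f (1 - t) with hψ
  have hψ' : ∀ t, ψ (1 - t) = 1 - extendReal f t := fun t => by simp [hψ]
  have hPL : PL ψ 0 1 := by
    simpa using (PL_extendReal f zero_le_one .zero .one).flip (ψ := ψ) fun t _ => hψ' t
  obtain ⟨g, hg⟩ := exists_extendReal_eq hPL
    (by simp only [hψ, sub_zero, extendReal_one_right, sub_self])
    (by simp only [hψ, sub_zero, extendReal_zero, sub_self])
  refine ⟨g, fun t => ?_⟩
  rw [← hψ']
  by_cases h : 1 - t ∈ unitInterval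
  · exact hg _ h
  · have h' : t ∉ unitInterval := fun h2 => h ⟨by linarith [h2.2], by linarith [h2.1]⟩
    rw [hψ', extendReal_of_notMem _ h, extendReal_of_notMem _ h']

/-- The involutive automorphism of `F` induced by `t ↦ 1 - t`. -/
noncomputable def flip : F →* F :=
  MonoidHom.mk' (fun f => (exists_flip f).choose) fun f g => by
    have h := fun f => (exists_flip f).choose_spec
    refine F_ext fun t _ => ?_
    obtain ⟨s, rfl⟩ : ∃ s, t = 1 - s := ⟨1 - t, by ring⟩
    rw [extendReal_mul, h, h, h, extendReal_mul]

theorem extendReal_flip (f : F) (t : ℝ) : extendReal (flip f) t = 1 - extendReal f (1 - t) := by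
  have := (exists_flip f).choose_spec (1 - t)
  rwa [sub_sub_cancel] at this

@[simp] theorem flip_flip (f : F) : flip (flip f) = f :=
  F_ext fun t _ => by simp [extendReal_flip]

theorem flip_injective : Function.Injective flip := Function.LeftInverse.injective flip_flip

/-! ### Transitivity on interior dyadic points -/

theorem exists_PL_extend {φ : ℝ → ℝ} {p a b c d : ℝ} (h : PL φ p a) (hc : φ a = c) (hab : a < b)
    (hcd : c < d) (hb : IsDyadic b) (hdd : IsDyadic d) :
    ∃ χ, PL χ p b ∧ χ b = d ∧ ∀ t ≤ a, χ t = φ t := by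
  have hdc : IsDyadic c := by
    rw [← hc, h.dyadic_iff a ⟨h.le, le_rfl⟩]; exact h.dyadic_right
  obtain ⟨ψ, h1, h2, h3⟩ := exists_PL_interp h.dyadic_right hb hdc hdd hab hcd
  obtain ⟨χ, h4, h5, h6⟩ := exists_PL_glue h h1 (hc.trans h2.symm)
  exact ⟨χ, h4, (h6 b hab.le).trans h3, h5⟩

/-- Elements of `F` with trivial germs at the end points act transitively on pairs of interior
dyadic points. -/
theorem exists_map_pair {a b c d : ℝ} (ha : IsDyadic a) (hb : IsDyadic b) (hc : IsDyadic c)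
    (hd : IsDyadic d) (h0a : 0 < a) (hab : a < b) (hb1 : b < 1) (h0c : 0 < c) (hcd : c < d)
    (hd1 : d < 1) : ∃ w : F, extendReal w a = c ∧ extendReal w b = d ∧
      (∃ y > 0, ∀ t ≤ y, extendReal w t = t) ∧ ∃ y < 1, ∀ t ≥ y, extendReal w t = t := by
  -- The map will be the identity below `ε` and above `δ`, with three interpolated pieces sending
  -- `ε, a, b, δ` to `ε, c, d, δ`.
  obtain ⟨ε, hε, hε0, hε1⟩ := IsDyadic.exists_between (lt_min h0a h0c)
  obtain ⟨δ, hδ, hδ0, hδ1⟩ := IsDyadic.exists_between (max_lt hb1 hd1)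
  rw [lt_min_iff] at hε1
  rw [max_lt_iff] at hδ0
  have p0 : PL (fun t => t) 0 ε := .id_on hε0.le .zero hε fun _ _ => rfl
  obtain ⟨φ₁, p1, q1, r1⟩ := exists_PL_extend p0 rfl hε1.1 hε1.2 ha hc
  obtain ⟨φ₂, p2, q2, r2⟩ := exists_PL_extend p1 q1 hab hcd hb hd
  obtain ⟨φ₃, p3, q3, r3⟩ := exists_PL_extend p2 q2 hδ0.1 hδ0.2 hδ hδ
  have p4 : PL (fun t => t) δ 1 := .id_on hδ1.le hδ .one fun _ _ => rfl
  obtain ⟨χ, p5, r4, r5⟩ := exists_PL_glue p3 p4 q3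
  have hid : ∀ t ≤ ε, χ t = t := fun t ht => by
    rw [r4 t (by linarith), r3 t (by linarith), r2 t (by linarith), r1 t ht]
  obtain ⟨w, hw⟩ := exists_extendReal_eq p5 (hid 0 hε0.le) (r5 1 hδ1.le)
  refine ⟨w, ?_, ?_, ⟨ε, hε0, fun t ht => ?_⟩, ⟨δ, hδ1, fun t ht => ?_⟩⟩
  · rw [hw a ⟨by linarith, by linarith⟩, r4 a (by linarith), r3 a (by linarith), r2 a le_rfl, q1]
  · rw [hw b ⟨by linarith, by linarith⟩, r4 b (by linarith), r3 b le_rfl, q2]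
  · by_cases h : t ∈ unitInterval
    · rw [hw t h, hid t ht]
    · exact extendReal_of_notMem _ h
  · by_cases h : t ∈ unitInterval
    · rw [hw t h, r5 t ht]
    · exact extendReal_of_notMem _ h

/-! ### Germs -/

/-- The slope of `f` on the right of `x` is `2 ^ k`. -/
def RGerm (f : F) (x : ℝ) (k : ℤ) : Prop :=
  ∃ y, x < y ∧ ∀ t ∈ Set.Icc x y, extendReal f t = extendReal f x + 2 ^ k * (t - x)

/-- The slope of `f` on the left of `x` is `2 ^ k`. -/
def LGerm (f : F) (x : ℝ) (k : ℤ) : Prop :=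
  ∃ y, y < x ∧ ∀ t ∈ Set.Icc y x, extendReal f t = extendReal f x + 2 ^ k * (t - x)

theorem lGerm_iff {f : F} {x : ℝ} {k : ℤ} : LGerm f x k ↔ RGerm (flip f) (1 - x) k := by
  constructor
  · rintro ⟨y, hy, h⟩
    refine ⟨1 - y, by linarith, fun t ht => ?_⟩
    rw [extendReal_flip, extendReal_flip, sub_sub_cancel,
      h (1 - t) ⟨by linarith [ht.2], by linarith [ht.1]⟩]
    ring
  · rintro ⟨y, hy, h⟩
    refine ⟨1 - y, by linarith, fun t ht => ?_⟩
    have := h (1 - t) ⟨by linarith [ht.2], by linarith [ht.1]⟩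
    rw [extendReal_flip, extendReal_flip, sub_sub_cancel, sub_sub_cancel] at this
    linear_combination -this

theorem RGerm.exists (f : F) {x : ℝ} (h0 : 0 ≤ x) (h1 : x < 1) : ∃ k, RGerm f x k :=
  (PL_extendReal f zero_le_one .zero .one).exists_right_slope x h0 h1

theorem RGerm.unique {f : F} {x : ℝ} {k l : ℤ} (hk : RGerm f x k) (hl : RGerm f x l) : k = l := by
  obtain ⟨y, hy, h⟩ := hk
  obtain ⟨z, hz, h'⟩ := hl
  have hm : x < min y z := lt_min hy hz
  have e1 := h _ ⟨hm.le, min_le_left _ _⟩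
  rw [h' _ ⟨hm.le, min_le_right _ _⟩] at e1
  have e2 := mul_right_cancel₀ (sub_ne_zero.2 hm.ne') (add_left_cancel e1)
  exact (zpow_right_injective₀ (by norm_num : (0 : ℝ) < 2) (by norm_num) e2).symm

theorem RGerm.mul {f g : F} {x : ℝ} {k l : ℤ} (hf : RGerm f (extendReal g x) k)
    (hg : RGerm g x l) : RGerm (f * g) x (k + l) := by
  obtain ⟨y, hy, h⟩ := hf
  obtain ⟨z, hz, h'⟩ := hg
  have hgi : x < extendReal g⁻¹ y := by
    rw [← (extendReal_strictMono g).lt_iff_lt]; simpa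
  refine ⟨min (extendReal g⁻¹ y) z, lt_min hgi hz, fun t ht => ?_⟩
  have ht1 : extendReal g t ≤ y := by
    have := (extendReal_strictMono g).monotone (ht.2.trans (min_le_left _ _))
    simpa using this
  rw [extendReal_mul, extendReal_mul, h _ ⟨(extendReal_strictMono g).monotone ht.1, ht1⟩,
    h' t ⟨ht.1, ht.2.trans (min_le_right _ _)⟩, zpow_add₀ (by norm_num)]
  ring

theorem RGerm.one (x : ℝ) : RGerm 1 x 0 := ⟨x + 1, by linarith, fun t _ => by simp⟩

theorem RGerm.inv {f : F} {x : ℝ} {k : ℤ} (hf : RGerm f x k) :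
    RGerm f⁻¹ (extendReal f x) (-k) := by
  obtain ⟨y, hy, h⟩ := hf
  refine ⟨extendReal f y, extendReal_strictMono f hy, fun t ht => ?_⟩
  have e1 := (extendReal_strictMono f⁻¹).monotone ht.1
  have e2 := (extendReal_strictMono f⁻¹).monotone ht.2
  simp only [extendReal_inv_apply] at e1 e2 ⊢
  have := h _ ⟨e1, e2⟩
  rw [extendReal_apply_inv] at this
  linear_combination (-2 ^ (-k)) * this - (extendReal f⁻¹ t - x) * two_zpow_mul_neg k

theorem RGerm.of_id {f : F} {x y : ℝ} (hxy : x < y) (h : ∀ t ∈ Set.Icc x y, extendReal f t = t) :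
    RGerm f x 0 :=
  ⟨y, hxy, fun t ht => by rw [h t ht, h x ⟨le_rfl, hxy.le⟩]; simp⟩

theorem RGerm.rightDeriv_eq {f : F} {x : ℝ} {k : ℤ} (h : RGerm f x k) :
    rightDeriv f x = 2 ^ k := by
  obtain ⟨y, hy, h⟩ := h
  have h1 : HasDerivWithinAt (fun t => extendReal f x + 2 ^ k * (t - x)) (2 ^ k) (Set.Ici x) x := by
    have := (((hasDerivWithinAt_id x (Set.Ici x)).sub_const x).const_mul ((2 : ℝ) ^ k)).const_add
      (extendReal f x)
    simpa using this
  refine (h1.congr_of_eventuallyEq ?_ (by simp)).derivWithin (uniqueDiffWithinAt_Ici x)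
  filter_upwards [Icc_mem_nhdsGE hy] with t ht using h t ht

-- The reflection acts on the source and on the target; each contributes a sign to the derivative,
-- and the signs cancel. All statements about right ends are reduced to left ends in this way.
open scoped Pointwise in
theorem leftDeriv_eq_rightDeriv_flip (f : F) (x : ℝ) :
    leftDeriv f x = rightDeriv (flip f) (1 - x) := by
  have hc : extendReal (flip f) = fun t => 1 - extendReal f (1 - t) :=
    funext fun t => extendReal_flip f t
  rw [leftDeriv, rightDeriv, hc, derivWithin_const_sub]
  have := derivWithin_comp_const_sub (f := extendReal f) (s := Set.Ici (1 - x)) (x := 1 - x) 1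
  have h2 : (1 : ℝ) +ᵥ -Set.Ici (1 - x) = Set.Iic x := by
    ext t
    rw [Set.mem_vadd_set_iff_neg_vadd_mem]
    simp only [vadd_eq_add, Set.mem_neg, Set.mem_Ici, Set.mem_Iic]
    constructor <;> intro h <;> linarith
  rw [this, h2, sub_sub_cancel, neg_neg]

/-! ### The homomorphism onto `ℤ²` -/

theorem exists_rGerm_zero (f : F) : ∃ k, RGerm f 0 k := RGerm.exists f le_rfl zero_lt_one

theorem RGerm.log_eq {f : F} {x : ℝ} {k : ℤ} (h : RGerm f x k) :
    Int.log 2 (rightDeriv f x) = k := by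
  rw [h.rightDeriv_eq]
  have := Int.log_zpow (R := ℝ) (b := 2) one_lt_two k
  simpa using this

/-- The logarithm of the slope of `f` at `0`. -/
noncomputable def logZero : F →* Multiplicative ℤ :=
  MonoidHom.mk' (fun f => Multiplicative.ofAdd (Int.log 2 (rightDeriv f 0))) fun f g => by
    obtain ⟨k, hk⟩ := exists_rGerm_zero f
    obtain ⟨l, hl⟩ := exists_rGerm_zero g
    have h : RGerm (f * g) 0 (k + l) := RGerm.mul (by rwa [extendReal_zero]) hl
    rw [hk.log_eq, hl.log_eq, h.log_eq]; rfl

/-- The exponent of the slope of `f` at `0`. -/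
noncomputable def slope (f : F) : ℤ := (logZero f).toAdd

theorem rGerm_slope (f : F) : RGerm f 0 (slope f) := by
  obtain ⟨k, hk⟩ := exists_rGerm_zero f
  have : slope f = k := hk.log_eq
  rwa [this]

theorem RGerm.slope_eq {f : F} {k : ℤ} (h : RGerm f 0 k) : slope f = k := (rGerm_slope f).unique h

@[simp] theorem slope_mul (f g : F) : slope (f * g) = slope f + slope g := by
  simp [slope]

@[simp] theorem slope_one : slope 1 = 0 := by simp [slope]

@[simp] theorem slope_inv (f : F) : slope f⁻¹ = -slope f := by simp [slope]

@[simp] theorem slope_zpow (f : F) (n : ℤ) : slope (f ^ n) = n * slope f := by simp [slope]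

@[simp] theorem slope_pow (f : F) (n : ℕ) : slope (f ^ n) = n * slope f := by simp [slope]

theorem logDerivs_eq (f : F) :
    logDerivs f = Multiplicative.ofAdd (slope f, slope (flip f)) := by
  rw [logDerivs, leftDeriv_eq_rightDeriv_flip, sub_self]; rfl

theorem logDerivs_mul (f g : F) : logDerivs (f * g) = logDerivs f * logDerivs g := by
  simp [logDerivs_eq, ← ofAdd_add]

theorem logDerivs_one : logDerivs 1 = 1 := by
  simp [logDerivs_eq]

theorem logDerivs_inv (f : F) : logDerivs f⁻¹ = (logDerivs f)⁻¹ := by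
  rw [eq_inv_iff_mul_eq_one, ← logDerivs_mul, inv_mul_cancel, logDerivs_one]

theorem logDerivs_eq_one_iff {f : F} : logDerivs f = 1 ↔ slope f = 0 ∧ slope (flip f) = 0 := by
  rw [logDerivs_eq, ← ofAdd_zero, Multiplicative.ofAdd.injective.eq_iff, Prod.ext_iff]; rfl

theorem slope_eq_zero_of_id {f : F} {y : ℝ} (hy : 0 < y) (h : ∀ t ≤ y, extendReal f t = t) :
    slope f = 0 :=
  (RGerm.of_id hy fun t ht => h t ht.2).slope_eq

theorem slope_flip_eq_zero_of_id {f : F} {y : ℝ} (hy : y < 1) (h : ∀ t ≥ y, extendReal f t = t) :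
    slope (flip f) = 0 :=
  slope_eq_zero_of_id (y := 1 - y) (by linarith) fun t ht => by
    rw [extendReal_flip, h _ (by linarith)]; ring

theorem exists_id_of_slope_eq_zero {f : F} (h : slope f = 0) :
    ∃ y, 0 < y ∧ ∀ t ≤ y, extendReal f t = t := by
  obtain ⟨y, hy, e⟩ := rGerm_slope f
  refine ⟨y, hy, fun t ht => ?_⟩
  rcases le_total t 0 with h0 | h0
  · exact extendReal_of_nonpos f h0
  · simpa [h, extendReal_zero] using e t ⟨h0, ht⟩

theorem exists_id_of_slope_flip_eq_zero {f : F} (h : slope (flip f) = 0) :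
    ∃ y, y < 1 ∧ ∀ t ≥ y, extendReal f t = t := by
  obtain ⟨y, hy, e⟩ := exists_id_of_slope_eq_zero h
  refine ⟨1 - y, by linarith, fun t ht => ?_⟩
  have := e (1 - t) (by linarith)
  rw [extendReal_flip, sub_sub_cancel] at this
  linarith

/-! ### The first non-trivial germ -/

/-- The leftmost point where `f` leaves the identity is `x`, and its slope there is `2 ^ k`. -/
structure FirstGerm (f : F) (x : ℝ) (k : ℤ) : Prop where
  dyadic : IsDyadic x
  nonneg : 0 ≤ x
  lt_one : x < 1
  id_on : ∀ t ≤ x, extendReal f t = t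
  ne_zero : k ≠ 0
  germ : RGerm f x k

namespace FirstGerm

variable {f g : F} {x y : ℝ} {k l : ℤ}

theorem exists_of_ne_one (h : f ≠ 1) : ∃ x k, FirstGerm f x k := by
  rcases (PL_extendReal f zero_le_one .zero .one).eq_id_or_exists_first (extendReal_zero f) with
    h' | ⟨x, k, h1, h2, h3, h4, h5, h6⟩
  · exact absurd (F_ext fun t ht => by rw [h' t ht, extendReal_one]) h
  · refine ⟨x, k, h1, h2, h3, fun t ht => ?_, h5, h6⟩
    rcases le_total t 0 with h0 | h0
    · exact extendReal_of_nonpos f h0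
    · exact h4 t ⟨h0, ht⟩

theorem ne_one (h : FirstGerm f x k) : f ≠ 1 := by
  rintro rfl
  exact h.ne_zero (h.germ.unique (.one x))

theorem not_lt (h : FirstGerm f x k) (h' : FirstGerm f y l) : ¬ x < y := fun hxy =>
  h.ne_zero (h.germ.unique (.of_id hxy fun t ht => h'.id_on t ht.2))

theorem unique (h : FirstGerm f x k) (h' : FirstGerm f y l) : x = y ∧ k = l := by
  obtain rfl := le_antisymm (le_of_not_gt (h'.not_lt h)) (le_of_not_gt (h.not_lt h'))
  exact ⟨rfl, h.germ.unique h'.germ⟩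

theorem inv (h : FirstGerm f x k) : FirstGerm f⁻¹ x (-k) := by
  have hi : ∀ t ≤ x, extendReal f⁻¹ t = t := fun t ht => by
    have := extendReal_inv_apply f t
    rwa [h.id_on t ht] at this
  refine ⟨h.dyadic, h.nonneg, h.lt_one, hi, neg_ne_zero.2 h.ne_zero, ?_⟩
  have := h.germ.inv
  rwa [h.id_on x le_rfl] at this

theorem mul_of_id (h : FirstGerm f x k) (hg : ∀ t ≤ x, extendReal g t = t)
    (hl : RGerm g x l) (hkl : k + l ≠ 0) : FirstGerm (f * g) x (k + l) := by
  refine ⟨h.dyadic, h.nonneg, h.lt_one, fun t ht => ?_, hkl, ?_⟩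
  · rw [extendReal_mul, hg t ht, h.id_on t ht]
  · exact RGerm.mul (by rw [hg x le_rfl]; exact h.germ) hl

theorem mul_left_of_id (h : FirstGerm f x k) (hg : ∀ t ≤ y, extendReal g t = t) (hxy : x < y) :
    FirstGerm (f * g) x k := by
  have := h.mul_of_id (g := g) (l := 0) (fun t ht => hg t (ht.trans hxy.le))
    (.of_id hxy fun t ht => hg t ht.2) (by simpa using h.ne_zero)
  simpa using this

/-- Chain rule: the exponent of `w` at `x` enters once and is cancelled by that of `w⁻¹` at the
image of `x`. Conjugacy invariance of the exponent is what makes the first-germ orderings invariant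
on both sides. -/
theorem conj (h : FirstGerm f x k) (w : F) : FirstGerm (w * f * w⁻¹) (extendReal w x) k := by
  have hi : ∀ t ≤ extendReal w x, extendReal w⁻¹ t ≤ x := fun t ht => by
    have := (extendReal_strictMono w⁻¹).monotone ht
    simpa using this
  refine ⟨(extendReal_dyadic_iff w x).2 h.dyadic, ?_, ?_, fun t ht => ?_, h.ne_zero, ?_⟩
  · rw [← extendReal_zero w]; exact (extendReal_strictMono w).monotone h.nonneg
  · rw [← extendReal_one_right w]; exact extendReal_strictMono w h.lt_one
  · rw [extendReal_mul, extendReal_mul, h.id_on _ (hi t ht), extendReal_apply_inv]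
  · obtain ⟨m, hm⟩ := RGerm.exists w h.nonneg h.lt_one
    have h1 : RGerm (w * f) x (m + k) := RGerm.mul (by rwa [h.id_on x le_rfl]) h.germ
    have h2 := RGerm.mul (f := w * f) (g := w⁻¹) (x := extendReal w x) (k := m + k) (l := -m)
      (by simpa using h1) hm.inv
    simpa using h2

theorem slope_eq (h : FirstGerm f 0 k) : slope f = k := h.germ.slope_eq

theorem slope_eq_zero (h : FirstGerm f x k) (hx : x ≠ 0) : slope f = 0 :=
  slope_eq_zero_of_id (lt_of_le_of_ne h.nonneg hx.symm) h.id_on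

theorem of_slope_ne_zero (h : slope f ≠ 0) : FirstGerm f 0 (slope f) :=
  ⟨.zero, le_rfl, zero_lt_one, fun _ ht => extendReal_of_nonpos f ht, h, rGerm_slope f⟩

theorem pos_of_slope_eq_zero (h : FirstGerm f x k) (hs : slope f = 0) : 0 < x := by
  refine lt_of_le_of_ne h.nonneg ?_
  rintro rfl
  exact h.ne_zero (h.slope_eq.symm.trans hs)

theorem isXMinus (h : FirstGerm f x k) : IsXMinus f x := by
  refine ⟨⟨⟨h.nonneg, h.lt_one⟩, ?_⟩, fun t ht => ?_⟩
  · rw [h.germ.rightDeriv_eq]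
    intro e
    exact h.ne_zero (zpow_right_injective₀ (by norm_num : (0 : ℝ) < 2) (by norm_num)
      (e.trans (zpow_zero 2).symm))
  · by_contra hlt
    refine ht.2 ?_
    rw [(RGerm.of_id (not_le.1 hlt) fun s hs => h.id_on s hs.2).rightDeriv_eq, zpow_zero]

end FirstGerm

theorem IsXMinus.exists_firstGerm {f : F} {x : ℝ} (h : IsXMinus f x) : ∃ k, FirstGerm f x k := by
  have hf : f ≠ 1 := by
    rintro rfl
    exact h.1.2 (by rw [(RGerm.one x).rightDeriv_eq, zpow_zero])
  obtain ⟨y, k, hy⟩ := FirstGerm.exists_of_ne_one hf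
  obtain rfl := IsLeast.unique h hy.isXMinus
  exact ⟨k, hy⟩

theorem isXPlus_iff {f : F} {x : ℝ} : IsXPlus f x ↔ IsXMinus (flip f) (1 - x) := by
  have key : ∀ t, t ∈ Set.Ioc (0 : ℝ) 1 ∧ leftDeriv f t ≠ 1 ↔
      1 - t ∈ Set.Ico (0 : ℝ) 1 ∧ rightDeriv (flip f) (1 - t) ≠ 1 := fun t => by
    rw [leftDeriv_eq_rightDeriv_flip]
    refine and_congr_left fun _ => ⟨fun h => ⟨?_, ?_⟩, fun h => ⟨?_, ?_⟩⟩ <;> linarith [h.1, h.2]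
  constructor
  · intro h
    refine ⟨(key x).1 h.1, fun t ht => ?_⟩
    have := h.2 ((key (1 - t)).2 (by rwa [sub_sub_cancel]))
    linarith
  · intro h
    refine ⟨(key x).2 h.1, fun t ht => ?_⟩
    have := h.2 ((key t).1 ht)
    linarith

/-! ### The cones -/

/-- The elements whose first germ has the sign of `a` at `0`, and the sign of `b` elsewhere. -/
def firstCone (a b : ℤ) : Set F :=
  {f | ∃ x k, FirstGerm f x k ∧ ((x = 0 ∧ 0 < a * k) ∨ (x ≠ 0 ∧ 0 < b * k))}

theorem FirstGerm.mem_firstCone_iff {f : F} {x : ℝ} {k : ℤ} (h : FirstGerm f x k) {a b : ℤ} :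
    f ∈ firstCone a b ↔ (x = 0 ∧ 0 < a * k) ∨ (x ≠ 0 ∧ 0 < b * k) := by
  constructor
  · rintro ⟨y, l, h', e⟩
    obtain ⟨rfl, rfl⟩ := h.unique h'
    exact e
  · exact fun e => ⟨x, k, h, e⟩

theorem FirstGerm.mem_firstCone_self_iff {f : F} {x : ℝ} {k : ℤ} (h : FirstGerm f x k) {a : ℤ} :
    f ∈ firstCone a a ↔ 0 < a * k := by
  rw [h.mem_firstCone_iff, ← or_and_right]
  simp [em]

theorem one_lt_zpow_iff {k : ℤ} : (1 : ℝ) < 2 ^ k ↔ 0 < k := by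
  rw [← zpow_zero (2 : ℝ), zpow_lt_zpow_iff_right₀ one_lt_two]

theorem zpow_lt_one_iff {k : ℤ} : (2 : ℝ) ^ k < 1 ↔ k < 0 := by
  rw [← zpow_zero (2 : ℝ), zpow_lt_zpow_iff_right₀ one_lt_two]

theorem exists_isXMinus_iff {f : F} {P : ℝ → ℝ → Prop} :
    (∃ x, IsXMinus f x ∧ P x (rightDeriv f x)) ↔ ∃ x k, FirstGerm f x k ∧ P x (2 ^ k) := by
  constructor
  · rintro ⟨x, hx, h⟩
    obtain ⟨k, hk⟩ := hx.exists_firstGerm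
    exact ⟨x, k, hk, by rwa [← hk.germ.rightDeriv_eq]⟩
  · rintro ⟨x, k, hk, h⟩
    exact ⟨x, hk.isXMinus, by rwa [hk.germ.rightDeriv_eq]⟩

theorem exists_isXPlus_iff {f : F} {P : ℝ → ℝ → Prop} :
    (∃ x, IsXPlus f x ∧ P x (leftDeriv f x)) ↔
      ∃ x k, FirstGerm (flip f) x k ∧ P (1 - x) (2 ^ k) := by
  rw [← exists_isXMinus_iff (P := fun x d => P (1 - x) d)]
  constructor
  · rintro ⟨x, hx, h⟩
    refine ⟨1 - x, isXPlus_iff.1 hx, ?_⟩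
    rwa [sub_sub_cancel, ← leftDeriv_eq_rightDeriv_flip]
  · rintro ⟨x, hx, h⟩
    refine ⟨1 - x, isXPlus_iff.2 (by rwa [sub_sub_cancel]), ?_⟩
    rwa [leftDeriv_eq_rightDeriv_flip, sub_sub_cancel]

theorem mainCone_xMinusPos : mainCone .xMinusPos = firstCone 1 1 := by
  ext f
  refine (exists_isXMinus_iff (P := fun _ d => 1 < d)).trans ?_
  simp only [firstCone, Set.mem_ofPred_eq, one_lt_zpow_iff, one_mul, ← or_and_right, em, true_and,
    ne_eq]

theorem mainCone_xMinusNeg : mainCone .xMinusNeg = firstCone (-1) (-1) := by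
  ext f
  refine (exists_isXMinus_iff (P := fun _ d => d < 1)).trans ?_
  simp only [firstCone, Set.mem_ofPred_eq, zpow_lt_one_iff, neg_one_mul, ← or_and_right, em,
    true_and, ne_eq, Left.neg_pos_iff]

/-- The flip reverses the interval but preserves slopes, so the condition "slope less than $1$" at
the right end is still a negative exponent: the label $+$ at $x^+$ corresponds to the sign $-1$. -/
theorem mainCone_xPlusPos : mainCone .xPlusPos = flip ⁻¹' firstCone (-1) (-1) := by
  ext f
  refine (exists_isXPlus_iff (P := fun _ d => d < 1)).trans ?_
  simp only [firstCone, Set.mem_preimage, Set.mem_ofPred_eq, zpow_lt_one_iff, neg_one_mul,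
    ← or_and_right, em, true_and, ne_eq, Left.neg_pos_iff]

theorem mainCone_xPlusNeg : mainCone .xPlusNeg = flip ⁻¹' firstCone 1 1 := by
  ext f
  refine (exists_isXPlus_iff (P := fun _ d => 1 < d)).trans ?_
  simp only [firstCone, Set.mem_preimage, Set.mem_ofPred_eq, one_lt_zpow_iff, one_mul,
    ← or_and_right, em, true_and, ne_eq]

theorem zero_and_rightDeriv_iff {f : F} {x : ℝ} {Q : ℝ → Prop} :
    (x = 0 ∧ Q (rightDeriv f 0)) ↔ (x = 0 ∧ Q (rightDeriv f x)) :=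
  and_congr_right fun h => by rw [h]

theorem one_and_leftDeriv_iff {f : F} {x : ℝ} {Q : ℝ → Prop} :
    (x = 1 ∧ Q (leftDeriv f 1)) ↔ (x = 1 ∧ Q (leftDeriv f x)) :=
  and_congr_right fun h => by rw [h]

theorem exoticCone_zeroPosNeg : exoticCone .zeroPosNeg = firstCone 1 (-1) := by
  ext f
  simp only [exoticCone, Set.mem_ofPred_eq, zero_and_rightDeriv_iff (Q := fun d => 1 < d)]
  refine (exists_isXMinus_iff (P := fun x d => (x = 0 ∧ 1 < d) ∨ (x ≠ 0 ∧ d < 1))).trans ?_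
  simp only [firstCone, Set.mem_ofPred_eq, zpow_lt_one_iff, one_lt_zpow_iff, neg_one_mul, one_mul,
    Left.neg_pos_iff]

theorem exoticCone_zeroNegPos : exoticCone .zeroNegPos = firstCone (-1) 1 := by
  ext f
  simp only [exoticCone, Set.mem_ofPred_eq, zero_and_rightDeriv_iff (Q := fun d => d < 1)]
  refine (exists_isXMinus_iff (P := fun x d => (x = 0 ∧ d < 1) ∨ (x ≠ 0 ∧ 1 < d))).trans ?_
  simp only [firstCone, Set.mem_ofPred_eq, zpow_lt_one_iff, one_lt_zpow_iff, neg_one_mul, one_mul,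
    Left.neg_pos_iff]

theorem one_sub_eq_one_iff {x : ℝ} : 1 - x = 1 ↔ x = 0 := by
  constructor <;> intro h <;> linarith

theorem exoticCone_onePosNeg : exoticCone .onePosNeg = flip ⁻¹' firstCone (-1) 1 := by
  ext f
  simp only [exoticCone, Set.mem_ofPred_eq, one_and_leftDeriv_iff (Q := fun d => d < 1)]
  refine (exists_isXPlus_iff (P := fun x d => (x = 1 ∧ d < 1) ∨ (x ≠ 1 ∧ 1 < d))).trans ?_
  simp only [firstCone, Set.mem_preimage, Set.mem_ofPred_eq, zpow_lt_one_iff, one_lt_zpow_iff,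
    neg_one_mul, one_mul, Left.neg_pos_iff, ne_eq, one_sub_eq_one_iff]

theorem exoticCone_oneNegPos : exoticCone .oneNegPos = flip ⁻¹' firstCone 1 (-1) := by
  ext f
  simp only [exoticCone, Set.mem_ofPred_eq, one_and_leftDeriv_iff (Q := fun d => 1 < d)]
  refine (exists_isXPlus_iff (P := fun x d => (x = 1 ∧ 1 < d) ∨ (x ≠ 1 ∧ d < 1))).trans ?_
  simp only [firstCone, Set.mem_preimage, Set.mem_ofPred_eq, zpow_lt_one_iff, one_lt_zpow_iff,
    neg_one_mul, one_mul, Left.neg_pos_iff, ne_eq, one_sub_eq_one_iff]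

/-! ### Generators of `F` -/

theorem isDyadic_half : IsDyadic (1 / 2) := by simpa using IsDyadic.inv_two_pow 1

theorem isDyadic_quarter : IsDyadic (1 / 4) := by
  have := IsDyadic.inv_two_pow 2
  norm_num at this ⊢
  exact this

theorem exists_xZero : ∃ f : F, (∀ t ∈ Set.Icc (0 : ℝ) (1 / 4), extendReal f t = 2 * t) ∧
    (∀ t ∈ Set.Icc (1 / 4 : ℝ) (1 / 2), extendReal f t = t + 1 / 4) ∧
    ∀ t ∈ Set.Icc (1 / 2 : ℝ) 1, extendReal f t = t / 2 + 1 / 2 := by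
  -- With slopes $2,1,1/2$ the generator is concave, hence the minimum of its three affine pieces.
  set φ : ℝ → ℝ := fun t => min (2 * t) (min (t + 1 / 4) (t / 2 + 1 / 2)) with hφ
  have e1 : ∀ t ∈ Set.Icc (0 : ℝ) (1 / 4), φ t = 2 * t := fun t ht => by
    simp only [hφ]
    rw [min_eq_left]
    rw [le_min_iff]; constructor <;> linarith [ht.1, ht.2]
  have e2 : ∀ t ∈ Set.Icc (1 / 4 : ℝ) (1 / 2), φ t = t + 1 / 4 := fun t ht => by
    simp only [hφ]
    rw [min_eq_right, min_eq_left]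
    · linarith [ht.2]
    · refine (min_le_left _ _).trans ?_
      linarith [ht.1]
  have e3 : ∀ t ∈ Set.Icc (1 / 2 : ℝ) 1, φ t = t / 2 + 1 / 2 := fun t ht => by
    simp only [hφ]
    rw [min_eq_right, min_eq_right]
    · linarith [ht.1]
    · refine (min_le_right _ _).trans ?_
      linarith [ht.1]
  have h : PL φ 0 1 := by
    refine .glue (.aff (b := 1 / 4) 1 0 (by norm_num) .zero isDyadic_quarter .zero fun t ht => ?_)
      (.glue (.aff (b := 1 / 2) 0 (1 / 4) (by norm_num) isDyadic_quarter isDyadic_half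
        isDyadic_quarter fun t ht => ?_)
      (.aff (-1) (1 / 2) (by norm_num) isDyadic_half .one isDyadic_half fun t ht => ?_))
    · rw [e1 t ht]; simp
    · rw [e2 t ht]; simp
    · rw [e3 t ht, zpow_neg_one]; ring
  obtain ⟨f, hf⟩ := exists_extendReal_eq h
    (by rw [e1 _ ⟨le_rfl, by norm_num⟩, mul_zero])
    (by rw [e3 _ ⟨by norm_num, le_rfl⟩]; norm_num)
  refine ⟨f, fun t ht => ?_, fun t ht => ?_, fun t ht => ?_⟩
  · rw [hf t ⟨ht.1, by linarith [ht.2]⟩, e1 t ht]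
  · rw [hf t ⟨by linarith [ht.1], by linarith [ht.2]⟩, e2 t ht]
  · rw [hf t ⟨by linarith [ht.1], ht.2⟩, e3 t ht]

/-- The standard generator `x₀` of Thompson's group. -/
noncomputable def xZero : F := exists_xZero.choose

theorem xZero_left {t : ℝ} (h0 : 0 ≤ t) (h1 : t ≤ 1 / 4) : extendReal xZero t = 2 * t :=
  exists_xZero.choose_spec.1 t ⟨h0, h1⟩

theorem xZero_mid {t : ℝ} (h0 : 1 / 4 ≤ t) (h1 : t ≤ 1 / 2) : extendReal xZero t = t + 1 / 4 :=
  exists_xZero.choose_spec.2.1 t ⟨h0, h1⟩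

theorem xZero_right {t : ℝ} (h0 : 1 / 2 ≤ t) (h1 : t ≤ 1) : extendReal xZero t = t / 2 + 1 / 2 :=
  exists_xZero.choose_spec.2.2 t ⟨h0, h1⟩

/-- The copy of `F` supported in `[1 / 2, 1]`. -/
noncomputable abbrev rightCopy : F →* F :=
  copy (-1) (1 / 2) isDyadic_half (by norm_num) (by norm_num)

theorem extendReal_rightCopy (f : F) (t : ℝ) :
    extendReal (rightCopy f) (t / 2 + 1 / 2) = extendReal f t / 2 + 1 / 2 := by
  have := extendReal_copy (k := -1) (hp := isDyadic_half) (h0 := by norm_num) (h1 := by norm_num)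
    f t
  have e : ∀ s : ℝ, s / 2 + 1 / 2 = 2 ^ (-1 : ℤ) * s + 1 / 2 := fun s => by
    rw [zpow_neg_one]; ring
  rw [e, e]
  exact this

/-- On $[1/2,1]$ the generator `xZero` is $t\mapsto t/2+1/2$, the very rescaling that defines
`rightCopy`. Thus the subgroup generated by `xZero` and `rightCopy xZero` is stable under
`rightCopy`. -/
theorem rightCopy_rightCopy (f : F) :
    rightCopy (rightCopy f) = xZero * rightCopy f * xZero⁻¹ := by
  rw [eq_mul_inv_iff_mul_eq]
  refine F_ext fun t ht => ?_
  rw [extendReal_mul, extendReal_mul]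
  rcases le_total t (1 / 2) with h | h
  -- Left of $1/2$ both sides equal `xZero`: the iterated copy is supported in $[3/4,1]$, and
  -- `xZero` sends $[0,1/2]$ into $[0,3/4]$.
  · have h1 : extendReal xZero t ≤ 1 / 2 + 1 / 4 := by
      refine ((extendReal_strictMono xZero).monotone h).trans ?_
      rw [xZero_right le_rfl (by norm_num)]; norm_num
    have h2 : extendReal (rightCopy f) t = t := extendReal_copy_of_le f h
    rw [h2]
    obtain ⟨s, hs⟩ : ∃ s, extendReal xZero t = s / 2 + 1 / 2 :=
      ⟨(extendReal xZero t - 1 / 2) * 2, by ring⟩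
    rw [hs, extendReal_rightCopy]
    have h3 : extendReal (rightCopy f) s = s := extendReal_copy_of_le f (by linarith)
    rw [h3]
  · obtain ⟨s, rfl⟩ : ∃ s, t = s / 2 + 1 / 2 := ⟨(t - 1 / 2) * 2, by ring⟩
    have hs : s ∈ unitInterval := ⟨by linarith, by linarith [ht.2]⟩
    have hs' := extendReal_mem f hs
    rw [xZero_right h ht.2, extendReal_rightCopy, extendReal_rightCopy,
      xZero_right (by linarith [hs'.1]) (by linarith [hs'.2])]

theorem slope_xZero : slope xZero = 1 := by
  refine RGerm.slope_eq ⟨1 / 4, by norm_num, fun t ht => ?_⟩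
  rw [xZero_left ht.1 ht.2, extendReal_zero]; simp

theorem slope_flip_xZero : slope (flip xZero) = -1 := by
  refine RGerm.slope_eq ⟨1 / 2, by norm_num, fun t ht => ?_⟩
  rw [extendReal_flip, xZero_right (by linarith [ht.2]) (by linarith [ht.1]), extendReal_zero,
    zpow_neg_one]
  ring

theorem slope_copy_of_pos {k : ℤ} {p : ℝ} {hp : IsDyadic p} {h0 : 0 ≤ p} {h1 : 2 ^ k + p ≤ 1}
    (hpos : 0 < p) (f : F) : slope (copy k p hp h0 h1 f) = 0 :=
  slope_eq_zero_of_id hpos fun _ ht => extendReal_copy_of_le f ht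

theorem rGerm_copy {k : ℤ} {p : ℝ} {hp : IsDyadic p} {h0 : 0 ≤ p} {h1 : 2 ^ k + p ≤ 1}
    {f : F} {t : ℝ} {l : ℤ} (h : RGerm f t l) : RGerm (copy k p hp h0 h1 f) (2 ^ k * t + p) l := by
  obtain ⟨y, hy, e⟩ := h
  have hk : (0 : ℝ) < 2 ^ k := by positivity
  refine ⟨2 ^ k * y + p, by nlinarith, fun s hs => ?_⟩
  obtain ⟨u, rfl⟩ := exists_affine_eq k p s
  rw [extendReal_copy, extendReal_copy, e u ⟨?_, ?_⟩]
  · ring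
  · have := hs.1; nlinarith
  · have := hs.2; nlinarith

theorem lGerm_copy {k : ℤ} {p : ℝ} {hp : IsDyadic p} {h0 : 0 ≤ p} {h1 : 2 ^ k + p ≤ 1}
    {f : F} {t : ℝ} {l : ℤ} (h : LGerm f t l) : LGerm (copy k p hp h0 h1 f) (2 ^ k * t + p) l := by
  obtain ⟨y, hy, e⟩ := h
  have hk : (0 : ℝ) < 2 ^ k := by positivity
  refine ⟨2 ^ k * y + p, by nlinarith, fun s hs => ?_⟩
  obtain ⟨u, rfl⟩ := exists_affine_eq k p s
  rw [extendReal_copy, extendReal_copy, e u ⟨?_, ?_⟩]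
  · ring
  · have := hs.1; nlinarith
  · have := hs.2; nlinarith

theorem slope_rightCopy (f : F) : slope (rightCopy f) = 0 := slope_copy_of_pos (by norm_num) f

theorem lGerm_one_slope_flip (f : F) : LGerm f 1 (slope (flip f)) := by
  rw [lGerm_iff, sub_self]; exact rGerm_slope _

theorem LGerm.slope_flip_eq {f : F} {k : ℤ} (h : LGerm f 1 k) : slope (flip f) = k := by
  rw [lGerm_iff, sub_self] at h; exact h.slope_eq

theorem slope_flip_rightCopy (f : F) : slope (flip (rightCopy f)) = slope (flip f) := by
  refine LGerm.slope_flip_eq ?_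
  have := lGerm_copy (k := -1) (p := 1 / 2) (hp := isDyadic_half) (h0 := by norm_num)
    (h1 := by norm_num) (lGerm_one_slope_flip f)
  convert this using 1
  norm_num

/-! ### Standard dyadic partitions -/

/-- The points `p 0, …, p n` divide `[0,1]` into standard dyadic intervals. -/
structure StdPart (p : ℕ → ℝ) (n : ℕ) : Prop where
  zero : p 0 = 0
  last : p n = 1
  step : ∀ i < n, ∃ (c : ℤ) (k : ℕ), p i = c / 2 ^ k ∧ p (i + 1) = (c + 1) / 2 ^ k

namespace StdPart

variable {p : ℕ → ℝ} {n : ℕ}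

theorem lt_succ (h : StdPart p n) {i : ℕ} (hi : i < n) : p i < p (i + 1) := by
  obtain ⟨c, k, e1, e2⟩ := h.step i hi
  rw [e1, e2]
  gcongr
  linarith

theorem mono (h : StdPart p n) {i j : ℕ} (hij : i ≤ j) (hj : j ≤ n) : p i ≤ p j := by
  induction j, hij using Nat.le_induction with
  | base => exact le_rfl
  | succ j hij ih => exact (ih (by omega)).trans (h.lt_succ (by omega)).le

theorem strictMono (h : StdPart p n) {i j : ℕ} (hij : i < j) (hj : j ≤ n) : p i < p j :=
  (h.lt_succ (by omega)).trans_le (h.mono hij hj)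

theorem pos (h : StdPart p n) : 0 < n := by
  rcases Nat.eq_zero_or_pos n with rfl | h'
  · have := h.zero.symm.trans h.last; norm_num at this
  · exact h'

/-- A standard dyadic interval other than $[0,1]$ cannot contain $1/2$ in its interior, so the first
interval that reaches $1/2$ ends there. -/
theorem exists_half (h : StdPart p n) (hn : 2 ≤ n) : ∃ a, 0 < a ∧ a < n ∧ p a = 1 / 2 := by
  classical
  have hex : ∃ a, 1 / 2 ≤ p a := ⟨n, by rw [h.last]; norm_num⟩
  set a := Nat.find hex with ha
  have h1 : 1 / 2 ≤ p a := Nat.find_spec hex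
  have han : a ≤ n := Nat.find_min' hex (by rw [h.last]; norm_num)
  have ha0 : a ≠ 0 := fun h0 => by rw [h0, h.zero] at h1; norm_num at h1
  obtain ⟨b, hb⟩ := Nat.exists_eq_succ_of_ne_zero ha0
  have h2 : p b < 1 / 2 := not_le.1 (Nat.find_min hex (m := b) (by omega))
  obtain ⟨c, k, e1, e2⟩ := h.step b (by omega)
  rw [hb] at h1
  have hpa : p a = 1 / 2 := by
    rw [hb]
    rcases k with _ | k
    -- An interval of length $1$ starting below $1/2$ and ending at or above it is $[0,1]$ itself,
    -- against `2 ≤ n`.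
    · exfalso
      have hb0 : p b = 0 := by
        rw [e1] at h2 ⊢
        rw [Nat.succ_eq_add_one, e2] at h1
        simp only [pow_zero, div_one] at h1 h2 ⊢
        have h3 : c < 1 := by
          by_contra hc
          have : (1 : ℝ) ≤ c := by exact_mod_cast not_lt.1 hc
          linarith
        have h4 : -1 < c := by
          by_contra hc
          have : (c : ℝ) ≤ -1 := by exact_mod_cast not_lt.1 hc
          linarith
        have : c = 0 := by omega
        simp [this]
      have hb1 : p (b + 1) = 1 := by
        rw [e1] at hb0
        simp only [pow_zero, div_one] at hb0
        rw [e2, hb0]; simp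
      have hb2 : b = 0 := by
        by_contra hne
        have := h.strictMono (i := 0) (j := b) (by omega) (by omega)
        rw [h.zero, hb0] at this
        exact lt_irrefl _ this
      have hb3 : b + 1 = n := by
        by_contra hne
        have := h.strictMono (i := b + 1) (j := n) (by omega) le_rfl
        rw [h.last, hb1] at this
        exact lt_irrefl _ this
      omega
    · have hk : (0 : ℝ) < 2 ^ k := by positivity
      refine le_antisymm ?_ h1
      rw [e1, pow_succ, div_lt_iff₀ (by positivity)] at h2
      rw [Nat.succ_eq_add_one, e2, pow_succ, div_le_iff₀ (by positivity)]
      have h3 : (c : ℝ) < 2 ^ k := by linarith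
      have h4 : c < 2 ^ k := by exact_mod_cast h3
      have h5 : ((c + 1 : ℤ) : ℝ) ≤ 2 ^ k := by exact_mod_cast Int.add_one_le_of_lt h4
      push_cast at h5
      linarith
  refine ⟨a, by omega, lt_of_le_of_ne han ?_, hpa⟩
  rintro e
  rw [e, h.last] at hpa
  norm_num at hpa

/-- The length of a standard interval is $2^{-k}$, so a bound on the length bounds the exponent from
below; this leaves room for doubling, or for translating by $1/4$, without losing the standard form.
-/
theorem exists_exponent (h : StdPart p n) {i : ℕ} (hi : i < n) {m : ℕ}
    (hm : p (i + 1) - p i ≤ 1 / 2 ^ m) :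
    ∃ (c : ℤ) (k : ℕ), p i = c / 2 ^ (k + m) ∧ p (i + 1) = (c + 1) / 2 ^ (k + m) := by
  obtain ⟨c, k, e1, e2⟩ := h.step i hi
  have hk : (0 : ℝ) < 2 ^ k := by positivity
  have e3 : p (i + 1) - p i = 1 / 2 ^ k := by rw [e1, e2]; ring
  rw [e3, one_div_le_one_div (by positivity) (by positivity)] at hm
  have := (pow_le_pow_iff_right₀ (one_lt_two (α := ℝ))).1 hm
  obtain ⟨j, rfl⟩ := Nat.exists_eq_add_of_le' this
  exact ⟨c, j, e1, e2⟩

theorem double (h : StdPart p n) {a : ℕ} (ha : a < n) (hpa : p a = 1 / 2) :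
    StdPart (fun i => 2 * p i) a := by
  refine ⟨by simp [h.zero], by simp [hpa], fun i hi => ?_⟩
  have h1 : p (i + 1) ≤ 1 / 2 := hpa ▸ h.mono (by omega) (by omega)
  have h2 : 0 ≤ p i := h.zero ▸ h.mono (Nat.zero_le _) (by omega)
  obtain ⟨c, k, e1, e2⟩ := h.exists_exponent (i := i) (m := 1) (by omega) (by norm_num; linarith)
  refine ⟨c, k, ?_, ?_⟩
  · rw [e1, pow_succ]; field_simp
  · rw [e2, pow_succ]; field_simp

theorem double_sub_one (h : StdPart p (n + 1)) (hp : p 1 = 1 / 2) :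
    StdPart (fun i => 2 * p (i + 1) - 1) n := by
  have hn : 1 ≤ n := by
    by_contra hn
    obtain rfl : n = 0 := by omega
    have := h.last
    rw [hp] at this
    norm_num at this
  refine ⟨by simp [hp], by norm_num [h.last], fun i hi => ?_⟩
  have h1 : p (i + 1 + 1) ≤ 1 := h.last ▸ h.mono (by omega) (by omega)
  have h2 : 1 / 2 ≤ p (i + 1) := hp ▸ h.mono (by omega) (by omega)
  obtain ⟨c, k, e1, e2⟩ := h.exists_exponent (i := i + 1) (m := 1) (by omega)
    (by norm_num; linarith)
  refine ⟨c - 2 ^ k, k, ?_, ?_⟩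
  · rw [e1, pow_succ]; push_cast; field_simp
  · rw [e2, pow_succ]; push_cast; field_simp; ring

/-- Both breakpoints $1/4$ and $1/2$ of the generator belong to the partition, so each interval is
doubled, translated by $1/4$ or halved as a whole. -/
theorem xZero (h : StdPart p n) {a b : ℕ} (hba : b < a) (han : a < n) (hpa : p a = 1 / 2)
    (hpb : p b = 1 / 4) : StdPart (fun i => extendReal xZero (p i)) n := by
  refine ⟨by simp only [h.zero, extendReal_zero], by simp only [h.last, extendReal_one_right],
    fun i hi => ?_⟩
  have h0 : 0 ≤ p i := h.zero ▸ h.mono (Nat.zero_le _) (by omega)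
  have hlt := h.lt_succ hi
  rcases lt_or_ge i b with hib | hib
  · have h1 : p (i + 1) ≤ 1 / 4 := hpb ▸ h.mono (by omega) (by omega)
    obtain ⟨c, k, e1, e2⟩ := h.exists_exponent (m := 1) hi (by norm_num; linarith)
    refine ⟨c, k, ?_, ?_⟩
    · rw [xZero_left h0 (by linarith), e1, pow_succ]; field_simp
    · rw [xZero_left (by linarith) h1, e2, pow_succ]; field_simp
  have h0' : 1 / 4 ≤ p i := hpb ▸ h.mono hib (by omega)
  rcases lt_or_ge i a with hia | hia
  · have h1 : p (i + 1) ≤ 1 / 2 := hpa ▸ h.mono (by omega) (by omega)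
    obtain ⟨c, k, e1, e2⟩ := h.exists_exponent (m := 2) hi (by norm_num; linarith)
    refine ⟨c + 2 ^ k, k + 2, ?_, ?_⟩
    · rw [xZero_mid h0' (by linarith), e1, pow_add]; push_cast; field_simp; ring
    · rw [xZero_mid (by linarith) h1, e2, pow_add]; push_cast; field_simp; ring
  have h0'' : 1 / 2 ≤ p i := hpa ▸ h.mono hia (by omega)
  have h1 : p (i + 1) ≤ 1 := h.last ▸ h.mono (by omega) (by omega)
  obtain ⟨c, k, e1, e2⟩ := h.step i hi
  refine ⟨c + 2 ^ k, k + 1, ?_, ?_⟩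
  · rw [xZero_right h0'' (by linarith), e1, pow_succ]; push_cast; field_simp
  · rw [xZero_right (by linarith) h1, e2, pow_succ]; push_cast; field_simp; ring

end StdPart

/-- `f` maps the points `p i` to the points `q i`, and is affine in between. -/
structure AffineBetween (f : F) (p : ℕ → ℝ) (n : ℕ) (q : ℕ → ℝ) : Prop where
  map : ∀ i ≤ n, extendReal f (p i) = q i
  affine : ∀ i < n, ∃ m c : ℝ, ∀ t ∈ Set.Icc (p i) (p (i + 1)), extendReal f t = m * t + c

namespace AffineBetween

variable {f g : F} {p q r : ℕ → ℝ} {n : ℕ}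

theorem mul (hg : AffineBetween g q n r) (hf : AffineBetween f p n q) :
    AffineBetween (g * f) p n r := by
  refine ⟨fun i hi => by rw [extendReal_mul, hf.map i hi, hg.map i hi], fun i hi => ?_⟩
  obtain ⟨m, c, h1⟩ := hf.affine i hi
  obtain ⟨m', c', h2⟩ := hg.affine i hi
  refine ⟨m' * m, m' * c + c', fun t ht => ?_⟩
  rw [extendReal_mul, h2, h1 t ht]
  · ring
  · rw [← hf.map i hi.le, ← hf.map (i + 1) hi]
    exact ⟨(extendReal_strictMono f).monotone ht.1, (extendReal_strictMono f).monotone ht.2⟩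

theorem inv (hp : StdPart p n) (hf : AffineBetween f p n q) : AffineBetween f⁻¹ q n p := by
  refine ⟨fun i hi => by rw [← hf.map i hi, extendReal_inv_apply], fun i hi => ?_⟩
  obtain ⟨m, c, h1⟩ := hf.affine i hi
  have hlt := hp.lt_succ hi
  have hm : m ≠ 0 := by
    rintro rfl
    have := extendReal_strictMono f hlt
    rw [h1 _ ⟨le_rfl, hlt.le⟩, h1 _ ⟨hlt.le, le_rfl⟩] at this
    simp at this
  refine ⟨m⁻¹, -(m⁻¹ * c), fun t ht => ?_⟩
  rw [← hf.map i hi.le, ← hf.map (i + 1) hi] at ht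
  have e1 := (extendReal_strictMono f⁻¹).monotone ht.1
  have e2 := (extendReal_strictMono f⁻¹).monotone ht.2
  simp only [extendReal_inv_apply] at e1 e2
  have e3 := h1 _ ⟨e1, e2⟩
  rw [extendReal_apply_inv] at e3
  nth_rw 2 [e3]
  field_simp
  ring

theorem one (p : ℕ → ℝ) (n : ℕ) : AffineBetween 1 p n p :=
  ⟨fun i _ => extendReal_one _, fun _ _ => ⟨1, 0, fun t _ => by simp⟩⟩

theorem eq_on_first (hf : AffineBetween f p n q) (hn : 0 < n) (h0 : p 0 = 0)
    (h1 : p 1 = q 1) (hpos : 0 < p 1) : ∀ t ∈ Set.Icc 0 (p 1), extendReal f t = t := by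
  obtain ⟨m, c, h⟩ := hf.affine 0 hn
  rw [h0, zero_add] at h
  have e1 := h 0 ⟨le_rfl, hpos.le⟩
  have e2 := h (p 1) ⟨hpos.le, le_rfl⟩
  rw [extendReal_zero] at e1
  rw [hf.map 1 hn, ← h1] at e2
  have hc : c = 0 := by linarith
  have hm : m = 1 := by
    have : m * p 1 = 1 * p 1 := by linarith
    exact mul_right_cancel₀ hpos.ne' this
  intro t ht
  rw [h t ht, hm, hc]; ring

end AffineBetween

/-- Fine enough grids work. On an affine piece $2^kt+d/2^e$, an interval of length $2^{-m}$ goes to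
one of length $2^{k-m}$, and $m\ge k+e$ makes $d/2^e$ a multiple of that length. At a junction, $m$
must exceed the exponent of its denominator, so that no grid interval straddles it. -/
theorem PL.exists_std {φ : ℝ → ℝ} {a b : ℝ} (h : PL φ a b) : ∃ N : ℕ, ∀ m ≥ N, ∀ i : ℤ,
    a ≤ i / 2 ^ m → (i + 1) / 2 ^ m ≤ b →
    (∃ u v : ℝ, ∀ t ∈ Set.Icc ((i : ℝ) / 2 ^ m) ((i + 1) / 2 ^ m), φ t = u * t + v) ∧
    ∃ (c : ℤ) (k : ℕ), φ (i / 2 ^ m) = c / 2 ^ k ∧ φ ((i + 1) / 2 ^ m) = (c + 1) / 2 ^ k := by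
  induction h with
  | @aff a b k c h1 h2 h3 h4 h5 =>
    obtain ⟨d, e, rfl⟩ := h4
    refine ⟨(k + e).toNat + k.toNat, fun m hm i hi1 hi2 => ?_⟩
    have hlt : (i : ℝ) / 2 ^ m ≤ (i + 1) / 2 ^ m := by gcongr; linarith
    refine ⟨⟨2 ^ k, d / 2 ^ e, fun t ht => h5 t ⟨hi1.trans ht.1, ht.2.trans hi2⟩⟩, ?_⟩
    obtain ⟨j, hj⟩ : ∃ j : ℕ, (m : ℤ) = k + e + j := ⟨(m - k - e).toNat, by omega⟩
    have hz : (2 : ℝ) ^ (e + j) * 2 ^ k = 2 ^ m := by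
      rw [← zpow_natCast, ← zpow_natCast, ← zpow_add₀ (by norm_num), hj]
      congr 1
      push_cast
      ring
    have hz' : (2 : ℝ) ^ k / 2 ^ m = 1 / 2 ^ (e + j) := by
      rw [← hz]; field_simp
    have hz'' : (d : ℝ) / 2 ^ e = d * 2 ^ j / 2 ^ (e + j) := by
      rw [pow_add]; field_simp
    refine ⟨i + d * 2 ^ j, e + j, ?_, ?_⟩
    · rw [h5 _ ⟨hi1, hlt.trans hi2⟩, hz'', mul_div_assoc', mul_comm, mul_div_assoc, hz']
      push_cast; ring
    · rw [h5 _ ⟨hi1.trans hlt, hi2⟩, hz'', mul_div_assoc', mul_comm, mul_div_assoc, hz']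
      push_cast; ring
  | @glue a b c h1 h2 ih1 ih2 =>
    obtain ⟨N, hN⟩ := ih1
    obtain ⟨M, hM⟩ := ih2
    obtain ⟨d, e, rfl⟩ := h1.dyadic_right
    refine ⟨N + M + e, fun m hm i hi1 hi2 => ?_⟩
    obtain ⟨j, rfl⟩ : ∃ j, m = e + j := ⟨m - e, by omega⟩
    have hd : (d : ℝ) / 2 ^ e = ((d * 2 ^ j : ℤ) : ℝ) / 2 ^ (e + j) := by
      rw [pow_add]; push_cast; field_simp
    rcases lt_or_ge i (d * 2 ^ j) with h | h
    · refine hN _ (by omega) i hi1 ?_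
      rw [hd]
      gcongr
      exact_mod_cast h
    · refine hM _ (by omega) i ?_ hi2
      rw [hd]
      gcongr

theorem exists_affineBetween (f : F) :
    ∃ p n q, StdPart p n ∧ StdPart q n ∧ AffineBetween f p n q := by
  obtain ⟨N, hN⟩ := (PL_extendReal f zero_le_one .zero .one).exists_std
  have h := hN N le_rfl
  have key : ∀ i : ℕ, i < 2 ^ N → (0 : ℝ) ≤ ((i : ℤ) : ℝ) / 2 ^ N ∧ (((i : ℤ) : ℝ) + 1) / 2 ^ N ≤ 1 := by
    intro i hi
    refine ⟨by positivity, ?_⟩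
    rw [div_le_one (by positivity)]
    exact_mod_cast hi
  have h' := fun (i : ℕ) (hi : i < 2 ^ N) => h i (key i hi).1 (key i hi).2
  refine ⟨fun i => i / 2 ^ N, 2 ^ N, fun i => extendReal f (i / 2 ^ N), ⟨by simp, by simp,
    fun i hi => ⟨i, N, by simp, by simp⟩⟩, ⟨by simp [extendReal_zero], ?_,
    fun i hi => ?_⟩, ⟨fun i hi => rfl, fun i hi => ?_⟩⟩
  · simp only [Nat.cast_pow, Nat.cast_ofNat]
    rw [div_self (by positivity), extendReal_one_right]
  · have := (h' i hi).2
    push_cast at this ⊢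
    exact this
  · have := (h' i hi).1
    push_cast at this ⊢
    exact this

/-! ### Generation of $F$ by two elements -/

/-- Here `a` counts the intervals left of $1/2$. If there are at least two, $1/4$ is also a
partition point, and applying `xZero` moves it to $1/2$, which leaves strictly fewer intervals on
the left. Repeating this ends with the single interval $[0,1/2]$. -/
theorem exists_half_first {H : Subgroup F} (hx : xZero ∈ H) (a : ℕ) : ∀ {p : ℕ → ℝ} {n : ℕ},
    StdPart p n → 0 < a → a < n → p a = 1 / 2 →
    ∃ h ∈ H, ∃ p', StdPart p' n ∧ p' 1 = 1 / 2 ∧ AffineBetween h p n p' := by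
  induction a using Nat.strong_induction_on with
  | _ a ih =>
    intro p n hp ha han hpa
    rcases (Nat.succ_le_of_lt ha).eq_or_lt with h | h
    · rw [← h] at hpa
      exact ⟨1, H.one_mem, p, hp, hpa, .one p n⟩
    obtain ⟨b, hb0, hba, hb⟩ := (hp.double han hpa).exists_half h
    have hpb : p b = 1 / 4 := by linarith
    have hp' := hp.xZero hba han hpa hpb
    have hAff : AffineBetween xZero p n (fun i => extendReal xZero (p i)) := by
      refine ⟨fun _ _ => rfl, fun i hi => ?_⟩
      have h0 : 0 ≤ p i := hp.zero ▸ hp.mono (Nat.zero_le _) (by omega)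
      rcases lt_or_ge i b with hib | hib
      · have h1 : p (i + 1) ≤ 1 / 4 := hpb ▸ hp.mono (by omega) (by omega)
        exact ⟨2, 0, fun t ht => by
          rw [xZero_left (h0.trans ht.1) (ht.2.trans h1), add_zero]⟩
      have h0' : 1 / 4 ≤ p i := hpb ▸ hp.mono hib (by omega)
      rcases lt_or_ge i a with hia | hia
      · have h1 : p (i + 1) ≤ 1 / 2 := hpa ▸ hp.mono (by omega) (by omega)
        exact ⟨1, 1 / 4, fun t ht => by rw [xZero_mid (h0'.trans ht.1) (ht.2.trans h1), one_mul]⟩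
      have h0'' : 1 / 2 ≤ p i := hpa ▸ hp.mono hia (by omega)
      have h1 : p (i + 1) ≤ 1 := hp.last ▸ hp.mono (by omega) (by omega)
      exact ⟨1 / 2, 1 / 2, fun t ht => by
        rw [xZero_right (h0''.trans ht.1) (ht.2.trans h1)]; ring⟩
    obtain ⟨h, hh, p', h1, h2, h3⟩ := ih b hba hp' hb0 (hba.trans han)
      (by rw [hpb, xZero_mid le_rfl (by norm_num)]; norm_num)
    exact ⟨h * xZero, H.mul_mem hh hx, p', h1, h2, h3.mul hAff⟩

/-- Induction on the number of intervals. After multiplication on both sides by elements of `H`,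
both partitions begin with $[0,1/2]$; the map is affine there with fixed ends, hence the identity,
and is therefore the right copy of an element described by one interval less. -/
theorem mem_of_affineBetween {H : Subgroup F} (hx : xZero ∈ H) (hH : ∀ f ∈ H, rightCopy f ∈ H)
    (n : ℕ) : ∀ {p q : ℕ → ℝ} {f : F}, StdPart p n → StdPart q n → AffineBetween f p n q →
      f ∈ H := by
  induction n with
  | zero => intro p q f hp; exact absurd hp.pos (lt_irrefl _)
  | succ n ih =>
    intro p q f hp hq hf
    rcases Nat.eq_zero_or_pos n with rfl | hn
    · have h1 : p 1 = 1 := hp.last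
      have := hf.eq_on_first one_pos hp.zero (h1.trans hq.last.symm) (by rw [h1]; norm_num)
      rw [h1] at this
      have : f = 1 := F_ext fun t ht => by rw [this t ht, extendReal_one]
      rw [this]
      exact H.one_mem
    obtain ⟨a, ha0, ha1, ha⟩ := hp.exists_half (by omega)
    obtain ⟨b, hb0, hb1, hb⟩ := hq.exists_half (by omega)
    obtain ⟨u, hu, p', hp', hp1, hup⟩ := exists_half_first hx a hp ha0 ha1 ha
    obtain ⟨v, hv, q', hq', hq1, hvq⟩ := exists_half_first hx b hq hb0 hb1 hb
    have hf' : AffineBetween (v * f * u⁻¹) p' (n + 1) q' := (hvq.mul hf).mul (hup.inv hp)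
    suffices h : v * f * u⁻¹ ∈ H by
      have := H.mul_mem (H.mul_mem (H.inv_mem hv) h) hu
      simpa [mul_assoc] using this
    generalize v * f * u⁻¹ = g at hf'
    have h1 := hf'.eq_on_first (Nat.succ_pos _) hp'.zero (hp1.trans hq1.symm)
      (by rw [hp1]; norm_num)
    rw [hp1] at h1
    obtain ⟨k, rfl⟩ : ∃ k, rightCopy k = g := by
      refine exists_copy_eq g (fun t ht => ?_) fun t ht => ?_
      · rcases le_total t 0 with h | h
        · exact extendReal_of_nonpos _ h
        · exact h1 t ⟨h, ht⟩
      · refine extendReal_of_one_le _ ?_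
        norm_num at ht
        exact ht
    refine hH k (ih (hp'.double_sub_one hp1) (hq'.double_sub_one hq1) ⟨fun i hi => ?_,
      fun i hi => ?_⟩)
    · have e1 := hf'.map (i + 1) (by omega)
      have e2 := extendReal_rightCopy k (2 * p' (i + 1) - 1)
      rw [show (2 * p' (i + 1) - 1) / 2 + 1 / 2 = p' (i + 1) by ring, e1] at e2
      linarith
    · obtain ⟨m, c, e⟩ := hf'.affine (i + 1) (by omega)
      refine ⟨m, m + 2 * c - 1, fun t ht => ?_⟩
      have e1 := e (t / 2 + 1 / 2) ⟨by linarith [ht.1], by linarith [ht.2]⟩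
      rw [extendReal_rightCopy] at e1
      linarith

theorem closure_generators : Subgroup.closure {xZero, rightCopy xZero} = ⊤ := by
  rw [eq_top_iff]
  intro f _
  obtain ⟨p, n, q, hp, hq, hf⟩ := exists_affineBetween f
  refine mem_of_affineBetween (Subgroup.subset_closure (by simp)) (fun g hg => ?_) n hp hq hf
  have h0 : xZero ∈ Subgroup.closure {xZero, rightCopy xZero} :=
    Subgroup.subset_closure (by simp)
  have h1 : rightCopy xZero ∈ Subgroup.closure {xZero, rightCopy xZero} :=
    Subgroup.subset_closure (by simp)
  induction hg using Subgroup.closure_induction with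
  | mem x hx =>
    rcases hx with rfl | rfl
    · exact h1
    · rw [rightCopy_rightCopy]
      exact Subgroup.mul_mem _ (Subgroup.mul_mem _ h0 h1) (Subgroup.inv_mem _ h0)
  | one => rw [map_one]; exact Subgroup.one_mem _
  | mul x y _ _ hx hy => rw [map_mul]; exact Subgroup.mul_mem _ hx hy
  | inv x _ hx => rw [map_inv]; exact Subgroup.inv_mem _ hx

/-- Homomorphisms from `F` to commutative groups are determined by the slopes at the end points. -/
theorem map_eq_zpow_mul_zpow {A : Type*} [CommGroup A] (τ : F →* A) (f : F) :
    τ f = (τ xZero) ^ slope f * (τ (rightCopy xZero)) ^ (-(slope f + slope (flip f))) := by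
  have hf : f ∈ Subgroup.closure {xZero, rightCopy xZero} := by
    rw [closure_generators]; trivial
  induction hf using Subgroup.closure_induction with
  | mem x hx =>
    rcases hx with rfl | rfl
    · rw [slope_xZero, slope_flip_xZero]; simp
    · rw [slope_rightCopy, slope_flip_rightCopy, slope_flip_xZero]; simp
  | one => simp
  | mul x y _ _ hx hy =>
    rw [map_mul, hx, hy, slope_mul, map_mul, slope_mul, mul_mul_mul_comm, ← zpow_add, ← zpow_add]
    congr 2
    ring
  | inv x _ hx =>
    rw [map_inv, hx, slope_inv, map_inv, slope_inv, mul_inv, ← zpow_neg, ← zpow_neg]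
    congr 2
    ring

/-! ### The derived subgroup -/

/-- The slope exponents are homomorphisms to a commutative group, so they vanish on commutators.
Conversely, the class of `f` in the abelianization is determined by the two exponents. -/
theorem mem_derived_iff {f : F} : f ∈ F' ↔ slope f = 0 ∧ slope (flip f) = 0 := by
  constructor
  · intro h
    have h1 : F' ≤ logZero.ker := Abelianization.commutator_subset_ker _
    have h2 : F' ≤ (logZero.comp flip).ker := Abelianization.commutator_subset_ker _
    exact ⟨h1 h, h2 h⟩
  · rintro ⟨h1, h2⟩
    change f ∈ commutator F
    rw [← Abelianization.ker_of, MonoidHom.mem_ker, map_eq_zpow_mul_zpow Abelianization.of f, h1,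
      h2]
    simp

/-! ### Generalities on bi-orderings -/

namespace BiOrdering

variable {G G' : Type*} [Group G] [Group G'] (r s : BiOrdering G)

theorem not_pos_one : ¬ r.Pos 1 := fun h => h.2 rfl

variable {r s}

theorem le_iff {g h : G} : r.le g h ↔ g = h ∨ r.Pos (g⁻¹ * h) := by
  constructor
  · intro hle
    by_cases e : g = h
    · exact .inl e
    · have := r.mul_left g⁻¹ g h hle
      rw [inv_mul_cancel] at this
      exact .inr ⟨this, fun e' => e (inv_mul_eq_one.1 e')⟩
  · rintro (rfl | h')
    · exact r.le_refl _
    · have := r.mul_left g _ _ h'.1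
      simpa using this

theorem Pos.mul {g h : G} (hg : r.Pos g) (hh : r.Pos h) : r.Pos (g * h) := by
  have h1 : r.le g (g * h) := by simpa using r.mul_left g _ _ hh.1
  refine ⟨r.le_trans _ _ _ hg.1 h1, fun e => hg.2 ?_⟩
  rw [e] at h1
  exact r.le_antisymm _ _ h1 hg.1

theorem Pos.conj {g : G} (hg : r.Pos g) (a : G) : r.Pos (a * g * a⁻¹) := by
  refine ⟨?_, fun e => hg.2 ?_⟩
  · have := r.mul_right a⁻¹ _ _ (r.mul_left a _ _ hg.1)
    simpa using this
  · simpa using e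

theorem pos_conj_iff {g : G} (a : G) : r.Pos (a * g * a⁻¹) ↔ r.Pos g := by
  refine ⟨fun h => ?_, fun h => h.conj a⟩
  have := h.conj a⁻¹
  simpa [mul_assoc] using this

theorem Pos.not_inv {g : G} (hg : r.Pos g) : ¬ r.Pos g⁻¹ := fun h =>
  r.not_pos_one (by simpa using hg.mul h)

theorem pos_or_inv {g : G} (hg : g ≠ 1) : r.Pos g ∨ r.Pos g⁻¹ := by
  rcases r.le_total 1 g with h | h
  · exact .inl ⟨h, hg⟩
  · right
    have := r.mul_left g⁻¹ _ _ h
    refine ⟨by simpa using this, by simpa using hg⟩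

theorem not_pos_iff {g : G} : ¬ r.Pos g ↔ g = 1 ∨ r.Pos g⁻¹ := by
  constructor
  · intro h
    by_cases e : g = 1
    · exact .inl e
    · exact .inr ((pos_or_inv e).resolve_left h)
  · rintro (rfl | h)
    · exact r.not_pos_one
    · exact fun h' => h'.not_inv h

theorem ext_pos (h : ∀ g, r.Pos g ↔ s.Pos g) : r = s := by
  ext a b
  rw [le_iff, le_iff, h]

/-- A bi-ordering is determined by half of its positive cone being recognised. -/
theorem pos_iff_of_imp {P : G → Prop} (h : ∀ g, P g → r.Pos g) (hP : ∀ g, g ≠ 1 → P g ∨ P g⁻¹)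
    (g : G) : r.Pos g ↔ P g := by
  refine ⟨fun hg => ?_, h g⟩
  by_contra hn
  by_cases e : g = 1
  · subst e; exact r.not_pos_one hg
  · exact hg.not_inv (h _ ((hP g e).resolve_left hn))

theorem HasCone.unique {C : Set G} (hr : r.HasCone C) (hs : s.HasCone C) : r = s :=
  ext_pos fun g => (hr g).trans (hs g).symm

/-- The bi-ordering with a given positive cone. -/
def ofCone (C : Set G) (h1 : (1 : G) ∉ C) (hmul : ∀ g ∈ C, ∀ h ∈ C, g * h ∈ C)
    (hconj : ∀ g ∈ C, ∀ a, a * g * a⁻¹ ∈ C) (htot : ∀ g, g ≠ 1 → g ∈ C ∨ g⁻¹ ∈ C) :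
    BiOrdering G where
  le g h := g = h ∨ g⁻¹ * h ∈ C
  le_refl g := .inl rfl
  le_antisymm g h := by
    rintro (rfl | h') (h'' | h'')
    · rfl
    · rfl
    · exact h''.symm
    · exact absurd (by simpa [mul_assoc] using hmul _ h' _ h'') h1
  le_trans g h k := by
    rintro (rfl | h') (rfl | h'')
    · exact .inl rfl
    · exact .inr h''
    · exact .inr h'
    · exact .inr (by simpa [mul_assoc] using hmul _ h' _ h'')
  le_total g h := by
    by_cases e : g = h
    · exact .inl (.inl e)
    · rcases htot (g⁻¹ * h) (fun e' => e (inv_mul_eq_one.1 e')) with h' | h'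
      · exact .inl (.inr h')
      · exact .inr (.inr (by simpa using h'))
  mul_left a g h := by
    rintro (rfl | h')
    · exact .inl rfl
    · exact .inr (by simpa [mul_assoc] using h')
  mul_right a g h := by
    rintro (rfl | h')
    · exact .inl rfl
    · exact .inr (by simpa [mul_assoc] using hconj _ h' a⁻¹)

theorem pos_ofCone {C : Set G} {h1 : (1 : G) ∉ C} {hmul : ∀ g ∈ C, ∀ h ∈ C, g * h ∈ C}
    {hconj : ∀ g ∈ C, ∀ a, a * g * a⁻¹ ∈ C} {htot : ∀ g, g ≠ 1 → g ∈ C ∨ g⁻¹ ∈ C} (g : G) :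
    (ofCone C h1 hmul hconj htot).Pos g ↔ g ∈ C := by
  constructor
  · rintro ⟨rfl | h, hne⟩
    · exact absurd rfl hne
    · simpa using h
  · intro h
    refine ⟨.inr (by simpa using h), ?_⟩
    rintro rfl
    exact h1 h

/-- The pull-back of a bi-ordering by an injective homomorphism. -/
def comap (r : BiOrdering G') (φ : G →* G') (hφ : Function.Injective φ) : BiOrdering G where
  le g h := r.le (φ g) (φ h)
  le_refl g := r.le_refl _
  le_antisymm g h h1 h2 := hφ (r.le_antisymm _ _ h1 h2)
  le_trans g h k := r.le_trans _ _ _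
  le_total g h := r.le_total _ _
  mul_left a g h h' := by simpa using r.mul_left (φ a) _ _ h'
  mul_right a g h h' := by simpa using r.mul_right (φ a) _ _ h'

theorem pos_comap {r : BiOrdering G'} {φ : G →* G'} {hφ : Function.Injective φ} {g : G} :
    (r.comap φ hφ).Pos g ↔ r.Pos (φ g) := by
  have h : φ g = 1 ↔ g = 1 := by rw [← map_one φ, hφ.eq_iff]
  simp [Pos, comap, h]

/-! ### The topology -/

theorem isOpen_pos (g : G) : IsOpen {r : BiOrdering G | r.Pos g} := by
  classical
  rw [isOpen_iff_mem_nhds]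
  intro r hr
  refine Filter.mem_of_superset (IsOpen.mem_nhds (.basic _ ⟨r, {1, g}, rfl⟩) ?_) ?_
  · exact fun _ _ _ _ => Iff.rfl
  · intro r' hr'
    exact ⟨(hr' 1 (by simp) g (by simp)).2 hr.1, hr.2⟩

/-- For $g\ne1$, not being positive means that $g^{-1}$ is positive; conditions on signs are thus
clopen as soon as they are open. Continuity into the space of orderings can then be tested on
positivity alone. -/
theorem isOpen_not_pos {X : Type*} [TopologicalSpace X] {φ : X → BiOrdering G}
    (h : ∀ g, IsOpen {x | (φ x).Pos g}) (g : G) : IsOpen {x | ¬ (φ x).Pos g} := by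
  by_cases e : g = 1
  · subst e
    simp only [not_pos_one, not_false_eq_true]
    exact isOpen_univ
  · simp only [not_pos_iff, e, false_or]
    exact h _

theorem isOpen_pos_iff {X : Type*} [TopologicalSpace X] {φ : X → BiOrdering G}
    (h : ∀ g, IsOpen {x | (φ x).Pos g}) (r : BiOrdering G) (g : G) :
    IsOpen {x | (φ x).Pos g ↔ r.Pos g} := by
  by_cases hr : r.Pos g
  · simp only [hr, iff_true]
    exact h _
  · simp only [hr, iff_false]
    exact isOpen_not_pos h _

theorem continuous_of_isOpen_pos {X : Type*} [TopologicalSpace X] {φ : X → BiOrdering G}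
    (h : ∀ g, IsOpen {x | (φ x).Pos g}) : Continuous φ := by
  refine continuous_generateFrom_iff.2 ?_
  rintro _ ⟨r, A, rfl⟩
  have : φ ⁻¹' basicNhd r A = ⋂ g ∈ A, ⋂ h ∈ A, {x | (φ x).le g h ↔ r.le g h} := by
    ext x; simp [basicNhd]
  rw [this]
  refine isOpen_biInter_finset fun g _ => isOpen_biInter_finset fun k _ => ?_
  by_cases e : g = k
  · subst e
    simp only [le_refl]
    exact isOpen_univ
  simp only [le_iff, e, false_or]
  exact isOpen_pos_iff h _ _

instance : T2Space (BiOrdering G) := by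
  refine ⟨fun r s hrs => ?_⟩
  obtain ⟨g, hg⟩ : ∃ g, r.Pos g ∧ ¬ s.Pos g := by
    by_contra! hcon
    refine hrs (ext_pos fun g => ⟨hcon g, fun hg => ?_⟩)
    by_contra hn
    rcases not_pos_iff.1 hn with rfl | h
    · exact s.not_pos_one hg
    · exact hg.not_inv (hcon _ h)
  have hg' : s.Pos g⁻¹ := by
    rcases not_pos_iff.1 hg.2 with rfl | h
    · exact absurd hg.1 r.not_pos_one
    · exact h
  exact ⟨_, _, isOpen_pos g, isOpen_pos g⁻¹, hg.1, hg', Set.disjoint_left.2 fun t h1 h2 =>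
    Pos.not_inv (r := t) h1 h2⟩

open Classical in
/-- A bi-ordering as a linear order. -/
noncomputable abbrev toLinearOrder (r : BiOrdering G) : LinearOrder G where
  le := r.le
  le_refl := r.le_refl
  le_antisymm := r.le_antisymm
  le_trans := r.le_trans
  le_total := r.le_total
  toDecidableLE := Classical.decRel _

theorem pos_iff_lt (r : BiOrdering G) {g : G} : r.Pos g ↔ r.toLinearOrder.lt 1 g := by
  let := r.toLinearOrder
  change _ ↔ 1 < g
  rw [lt_iff_le_and_ne]
  exact and_congr_right fun _ => ne_comm

theorem mulLeftMono (r : BiOrdering G) : letI := r.toLinearOrder; MulLeftMono G := by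
  let := r.toLinearOrder
  exact ⟨fun a g h => r.mul_left a g h⟩

theorem mulRightMono (r : BiOrdering G) : letI := r.toLinearOrder; MulRightMono G := by
  let := r.toLinearOrder
  exact ⟨fun a g h => r.mul_right a g h⟩

end BiOrdering

/-! ### Hölder's theorem -/

section Holder

theorem zpow_strictMono_of_one_lt {G : Type*} [Group G] [LinearOrder G] [MulLeftMono G] {u : G}
    (hu : 1 < u) : StrictMono fun n : ℤ => u ^ n := by
  have : MulLeftStrictMono G := inferInstance
  refine strictMono_int_of_lt_succ fun n => ?_
  rw [zpow_add_one]
  exact lt_mul_of_one_lt_right' _ hu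

variable {G : Type*} [Group G] [LinearOrder G] [MulLeftMono G] [MulRightMono G]

/-- If $gh\le hg$, every exchange of $gh$ for $hg$ inside a word increases it. Hence
$g^nh^n\le(gh)^n\le(hg)^n\le h^ng^n$, which replaces commutativity in Hölder's argument. -/
theorem pow_mul_le_mul_pow {g h : G} (hgh : g * h ≤ h * g) (n : ℕ) : g ^ n * h ≤ h * g ^ n := by
  induction n with
  | zero => simp
  | succ n ih =>
    calc g ^ (n + 1) * h = g * (g ^ n * h) := by rw [pow_succ', mul_assoc]
      _ ≤ g * (h * g ^ n) := mul_le_mul_right ih g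
      _ = g * h * g ^ n := by rw [mul_assoc]
      _ ≤ h * g * g ^ n := mul_le_mul_left hgh _
      _ = h * g ^ (n + 1) := by rw [pow_succ', mul_assoc]

theorem mul_pow_le_pow_mul {g h : G} (hgh : g * h ≤ h * g) (n : ℕ) : g * h ^ n ≤ h ^ n * g := by
  induction n with
  | zero => simp
  | succ n ih =>
    calc g * h ^ (n + 1) = g * h ^ n * h := by rw [pow_succ, mul_assoc]
      _ ≤ h ^ n * g * h := mul_le_mul_left ih h
      _ = h ^ n * (g * h) := by rw [mul_assoc]
      _ ≤ h ^ n * (h * g) := mul_le_mul_right hgh _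
      _ = h ^ (n + 1) * g := by rw [pow_succ, mul_assoc]

theorem mul_pow_le {g h : G} (hgh : g * h ≤ h * g) (n : ℕ) : (h * g) ^ n ≤ h ^ n * g ^ n := by
  induction n with
  | zero => simp
  | succ n ih =>
    calc (h * g) ^ (n + 1) = (h * g) ^ n * (h * g) := pow_succ _ _
      _ ≤ h ^ n * g ^ n * (h * g) := mul_le_mul_left ih _
      _ = h ^ n * (g ^ n * h) * g := by simp only [mul_assoc]
      _ ≤ h ^ n * (h * g ^ n) * g :=
        mul_le_mul_left (mul_le_mul_right (pow_mul_le_mul_pow hgh _) _) _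
      _ = h ^ (n + 1) * g ^ (n + 1) := by rw [pow_succ h, pow_succ g]; simp only [mul_assoc]

theorem le_mul_pow {g h : G} (hgh : g * h ≤ h * g) (n : ℕ) : g ^ n * h ^ n ≤ (g * h) ^ n := by
  induction n with
  | zero => simp
  | succ n ih =>
    calc g ^ (n + 1) * h ^ (n + 1) = g ^ n * (g * h ^ n) * h := by
          rw [pow_succ g, pow_succ h]; simp only [mul_assoc]
      _ ≤ g ^ n * (h ^ n * g) * h := mul_le_mul_left (mul_le_mul_right (mul_pow_le_pow_mul hgh _) _) _
      _ = g ^ n * h ^ n * (g * h) := by simp only [mul_assoc]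
      _ ≤ (g * h) ^ n * (g * h) := mul_le_mul_left ih _
      _ = (g * h) ^ (n + 1) := (pow_succ _ _).symm

variable {u : G}

theorem exists_floor (hu : 1 < u) (hb : ∀ g, ∃ m : ℤ, g ≤ u ^ m) (g : G) :
    ∃ m : ℤ, u ^ m ≤ g ∧ g < u ^ (m + 1) := by
  have hmono := zpow_strictMono_of_one_lt hu
  obtain ⟨M, hM⟩ := hb g
  obtain ⟨N, hN⟩ := hb g⁻¹
  obtain ⟨m, hm, hm'⟩ := Int.exists_greatest_of_bdd (P := fun m : ℤ => u ^ m ≤ g)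
    ⟨M, fun z hz => hmono.le_iff_le.1 (le_trans (b := g) hz hM)⟩
    ⟨-N, by rw [zpow_neg]; exact inv_le_of_inv_le' hN⟩
  refine ⟨m, hm, not_le.1 fun h => ?_⟩
  have := hm' _ h
  omega

/-- The homomorphism to `ℝ` given by Hölder's theorem for an element `u` whose powers are
cofinal. -/
theorem exists_hom_real (hu : 1 < u) (hb : ∀ g, ∃ m : ℤ, g ≤ u ^ m) :
    ∃ τ : G →* Multiplicative ℝ, (τ u).toAdd = 1 ∧ ∀ g, 0 < (τ g).toAdd → 1 < g := by
  have hmono := zpow_strictMono_of_one_lt hu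
  choose m hm1 hm2 using exists_floor hu hb
  have hle : ∀ {g : G} {k : ℤ}, u ^ k ≤ g → k ≤ m g := fun {g k} h => by
    have := hmono.lt_iff_lt.1 (lt_of_le_of_lt (b := g) h (hm2 g))
    omega
  have hlt : ∀ {g : G} {k : ℤ}, g < u ^ k → m g < k := fun {g k} h =>
    hmono.lt_iff_lt.1 (lt_of_le_of_lt (b := g) (hm1 g) h)
  have hsup : ∀ g h, m g + m h ≤ m (g * h) := fun g h =>
    hle (by rw [zpow_add]; exact mul_le_mul' (hm1 g) (hm1 h))
  have hsub : ∀ g h, m (g * h) ≤ m g + m h + 1 := fun g h => by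
    have := hlt (g := g * h) (k := (m g + 1) + (m h + 1)) (by
      rw [zpow_add]; exact mul_lt_mul_of_lt_of_lt (hm2 g) (hm2 h))
    omega
  have hmon : ∀ {g h : G}, g ≤ h → m g ≤ m h := fun {g h} e => hle ((hm1 g).trans e)
  have hlim : ∀ g : G, ∃ l : ℝ, Filter.Tendsto (fun n : ℕ => (m (g ^ n) : ℝ) / n) Filter.atTop
      (nhds l) := fun g => by
    -- The integer part `m` is superadditive, so Fekete's lemma applied to its negative yields the
    -- limit of $m(g^n)/n$; the upper bound below makes it finite.
    have hS : Subadditive fun n : ℕ => -(m (g ^ n) : ℝ) := fun a b => by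
      have := hsup (g ^ a) (g ^ b)
      rw [← pow_add] at this
      have : (m (g ^ a) : ℝ) + m (g ^ b) ≤ m (g ^ (a + b)) := by exact_mod_cast this
      linarith
    have hup : ∀ n : ℕ, m (g ^ n) ≤ n * (m g + 1) := fun n => by
      have : g ^ n ≤ u ^ ((m g + 1) * n) := by
        rw [zpow_mul, zpow_natCast]
        exact pow_le_pow_left' (hm2 g).le n
      have := hmono.le_iff_le.1 ((hm1 (g ^ n)).trans this)
      linarith
    have hbd : BddBelow (Set.range fun n : ℕ => -(m (g ^ n) : ℝ) / n) := by
      refine ⟨-(|(m g : ℝ)| + 1), ?_⟩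
      rintro _ ⟨n, rfl⟩
      simp only
      rcases Nat.eq_zero_or_pos n with rfl | hn
      · have := abs_nonneg (m g : ℝ)
        simp; linarith
      · have hn' : (0 : ℝ) < n := by exact_mod_cast hn
        rw [le_div_iff₀ hn']
        have h1 : (m (g ^ n) : ℝ) ≤ n * (m g + 1) := by exact_mod_cast hup n
        have h2 := le_abs_self (m g : ℝ)
        nlinarith
    refine ⟨_, (hS.tendsto_lim hbd).neg.congr fun n => ?_⟩
    ring
  choose l hl using hlim
  have hadd : ∀ g h, l (g * h) = l g + l h := fun g h => by
    -- The word inequalities squeeze $(gh)^n$ between the two products of $g^n$ and $h^n$. The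
    -- defect is therefore at most $1$ for every $n$, and it disappears after division by $n$.
    have hbd : ∀ n : ℕ, |(m ((g * h) ^ n) : ℝ) - (m (g ^ n) + m (h ^ n))| ≤ 1 := fun n => by
      have key : m (g ^ n) + m (h ^ n) ≤ m ((g * h) ^ n) ∧
          m ((g * h) ^ n) ≤ m (g ^ n) + m (h ^ n) + 1 := by
        rcases le_total (g * h) (h * g) with hc | hc
        · refine ⟨(hsup _ _).trans (hmon (le_mul_pow hc n)),
            (hmon ((pow_le_pow_left' hc n).trans (mul_pow_le hc n))).trans ?_⟩
          have := hsub (h ^ n) (g ^ n)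
          omega
        · refine ⟨?_, (hmon (mul_pow_le hc n)).trans (hsub _ _)⟩
          have := (hsup _ _).trans (hmon ((le_mul_pow hc n).trans (pow_le_pow_left' hc n)))
          omega
      obtain ⟨k1, k2⟩ := key
      have k1' : (m (g ^ n) : ℝ) + m (h ^ n) ≤ m ((g * h) ^ n) := by exact_mod_cast k1
      have k2' : (m ((g * h) ^ n) : ℝ) ≤ m (g ^ n) + m (h ^ n) + 1 := by exact_mod_cast k2
      rw [abs_le]
      constructor <;> linarith
    have h0 : Filter.Tendsto (fun n : ℕ => (m ((g * h) ^ n) : ℝ) / n -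
        ((m (g ^ n) : ℝ) / n + (m (h ^ n) : ℝ) / n)) Filter.atTop (nhds 0) := by
      refine squeeze_zero_norm (fun n => ?_) tendsto_one_div_atTop_nhds_zero_nat
      rw [Real.norm_eq_abs, ← add_div, ← sub_div, abs_div, Nat.abs_cast]
      gcongr
      exact hbd n
    have := tendsto_nhds_unique h0 ((hl (g * h)).sub ((hl g).add (hl h)))
    linarith
  refine ⟨MonoidHom.mk' (fun g => Multiplicative.ofAdd (l g)) fun g h => by rw [hadd]; rfl, ?_, ?_⟩
  · change l u = 1
    refine tendsto_nhds_unique (hl u) (tendsto_const_nhds.congr' ?_)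
    filter_upwards [Filter.eventually_gt_atTop 0] with n hn
    have : m (u ^ n) = n := by
      refine le_antisymm ?_ (hle (by simp))
      have := hlt (g := u ^ n) (k := n + 1) (by rw [← zpow_natCast]; exact hmono (by omega))
      omega
    rw [this, Int.cast_natCast, div_self (by positivity)]
  · intro g hg
    change 0 < l g at hg
    by_contra hn
    refine absurd hg (not_lt.2 (le_of_tendsto' (hl g) fun n => ?_))
    have h1 : g ^ n ≤ 1 := pow_le_one' (not_lt.1 hn) n
    have h2 : m (g ^ n) < 1 := hlt (h1.trans_lt (by simpa using hu))
    have h3 : (m (g ^ n) : ℝ) ≤ 0 := by exact_mod_cast Int.lt_add_one_iff.1 h2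
    exact div_nonpos_of_nonpos_of_nonneg h3 (Nat.cast_nonneg n)

end Holder

/-! ### Bi-orderings of `F'` -/

/-- Take the larger of the absolute values of the two generators: a word of length $m$ is bounded by
its $m$-th power. -/
theorem exists_cofinal [LinearOrder F] [MulLeftMono F] [MulRightMono F] :
    ∃ u : F, 1 < u ∧ ∀ g, ∃ m : ℤ, g ≤ u ^ m := by
  have hx : xZero ≠ 1 := fun h => by
    have := slope_xZero
    rw [h, slope_one] at this
    omega
  have habs : ∀ g : F, ∃ v, 1 ≤ v ∧ g ≤ v ∧ g⁻¹ ≤ v ∧ (v = g ∨ v = g⁻¹) := fun g => by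
    rcases le_total 1 g with h | h
    · exact ⟨g, h, le_rfl, (Right.inv_le_one_iff.2 h).trans h, .inl rfl⟩
    · have h' : 1 ≤ g⁻¹ := Right.one_le_inv_iff.2 h
      exact ⟨g⁻¹, h', h.trans h', le_rfl, .inr rfl⟩
  obtain ⟨v, hv1, hv2, hv3, hv4⟩ := habs xZero
  obtain ⟨w, hw1, hw2, hw3, hw4⟩ := habs (rightCopy xZero)
  have hv : 1 < v := lt_of_le_of_ne hv1 fun h => by
    rcases hv4 with e | e
    · exact hx (e ▸ h.symm)
    · exact hx (inv_eq_one.1 (e ▸ h.symm))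
  refine ⟨max v w, lt_max_of_lt_left hv, fun g => ?_⟩
  have hu : 1 ≤ max v w := hv1.trans (le_max_left _ _)
  -- Bounding the inverse at the same time lets the induction pass to inverses.
  suffices ∃ m : ℕ, g ≤ max v w ^ m ∧ g⁻¹ ≤ max v w ^ m by
    obtain ⟨m, hm, _⟩ := this
    exact ⟨m, by simpa using hm⟩
  have hg : g ∈ Subgroup.closure {xZero, rightCopy xZero} := by
    rw [closure_generators]; trivial
  induction hg using Subgroup.closure_induction with
  | mem x hx =>
    rcases hx with rfl | rfl
    · exact ⟨1, by simp [hv2], by simp [hv3]⟩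
    · exact ⟨1, by simp [hw2], by simp [hw3]⟩
  | one => exact ⟨0, by simp, by simp⟩
  | mul x y _ _ hx hy =>
    obtain ⟨m, h1, h2⟩ := hx
    obtain ⟨n, h3, h4⟩ := hy
    refine ⟨m + n, ?_, ?_⟩
    · rw [pow_add]; exact mul_le_mul' h1 h3
    · rw [mul_inv_rev, add_comm, pow_add]; exact mul_le_mul' h4 h2
  | inv x _ hx =>
    obtain ⟨m, h1, h2⟩ := hx
    exact ⟨m, h2, by simpa using h1⟩

/-- Hölder's homomorphism has a commutative target, so it is a combination of the two end slopes.
The coefficients are not both zero, since the homomorphism takes the value $1$ at the cofinal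
element. -/
theorem BiOrdering.exists_slope_coeff (r : BiOrdering F) : ∃ α β : ℝ, (α ≠ 0 ∨ β ≠ 0) ∧
    ∀ f, 0 < α * slope f + β * slope (flip f) → r.Pos f := by
  let := r.toLinearOrder
  have := r.mulLeftMono
  have := r.mulRightMono
  obtain ⟨u, hu, hb⟩ := exists_cofinal
  obtain ⟨τ, h1, h2⟩ := exists_hom_real hu hb
  have h3 : ∀ f, (τ f).toAdd = ((τ xZero).toAdd - (τ (rightCopy xZero)).toAdd) * slope f +
      -(τ (rightCopy xZero)).toAdd * slope (flip f) := fun f => by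
    rw [map_eq_zpow_mul_zpow τ f]
    simp only [toAdd_mul, toAdd_zpow, zsmul_eq_mul]
    push_cast
    ring
  refine ⟨_, _, ?_, fun f hf => (r.pos_iff_lt).2 (h2 f (by rw [h3]; exact hf))⟩
  by_contra! h
  have := h3 u
  rw [h1, h.1, h.2] at this
  norm_num at this

theorem slope_eq_zero_of_mem {f : F} (h : f ∈ F') : slope f = 0 := (mem_derived_iff.1 h).1

theorem slope_flip_eq_zero_of_mem {f : F} (h : f ∈ F') : slope (flip f) = 0 :=
  (mem_derived_iff.1 h).2

theorem flip_mem {f : F} (h : f ∈ F') : flip f ∈ F' := by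
  rw [mem_derived_iff, flip_flip]
  exact (mem_derived_iff.1 h).symm

theorem mem_derived_of_id {f : F} (h0 : ∃ y > 0, ∀ t ≤ y, extendReal f t = t)
    (h1 : ∃ y < 1, ∀ t ≥ y, extendReal f t = t) : f ∈ F' := by
  obtain ⟨y, hy, e⟩ := h0
  obtain ⟨z, hz, e'⟩ := h1
  exact mem_derived_iff.2 ⟨slope_eq_zero_of_id hy e, slope_flip_eq_zero_of_id hz e'⟩

/-! ### The middle copy of $F$ in $F'$, and conjugation into it -/

theorem exists_mem_map_pair {a b c d : ℝ} (ha : IsDyadic a) (hb : IsDyadic b) (hc : IsDyadic c)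
    (hd : IsDyadic d) (h0a : 0 < a) (hab : a < b) (hb1 : b < 1) (h0c : 0 < c) (hcd : c < d)
    (hd1 : d < 1) : ∃ w ∈ F', extendReal w a = c ∧ extendReal w b = d := by
  obtain ⟨w, h1, h2, h3, h4⟩ := exists_map_pair ha hb hc hd h0a hab hb1 h0c hcd hd1
  exact ⟨w, mem_derived_of_id h3 h4, h1, h2⟩

theorem exists_mem_map {a c : ℝ} (ha : IsDyadic a) (hc : IsDyadic c) (h0a : 0 < a) (ha1 : a < 1)
    (h0c : 0 < c) (hc1 : c < 1) : ∃ w ∈ F', extendReal w a = c := by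
  obtain ⟨b, hb, hab, hb1⟩ := IsDyadic.exists_between ha1
  obtain ⟨d, hd, hcd, hd1⟩ := IsDyadic.exists_between hc1
  obtain ⟨w, hw, h, _⟩ := exists_mem_map_pair ha hb hc hd h0a hab hb1 h0c hcd hd1
  exact ⟨w, hw, h⟩

/-- The copy of `F` supported in `[1 / 4, 3 / 4]`. -/
noncomputable abbrev midCopy : F →* F :=
  copy (-1) (1 / 4) isDyadic_quarter (by norm_num) (by norm_num)

theorem extendReal_midCopy (f : F) (t : ℝ) :
    extendReal (midCopy f) (t / 2 + 1 / 4) = extendReal f t / 2 + 1 / 4 := by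
  have := extendReal_copy (k := -1) (hp := isDyadic_quarter) (h0 := by norm_num)
    (h1 := by norm_num) f t
  have e : ∀ s : ℝ, s / 2 + 1 / 4 = 2 ^ (-1 : ℤ) * s + 1 / 4 := fun s => by
    rw [zpow_neg_one]; ring
  rw [e, e]
  exact this

theorem midCopy_of_ge (f : F) {t : ℝ} (ht : 3 / 4 ≤ t) : extendReal (midCopy f) t = t :=
  extendReal_copy_of_ge f (by norm_num; exact ht)

theorem midCopy_mem (f : F) : midCopy f ∈ F' :=
  mem_derived_of_id ⟨1 / 4, by norm_num, fun _ ht => extendReal_copy_of_le f ht⟩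
    ⟨3 / 4, by norm_num, fun _ ht => midCopy_of_ge f ht⟩

/-- The interval $[1/4,3/4]$ is symmetric about $1/2$; this is the reason for choosing it. -/
theorem flip_midCopy (f : F) : flip (midCopy f) = midCopy (flip f) := by
  refine F_ext fun t _ => ?_
  obtain ⟨s, rfl⟩ : ∃ s, t = s / 2 + 1 / 4 := ⟨2 * t - 1 / 2, by ring⟩
  rw [extendReal_flip, show (1 : ℝ) - (s / 2 + 1 / 4) = (1 - s) / 2 + 1 / 4 by ring,
    extendReal_midCopy, extendReal_midCopy, extendReal_flip]
  ring

theorem firstGerm_copy {k : ℤ} {p : ℝ} {hp : IsDyadic p} {h0 : 0 ≤ p} {h1 : 2 ^ k + p ≤ 1}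
    {f : F} {l : ℤ} (h : FirstGerm f 0 l) : FirstGerm (copy k p hp h0 h1 f) p l := by
  have hk : (0 : ℝ) < 2 ^ k := by positivity
  refine ⟨hp, h0, by linarith, fun t ht => extendReal_copy_of_le f ht, h.ne_zero, ?_⟩
  have := rGerm_copy (hp := hp) (h0 := h0) (h1 := h1) h.germ
  rwa [mul_zero, zero_add] at this

/-- `midCopy` as a homomorphism to `F'`. -/
noncomputable def midCopy' : F →* F' := midCopy.codRestrict F' midCopy_mem

theorem midCopy'_injective : Function.Injective midCopy' := fun f g h =>
  copy_injective (congrArg Subtype.val h : midCopy f = midCopy g)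

/-- The restriction of `flip` to `F'`. -/
noncomputable def flip' : F' →* F' :=
  (flip.comp F'.subtype).codRestrict F' fun f => flip_mem f.2

theorem flip'_injective : Function.Injective flip' := fun f g h =>
  Subtype.ext (flip_injective (congrArg Subtype.val h : flip f = flip g))

@[simp] theorem flip'_flip' (f : F') : flip' (flip' f) = f := Subtype.ext (flip_flip f.1)

/-- Every element of `F'` is conjugate in `F'` to an element of the middle copy of `F` with
prescribed germs. -/
theorem exists_conj_midCopy {f : F} (hf : f ∈ F') {x : ℝ} {k : ℤ} (h : FirstGerm f x k) :
    ∃ w ∈ F', ∃ g, w * f * w⁻¹ = midCopy g ∧ slope g = k ∧ slope (flip g) = 0 := by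
  have hx := h.pos_of_slope_eq_zero (slope_eq_zero_of_mem hf)
  obtain ⟨y, hy, hyid⟩ := exists_id_of_slope_flip_eq_zero (slope_flip_eq_zero_of_mem hf)
  obtain ⟨b, hb, hxb, hb1⟩ := IsDyadic.exists_between (max_lt h.lt_one hy)
  rw [max_lt_iff] at hxb
  -- The first moved point goes to $1/4$, and a point `b` beyond the support goes to $1/2$, the
  -- middle of $[1/4,3/4]$. After rescaling, the element is the identity on $[1/2,1]$, so its
  -- exponent at $1$ vanishes.
  obtain ⟨w, hw, e1, e2⟩ := exists_mem_map_pair h.dyadic hb isDyadic_quarter isDyadic_half hx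
    hxb.1 hb1 (by norm_num) (by norm_num) (by norm_num)
  have h1 := h.conj w
  rw [e1] at h1
  have h2 : ∀ t ≥ 1 / 2, extendReal (w * f * w⁻¹) t = t := fun t ht => by
    have := (extendReal_strictMono w⁻¹).monotone ht
    rw [← e2, extendReal_inv_apply] at this
    rw [extendReal_mul, extendReal_mul, hyid _ (hxb.2.le.trans this), extendReal_apply_inv]
  obtain ⟨g, hg⟩ : ∃ g, midCopy g = w * f * w⁻¹ :=
    exists_copy_eq _ h1.id_on fun t ht => h2 t (by norm_num at ht; linarith)
  refine ⟨w, hw, g, hg.symm, ?_, ?_⟩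
  · have e3 := rGerm_copy (k := -1) (p := 1 / 4) (hp := isDyadic_quarter) (h0 := by norm_num)
      (h1 := by norm_num) (rGerm_slope g)
    rw [mul_zero, zero_add] at e3
    have e4 := h1.germ
    rw [← hg] at e4
    exact e3.unique e4
  · refine slope_flip_eq_zero_of_id (y := 1 / 2) (by norm_num) fun t ht => ?_
    have e3 := extendReal_midCopy g t
    rw [hg, h2 _ (by linarith)] at e3
    linarith

/-- A conjugacy-invariant sign rule on the first germs of the elements of `F'`. -/
def FirstRule (r : BiOrdering F') (e : ℤ) : Prop :=
  ∀ (f : F') (x : ℝ) (k : ℤ), FirstGerm f x k → (r.Pos f ↔ 0 < e * k)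

theorem mul_pos_or_mul_neg_pos {e k : ℤ} (he : e ≠ 0) (hk : k ≠ 0) : 0 < e * k ∨ 0 < e * -k := by
  rcases lt_or_gt_of_ne (mul_ne_zero he hk) with h | h
  · right; rw [mul_neg]; omega
  · exact .inl h

theorem mul_pos_of_same_sign {e k l : ℤ} (h1 : 0 < e * k) (h2 : 0 < e * l) : 0 < e * (k + l) := by
  rw [mul_add]; omega

theorem firstRule_of_imp {r : BiOrdering F'} {e : ℤ} (he : e ≠ 0)
    (h : ∀ (f : F') (x : ℝ) (k : ℤ), FirstGerm f x k → 0 < e * k → r.Pos f) : FirstRule r e := by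
  intro f x k hf
  refine ⟨fun hpos => ?_, h f x k hf⟩
  refine (mul_pos_or_mul_neg_pos he hf.ne_zero).resolve_right fun hneg => ?_
  exact hpos.not_inv (h f⁻¹ x (-k) hf.inv hneg)

/-- Conjugating into the middle copy with trivial germ at the right end removes the term with `β`;
what remains is the sign of $\alpha k$, where $k$ is the exponent of the first germ. -/
theorem firstRule_of_coeff (r : BiOrdering F') {α β : ℝ} (hα : α ≠ 0)
    (h : ∀ f, 0 < α * slope f + β * slope (flip f) → r.Pos (midCopy' f)) :
    FirstRule r 1 ∨ FirstRule r (-1) := by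
  have key : ∀ (f : F') (x : ℝ) (k : ℤ), FirstGerm f x k → 0 < α * k → r.Pos f := by
    intro f x k hf hk
    obtain ⟨w, hw, g, hg, e1, e2⟩ := exists_conj_midCopy f.2 hf
    have h1 := h g (by rw [e1, e2]; simpa using hk)
    have h2 : midCopy' g = ⟨w, hw⟩ * f * ⟨w, hw⟩⁻¹ := Subtype.ext hg.symm
    rw [h2] at h1
    exact (BiOrdering.pos_conj_iff _).1 h1
  rcases lt_or_gt_of_ne hα with h0 | h0
  · right
    refine firstRule_of_imp (by norm_num) fun f x k hf hk => key f x k hf ?_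
    have : (k : ℝ) < 0 := by exact_mod_cast (by omega : k < 0)
    nlinarith
  · left
    refine firstRule_of_imp (by norm_num) fun f x k hf hk => key f x k hf ?_
    have : (0 : ℝ) < k := by exact_mod_cast (by omega : 0 < k)
    positivity

/-- The four possibilities for a bi-ordering on `F'`. -/
theorem exists_firstRule (r : BiOrdering F') : (FirstRule r 1 ∨ FirstRule r (-1)) ∨
    FirstRule (r.comap flip' flip'_injective) 1 ∨
    FirstRule (r.comap flip' flip'_injective) (-1) := by
  obtain ⟨α, β, h0, h⟩ := (r.comap midCopy' midCopy'_injective).exists_slope_coeff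
  simp only [BiOrdering.pos_comap] at h
  rcases h0 with h0 | h0
  · exact .inl (firstRule_of_coeff r h0 h)
  -- The flip commutes with the middle copy and exchanges the two end slopes, hence the two
  -- coefficients.
  · refine .inr (firstRule_of_coeff _ (α := β) (β := α) h0 fun f hf => ?_)
    rw [BiOrdering.pos_comap]
    have : flip' (midCopy' f) = midCopy' (flip f) := Subtype.ext (flip_midCopy f)
    rw [this]
    refine h _ ?_
    rw [flip_flip, add_comm]
    exact hf

/-! ### Bi-orderings of `F` for which `F'` is not convex -/

/-- The middle copy of `xZero ^ k` has its first germ at $1/4$ with exponent $k$; a conjugation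
moves it to `a`. -/
theorem exists_mem_firstGerm {a : ℝ} (ha : IsDyadic a) (h0 : 0 < a) (h1 : a < 1) {k : ℤ}
    (hk : k ≠ 0) : ∃ f ∈ F', FirstGerm f a k := by
  obtain ⟨w, -, hw⟩ := exists_mem_map isDyadic_quarter ha (by norm_num) (by norm_num) h0 h1
  have hs : slope (xZero ^ k) = k := by rw [slope_zpow, slope_xZero, mul_one]
  have hf := firstGerm_copy (k := -1) (hp := isDyadic_quarter)
    (h0 := by norm_num) (h1 := by norm_num) (FirstGerm.of_slope_ne_zero (f := xZero ^ k) (by rwa [hs]))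
  rw [hs] at hf
  refine ⟨w * midCopy (xZero ^ k) * w⁻¹, ?_, hw ▸ hf.conj w⟩
  exact (inferInstance : F'.Normal).conj_mem _ (midCopy_mem _) w

theorem FirstGerm.mul_right_of_id {f g : F} {x y : ℝ} {k : ℤ} (h : FirstGerm g x k)
    (hf : ∀ t ≤ y, extendReal f t = t) (hxy : x < y) : FirstGerm (f * g) x k := by
  have h1 := (h.inv.mul_left_of_id (g := f⁻¹) (y := y) (fun t ht => ?_) hxy).inv
  · simpa using h1
  · have := extendReal_inv_apply f t
    rwa [hf t ht] at this

theorem id_inv {f : F} {y : ℝ} (hf : ∀ t ≤ y, extendReal f t = t) :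
    ∀ t ≤ y, extendReal f⁻¹ t = t := fun t ht => by
  have := extendReal_inv_apply f t
  rwa [hf t ht] at this

theorem exists_id_of_germ_zero {f : F} {a : ℝ} (hid : ∀ t ≤ a, extendReal f t = t)
    (hg : RGerm f a 0) : ∃ b > a, ∀ t ≤ b, extendReal f t = t := by
  obtain ⟨y, hy, h⟩ := hg
  refine ⟨y, hy, fun t ht => ?_⟩
  rcases le_total t a with h' | h'
  · exact hid t h'
  · rw [h t ⟨h', ht⟩, hid a le_rfl]; simp

section Core

variable [LinearOrder F] [MulLeftMono F] [MulRightMono F] {e : ℤ}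

/-- The order on `F'` is given by the sign of the first germ. -/
def DerivedRule (e : ℤ) : Prop := ∀ f ∈ F', ∀ x k, FirstGerm f x k → 0 < e * k → 1 < f

/-- Every commutator $fg'f^{-1}g'^{-1}$ lies below $g$, being $f\prec g$ times a conjugate of
$f^{-1}\prec id$. If $f$ had slope other than $1$ at $0$, it would move each dyadic point $a$ close
to $0$, and a suitable $g'$ starting at $a$ would give a commutator that starts before $g$ with a
positive germ. The rule on $F'$ places such a commutator above $g$, a contradiction. -/
theorem slope_eq_zero_of_lt (he : e ≠ 0) (hr : DerivedRule e) {f g : F} (hg : g ∈ F') (hf1 : 1 < f)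
    (hfg : f < g) : slope f = 0 := by
  by_contra hs
  have hg1 : g ≠ 1 := (hf1.trans hfg).ne'
  obtain ⟨z, l, hz⟩ := FirstGerm.exists_of_ne_one hg1
  have hz0 := hz.pos_of_slope_eq_zero (slope_eq_zero_of_mem hg)
  obtain ⟨y, hy, hlin⟩ := rGerm_slope f
  have hk : (0 : ℝ) < 2 ^ slope f := by positivity
  obtain ⟨a, ha, ha0, ha1⟩ := IsDyadic.exists_between (lt_min hy hz0)
  rw [lt_min_iff] at ha1
  have haz := ha1.2
  have hfa : extendReal f a = 2 ^ slope f * a := by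
    rw [hlin a ⟨ha0.le, ha1.1.le⟩, extendReal_zero]; ring
  -- it is enough to find a positive commutator whose first germ is on the left of that of `g`
  have key : ∀ c ∈ F', c < g → ∀ b m, b < z → FirstGerm c b m → 0 < e * m → False := by
    intro c hc hcg b m hb hm hpos
    have h1 := hm.mul_right_of_id (f := g⁻¹) (y := z) (id_inv hz.id_on) hb
    have h2 := hr _ (F'.mul_mem (F'.inv_mem hg) hc) _ _ h1 hpos
    exact lt_asymm hcg (lt_inv_mul_iff_lt.1 h2)
  have hcomm : ∀ g', f * g' * f⁻¹ * g'⁻¹ ∈ F' := fun g' =>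
    mem_derived_iff.2 ⟨by simp, by simp⟩
  have hsmall : ∀ g', f * g' * f⁻¹ * g'⁻¹ < g := fun g' => by
    have h1 : g' * f⁻¹ * g'⁻¹ < 1 := by
      have : f⁻¹ < 1 := inv_lt_one'.2 hf1
      calc g' * f⁻¹ * g'⁻¹ < g' * 1 * g'⁻¹ := mul_lt_mul_left (mul_lt_mul_right this _) _
        _ = 1 := by simp
    calc f * g' * f⁻¹ * g'⁻¹ = f * (g' * f⁻¹ * g'⁻¹) := by simp only [mul_assoc]
      _ < g * 1 := mul_lt_mul_of_lt_of_lt hfg h1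
      _ = g := mul_one g
  have hee : 0 < e * e := mul_self_pos.2 he
  -- The commutator starts at the smaller of $f(a)$ and $a$: with the germ of $g'$ in the first
  -- case, with that of $g'^{-1}$ in the second. The exponent of $g'$ is accordingly $e$ or $-e$.
  rcases lt_or_gt_of_ne hs with hneg | hpos
  · obtain ⟨g', -, hg'⟩ := exists_mem_firstGerm ha ha0 (haz.trans hz.lt_one) he
    have hlt : extendReal f a < a := by
      rw [hfa]
      have := zpow_lt_one_iff.2 hneg
      nlinarith
    exact key _ (hcomm g') (hsmall g') _ _ (hlt.trans haz)
      ((hg'.conj f).mul_left_of_id (id_inv hg'.id_on) hlt) hee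
  · obtain ⟨g', -, hg'⟩ := exists_mem_firstGerm ha ha0 (haz.trans hz.lt_one) (neg_ne_zero.2 he)
    have hlt : a < extendReal f a := by
      rw [hfa]
      have := one_lt_zpow_iff.2 hpos
      nlinarith
    have h1 := hg'.inv
    rw [neg_neg] at h1
    exact key _ (hcomm g') (hsmall g') _ _ haz (h1.mul_right_of_id (hg'.conj f).id_on hlt) hee

/-- Modulo $F'$, elements of slope $1$ at $0$ are classified by one integer, the exponent at $1$,
and that of $f$ is nonzero. Some positive power of $h$ is thus a power of $f$ up to $F'$, and powers
of $f$ are bounded by powers of $g\in F'$. -/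
theorem exists_le_mem {f g h : F} (hf : f ∉ F') (hf0 : slope f = 0) (hg : g ∈ F') (hf1 : 1 < f)
    (hfg : f < g) (hh : slope h = 0) : ∃ κ ∈ F', h ≤ κ := by
  set l := slope (flip f) with hl
  have hl0 : l ≠ 0 := fun h0 => hf (mem_derived_iff.2 ⟨hf0, h0⟩)
  have hn : 1 ≤ l.natAbs := Int.natAbs_pos.2 hl0
  -- Chosen so that $|l|\cdot s+jl=0$, where $s$ is the exponent of $h$ at $1$; recall that
  -- $|l|=\operatorname{sign}(l)\,l$.
  set j : ℤ := -(slope (flip h) * l.sign) with hj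
  have hmem : h ^ l.natAbs * f ^ j ∈ F' := by
    refine mem_derived_iff.2 ⟨by simp [hh, hf0], ?_⟩
    rw [map_mul, map_pow, map_zpow, slope_mul, slope_pow, slope_zpow, ← hl, hj]
    have : (l.natAbs : ℤ) = l.sign * l := (Int.sign_mul_self_eq_natAbs l).symm
    rw [this]; ring
  have hfj : f ^ (-j) ≤ g ^ j.natAbs := by
    calc f ^ (-j) ≤ f ^ ((j.natAbs : ℤ)) := (zpow_strictMono_of_one_lt hf1).monotone (by omega)
      _ = f ^ j.natAbs := zpow_natCast _ _
      _ ≤ g ^ j.natAbs := pow_le_pow_left' hfg.le _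
  have hle : h ^ l.natAbs ≤ h ^ l.natAbs * f ^ j * g ^ j.natAbs := by
    calc h ^ l.natAbs = h ^ l.natAbs * f ^ j * f ^ (-j) := by rw [mul_assoc, ← zpow_add]; simp
      _ ≤ _ := mul_le_mul_right hfj _
  have hmem' := F'.mul_mem hmem (F'.pow_mem hg j.natAbs)
  rcases le_total h 1 with h1 | h1
  · exact ⟨1, F'.one_mem, h1⟩
  · exact ⟨_, hmem', (le_self_pow h1 (by omega)).trans hle⟩

/-- A bound $\nu\in F'$ may start before $a$, so it is pushed to the right: choose $w\in F'$ sending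
a point $p$, below which $h$ and $\nu$ are the identity, to some $q>a$. Then $h=[h,w]\cdot
whw^{-1}\le[h,w]\cdot w\nu w^{-1}$, where $[h,w]=h\cdot wh^{-1}w^{-1}$ lies in $F'$ and both factors
of the bound are the identity slightly beyond $a$. -/
theorem exists_le_mem_id {h : F} (hbd : ∀ h : F, slope h = 0 → ∃ κ ∈ F', h ≤ κ) {a b : ℝ}
    (ha : 0 ≤ a) (ha1 : a < 1) (hab : a < b) (hh : ∀ t ≤ b, extendReal h t = t) :
    ∃ κ ∈ F', h ≤ κ ∧ ∃ c > a, ∀ t ≤ c, extendReal κ t = t := by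
  obtain ⟨ν, hν, hle⟩ := hbd h (slope_eq_zero_of_id (ha.trans_lt hab) hh)
  obtain ⟨y, hy, hyid⟩ := exists_id_of_slope_eq_zero (slope_eq_zero_of_mem hν)
  obtain ⟨p, hp, hp0, hp1⟩ :=
    IsDyadic.exists_between (lt_min (lt_min (ha.trans_lt hab) hy) one_pos)
  rw [lt_min_iff, lt_min_iff] at hp1
  obtain ⟨⟨hpb, hpy⟩, hp1⟩ := hp1
  obtain ⟨q, hq, haq, hq1⟩ := IsDyadic.exists_between ha1
  obtain ⟨w, hw, hwp⟩ := exists_mem_map hp hq hp0 hp1 (ha.trans_lt haq) hq1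
  have hconj : ∀ {f : F} {z : ℝ}, p ≤ z → (∀ t ≤ z, extendReal f t = t) →
      ∀ t ≤ q, extendReal (w * f * w⁻¹) t = t := fun {f z} hz hf t ht => by
    have h1 := (extendReal_strictMono w⁻¹).monotone ht
    rw [← hwp, extendReal_inv_apply] at h1
    rw [extendReal_mul, extendReal_mul, hf _ (h1.trans hz), extendReal_apply_inv]
  have hN : F'.Normal := inferInstance
  refine ⟨h * w * h⁻¹ * w⁻¹ * (w * ν * w⁻¹), F'.mul_mem (F'.mul_mem (hN.conj_mem _ hw h)
    (F'.inv_mem hw)) (hN.conj_mem _ hν w), ?_, min b q, lt_min hab haq, fun t ht => ?_⟩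
  · calc h = h * w * h⁻¹ * w⁻¹ * (w * h * w⁻¹) := by group
      _ ≤ _ := mul_le_mul_right (mul_le_mul_left (mul_le_mul_right hle w) _) _
  · have h1 := hconj hpy.le hyid t (ht.trans (min_le_right _ _))
    have h2 := hconj hpb.le (id_inv hh) t (ht.trans (min_le_right _ _))
    have h3 : h * w * h⁻¹ * w⁻¹ = h * (w * h⁻¹ * w⁻¹) := by group
    rw [extendReal_mul, h1, h3, extendReal_mul, h2, hh t (ht.trans (min_le_left _ _))]

/-- Let $\kappa\in F'$ have the same first germ as $h$. Then $h^{-1}\kappa$ is the identity beyond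
$a$, hence at most some $\nu\in F'$ that is also the identity beyond $a$. So $h\ge\kappa\nu^{-1}$,
an element of $F'$ with the first germ of $\kappa$, which is positive. -/
theorem one_lt_of_firstGerm (hr : DerivedRule e)
    (hbd : ∀ h : F, slope h = 0 → ∃ κ ∈ F', h ≤ κ) {h : F} (hs : slope h = 0) {a : ℝ} {k : ℤ}
    (hh : FirstGerm h a k) (hk : 0 < e * k) : 1 < h := by
  have ha := hh.pos_of_slope_eq_zero hs
  obtain ⟨κ, hκ, hκg⟩ := exists_mem_firstGerm hh.dyadic ha hh.lt_one hh.ne_zero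
  obtain ⟨b, hb, hid⟩ : ∃ b > a, ∀ t ≤ b, extendReal (h⁻¹ * κ) t = t := by
    refine exists_id_of_germ_zero (fun t ht => ?_) ?_
    · rw [extendReal_mul, hκg.id_on t ht, hh.inv.id_on t ht]
    · have := RGerm.mul (f := h⁻¹) (g := κ) (x := a) (k := -k) (l := k)
        (by rw [hκg.id_on a le_rfl]; exact hh.inv.germ) hκg.germ
      simpa using this
  obtain ⟨ν, hν, hle, c, hc, hcid⟩ := exists_le_mem_id hbd hh.nonneg hh.lt_one hb hid
  have h1 : 1 < κ * ν⁻¹ := hr _ (F'.mul_mem hκ (F'.inv_mem hν)) _ _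
    (hκg.mul_left_of_id (id_inv hcid) hc) hk
  have h2 : κ * ν⁻¹ ≤ h := by
    calc κ * ν⁻¹ ≤ κ * (h⁻¹ * κ)⁻¹ := mul_le_mul_right (inv_le_inv_iff.2 hle) _
      _ = h := by group
  exact h1.trans_le h2

/-- If `F'` is not convex, the order is given by the first germ. -/
theorem exists_firstCone_of_not_convex (he : e ≠ 0) (hr : DerivedRule e) {f g : F} (hf : f ∉ F')
    (hg : g ∈ F') (hf1 : 1 < f) (hfg : f < g) :
    ∃ d : ℤ, (d = 1 ∨ d = -1) ∧ ∀ h ∈ firstCone d e, 1 < h := by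
  have hf0 := slope_eq_zero_of_lt he hr hg hf1 hfg
  have hbd : ∀ h : F, slope h = 0 → ∃ κ ∈ F', h ≤ κ := fun h hh =>
    exists_le_mem hf hf0 hg hf1 hfg hh
  -- Otherwise $h$ would be bounded by an element of $F'$, and its slope at $0$ would be $1$.
  have hdom : ∀ h, 1 < h → slope h ≠ 0 → ∀ n, slope n = 0 → n < h := by
    intro h h1 hs n hn
    by_contra hle
    obtain ⟨κ, hκ, hκn⟩ := hbd n hn
    have hle' := (not_lt.1 hle).trans hκn
    rcases hle'.eq_or_lt with rfl | hlt
    · exact hs (slope_eq_zero_of_mem hκ)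
    · exact hs (slope_eq_zero_of_lt he hr hκ h1 hlt)
  have hx : ∃ d : ℤ, (d = 1 ∨ d = -1) ∧ ∀ k : ℤ, 0 < d * k → 1 < xZero ^ k := by
    rcases lt_trichotomy 1 xZero with h | h | h
    · exact ⟨1, .inl rfl, fun k hk => by
        simpa using zpow_strictMono_of_one_lt h (a := 0) (b := k) (by simpa using hk)⟩
    · have := slope_xZero
      rw [← h, slope_one] at this
      omega
    · refine ⟨-1, .inr rfl, fun k hk => ?_⟩
      have h' : 1 < xZero⁻¹ := one_lt_inv'.2 h
      have := zpow_strictMono_of_one_lt h' (a := 0) (b := -k) (by simpa using hk)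
      simpa using this
  obtain ⟨d, hd, hx⟩ := hx
  refine ⟨d, hd, ?_⟩
  rintro h ⟨a, k, hh, ⟨rfl, hk⟩ | ⟨ha, hk⟩⟩
  -- Compare with the power of `xZero` of the same slope: $h^{-1}x_0^k$ has slope $1$ at $0$, so it
  -- is dominated by $x_0^k\succ id$, and cancelling gives $h^{-1}\prec id$.
  · have hsk := hh.slope_eq
    have h1 := hdom (xZero ^ k) (hx k hk) (by rw [slope_zpow, slope_xZero, mul_one]; exact hh.ne_zero)
      (h⁻¹ * xZero ^ k) (by
        rw [slope_mul, slope_inv, slope_zpow, slope_xZero, hsk]; ring)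
    simpa using h1
  · exact one_lt_of_firstGerm hr hbd (hh.slope_eq_zero ha) hh hk

end Core

/-! ### The bi-orderings on `ℤ²` form a Cantor set -/

/-- One step of the subtractive Euclidean algorithm. -/
def euclidStep : Bool × (ℤ × ℤ) × (ℤ × ℤ) → (ℤ × ℤ) × (ℤ × ℤ)
  | (true, u, v) => (u - v, v)
  | (false, u, v) => (u, v - u)

/-- The integer `1` or `-1`. -/
def boolSign (b : Bool) : ℤ := if b then 1 else -1

/-- The sequence of bases of `ℤ²` determined by a sequence of bits. -/
def basisSeq (b : ℕ → Bool) : ℕ → (ℤ × ℤ) × (ℤ × ℤ)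
  | 0 => ((boolSign (b 0), 0), (0, boolSign (b 1)))
  | n + 1 => euclidStep (b (n + 2), basisSeq b n)

theorem continuous_basisSeq (n : ℕ) : Continuous fun b => basisSeq b n := by
  induction n with
  | zero =>
    have : Continuous fun c : Bool × Bool =>
      (((boolSign c.1, 0), (0, boolSign c.2)) : (ℤ × ℤ) × (ℤ × ℤ)) :=
      continuous_of_discreteTopology
    exact this.comp (f := fun b : ℕ → Bool => (b 0, b 1)) (by fun_prop)
  | succ n ih =>
    have : Continuous euclidStep := continuous_of_discreteTopology
    exact this.comp ((continuous_apply (n + 2)).prodMk ih)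

theorem basisSeq_congr {b c : ℕ → Bool} {n : ℕ} (h : ∀ i < n + 2, b i = c i) :
    basisSeq b n = basisSeq c n := by
  induction n with
  | zero => simp [basisSeq, h 0, h 1]
  | succ n ih => rw [basisSeq, basisSeq, h _ (by omega), ih fun i hi => h i (by omega)]

theorem boolSign_mul_self (b : Bool) : boolSign b * boolSign b = 1 := by
  cases b <;> simp [boolSign]

/-- Since $xu+yv=x(u-v)+(x+y)v=(x+y)u+y(v-u)$, a step replaces one coordinate by $x+y$. Nonnegative
coordinates stay nonnegative, so the cones spanned by the successive bases increase. -/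
theorem exists_basisSeq_succ (b : ℕ → Bool) (n : ℕ) (x y : ℤ) :
    x • (basisSeq b n).1 + y • (basisSeq b n).2 =
      (if b (n + 2) then x else x + y) • (basisSeq b (n + 1)).1 +
        (if b (n + 2) then x + y else y) • (basisSeq b (n + 1)).2 := by
  rw [basisSeq]
  generalize basisSeq b n = s
  obtain ⟨u, v⟩ := s
  cases b (n + 2) <;> simp [euclidStep, smul_sub, add_smul] <;> abel

theorem exists_basisSeq_coord (b : ℕ → Bool) (n : ℕ) (z : ℤ × ℤ) :
    ∃ x y : ℤ, z = x • (basisSeq b n).1 + y • (basisSeq b n).2 := by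
  induction n with
  | zero =>
    refine ⟨z.1 * boolSign (b 0), z.2 * boolSign (b 1), Prod.ext ?_ ?_⟩ <;>
      simp [basisSeq, mul_assoc, boolSign_mul_self]
  | succ n ih =>
    obtain ⟨x, y, rfl⟩ := ih
    exact ⟨_, _, exists_basisSeq_succ b n x y⟩

theorem basisSeq_indep (b : ℕ → Bool) (n : ℕ) : ∀ x y : ℤ,
    x • (basisSeq b n).1 + y • (basisSeq b n).2 = 0 → x = 0 ∧ y = 0 := by
  induction n with
  | zero =>
    intro x y h
    have h1 := congrArg Prod.fst h
    have h2 := congrArg Prod.snd h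
    cases h0 : b 0 <;> cases h0' : b 1 <;> simp_all [basisSeq, boolSign]
  | succ n ih =>
    intro x y h
    cases hb : b (n + 2)
    · have := exists_basisSeq_succ b n (x - y) y
      rw [hb] at this
      simp only [Bool.false_eq_true, if_false, sub_add_cancel, h] at this
      have := ih _ _ this
      omega
    · have := exists_basisSeq_succ b n x (y - x)
      rw [hb] at this
      simp only [if_true, add_sub_cancel, h] at this
      have := ih _ _ this
      omega

/-- The positive vectors of the order determined by a sequence of bits. -/
def bitCone (b : ℕ → Bool) : Set Z2 :=
  {z | z ≠ 1 ∧ ∃ n, ∃ x y : ℤ, 0 ≤ x ∧ 0 ≤ y ∧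
    z.toAdd = x • (basisSeq b n).1 + y • (basisSeq b n).2}

theorem exists_basisSeq_nonneg_of_le {b : ℕ → Bool} {z : ℤ × ℤ} {n m : ℕ} (hnm : n ≤ m)
    (h : ∃ x y : ℤ, 0 ≤ x ∧ 0 ≤ y ∧ z = x • (basisSeq b n).1 + y • (basisSeq b n).2) :
    ∃ x y : ℤ, 0 ≤ x ∧ 0 ≤ y ∧ z = x • (basisSeq b m).1 + y • (basisSeq b m).2 := by
  induction m, hnm using Nat.le_induction with
  | base => exact h
  | succ m _ ih =>
    obtain ⟨x, y, hx, hy, rfl⟩ := ih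
    refine ⟨_, _, ?_, ?_, exists_basisSeq_succ b m x y⟩ <;> split_ifs <;> omega

/-- If the coordinates have opposite signs, one of them is replaced by $x+y$. Either the new pair no
longer has opposite signs, or $|x|+|y|$ has decreased, so the process stops. -/
theorem bitCone_total (b : ℕ → Bool) (z : ℤ × ℤ) : ∃ n, ∃ x y : ℤ,
    (0 ≤ x ∧ 0 ≤ y ∨ x ≤ 0 ∧ y ≤ 0) ∧ z = x • (basisSeq b n).1 + y • (basisSeq b n).2 := by
  have key : ∀ (N n : ℕ) (x y : ℤ), x.natAbs + y.natAbs = N →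
      z = x • (basisSeq b n).1 + y • (basisSeq b n).2 → ∃ n, ∃ x y : ℤ,
      (0 ≤ x ∧ 0 ≤ y ∨ x ≤ 0 ∧ y ≤ 0) ∧ z = x • (basisSeq b n).1 + y • (basisSeq b n).2 := by
    intro N
    induction N using Nat.strong_induction_on with
    | _ N ih =>
      intro n x y hN hz
      by_cases h : 0 ≤ x ∧ 0 ≤ y ∨ x ≤ 0 ∧ y ≤ 0
      · exact ⟨n, x, y, h, hz⟩
      rw [exists_basisSeq_succ] at hz
      cases hb : b (n + 2)
      · simp only [hb, Bool.false_eq_true, if_false] at hz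
        by_cases h' : 0 ≤ x + y ∧ 0 ≤ y ∨ x + y ≤ 0 ∧ y ≤ 0
        · exact ⟨n + 1, x + y, y, h', hz⟩
        · exact ih _ (by omega) (n + 1) _ _ rfl hz
      · simp only [hb, if_true] at hz
        by_cases h' : 0 ≤ x ∧ 0 ≤ x + y ∨ x ≤ 0 ∧ x + y ≤ 0
        · exact ⟨n + 1, x, x + y, h', hz⟩
        · exact ih _ (by omega) (n + 1) _ _ rfl hz
  obtain ⟨x, y, hz⟩ := exists_basisSeq_coord b 0 z
  exact key _ 0 x y rfl hz

/-- The bi-ordering on `ℤ²` determined by a sequence of bits. -/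
def bitOrder (b : ℕ → Bool) : BiOrdering Z2 :=
  BiOrdering.ofCone (bitCone b) (fun h => h.1 rfl)
    (by
      rintro g ⟨hg, n, hgn⟩ h ⟨hh, m, hhm⟩
      obtain ⟨x, y, hx, hy, e⟩ := exists_basisSeq_nonneg_of_le (le_max_left n m) hgn
      obtain ⟨x', y', hx', hy', e'⟩ := exists_basisSeq_nonneg_of_le (le_max_right n m) hhm
      have e'' : (g * h).toAdd = (x + x') • (basisSeq b (max n m)).1 +
          (y + y') • (basisSeq b (max n m)).2 := by
        rw [toAdd_mul, e, e', add_smul, add_smul]; abel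
      refine ⟨fun h1 => hg ?_, max n m, x + x', y + y', by omega, by omega, e''⟩
      rw [h1, toAdd_one] at e''
      have := basisSeq_indep b _ _ _ e''.symm
      apply Multiplicative.toAdd.injective
      rw [e, show x = 0 by omega, show y = 0 by omega]
      simp)
    (fun g hg a => by simpa using hg)
    (by
      intro g hg
      obtain ⟨n, x, y, h | h, e⟩ := bitCone_total b g.toAdd
      · exact .inl ⟨hg, n, x, y, h.1, h.2, e⟩
      · refine .inr ⟨by simpa using hg, n, -x, -y, by omega, by omega, ?_⟩
        rw [toAdd_inv, e, neg_smul, neg_smul]; abel)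

theorem pos_bitOrder {b : ℕ → Bool} {z : Z2} : (bitOrder b).Pos z ↔ z ∈ bitCone b :=
  BiOrdering.pos_ofCone z

theorem pos_basisSeq_fst (b : ℕ → Bool) (n : ℕ) :
    (bitOrder b).Pos (Multiplicative.ofAdd (basisSeq b n).1) := by
  rw [pos_bitOrder]
  refine ⟨fun h => ?_, n, 1, 0, by omega, by omega, by simp⟩
  have h' : (basisSeq b n).1 = 0 := congrArg Multiplicative.toAdd h
  have := basisSeq_indep b n 1 0 (by simp [h'])
  omega

theorem pos_basisSeq_snd (b : ℕ → Bool) (n : ℕ) :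
    (bitOrder b).Pos (Multiplicative.ofAdd (basisSeq b n).2) := by
  rw [pos_bitOrder]
  refine ⟨fun h => ?_, n, 0, 1, by omega, by omega, by simp⟩
  have h' : (basisSeq b n).2 = 0 := congrArg Multiplicative.toAdd h
  have := basisSeq_indep b n 0 1 (by simp [h'])
  omega

/-- Positivity of a given vector is certified at some finite stage, by finitely many bits. -/
theorem continuous_bitOrder : Continuous bitOrder := by
  refine BiOrdering.continuous_of_isOpen_pos fun z => ?_
  simp only [pos_bitOrder]
  by_cases hz : z = 1
  · subst hz
    simp [bitCone]
  have : {b | z ∈ bitCone b} = ⋃ n, (fun b => basisSeq b n) ⁻¹'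
      {s | ∃ x y : ℤ, 0 ≤ x ∧ 0 ≤ y ∧ z.toAdd = x • s.1 + y • s.2} := by
    ext b
    simp [bitCone, hz]
  rw [this]
  exact isOpen_iUnion fun n => (isOpen_discrete _).preimage (continuous_basisSeq n)

theorem pos_ofAdd_neg_of_eq {s : BiOrdering Z2} {u v : ℤ × ℤ}
    (hu : s.Pos (Multiplicative.ofAdd u)) (hv : s.Pos (Multiplicative.ofAdd v)) : v ≠ -u := by
  rintro rfl
  exact hu.not_inv hv

/-- The first two bits are the signs of $(1,0)$ and $(0,1)$. At a later first disagreement both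
sequences have reached the same basis $(u,v)$, and one makes $u-v$ positive while the other makes
$v-u$ positive. -/
theorem bitOrder_injective : Function.Injective bitOrder := by
  intro b c h
  funext n
  induction n using Nat.strong_induction_on with
  | _ n ih =>
    have h1 := fun n => pos_basisSeq_fst b n
    have h2 := fun n => pos_basisSeq_snd b n
    rw [h] at h1 h2
    match n with
    | 0 =>
      have := pos_ofAdd_neg_of_eq (h1 0) (pos_basisSeq_fst c 0)
      by_contra hne
      refine this ?_
      cases hb : b 0 <;> cases hc : c 0 <;> simp_all [basisSeq, boolSign]
    | 1 =>
      have := pos_ofAdd_neg_of_eq (h2 0) (pos_basisSeq_snd c 0)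
      by_contra hne
      refine this ?_
      cases hb : b 1 <;> cases hc : c 1 <;> simp_all [basisSeq, boolSign]
    | n + 2 =>
      have e := basisSeq_congr ih
      have h1' := h1 (n + 1)
      have h2' := h2 (n + 1)
      have h3' := pos_basisSeq_fst c (n + 1)
      have h4' := pos_basisSeq_snd c (n + 1)
      rw [basisSeq] at h1' h2' h3' h4'
      rw [e] at h1' h2'
      cases hb : b (n + 2) <;> cases hc : c (n + 2) <;> try rfl
      · rw [hb] at h2'
        rw [hc] at h3'
        exact absurd (by simp [euclidStep]) (pos_ofAdd_neg_of_eq h2' h3')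
      · rw [hb] at h1'
        rw [hc] at h4'
        exact absurd (by simp [euclidStep]) (pos_ofAdd_neg_of_eq h1' h4')

open Classical in
/-- The sequence of bases extracted from a bi-ordering on `ℤ²`. -/
noncomputable def orderBasis (s : BiOrdering Z2) : ℕ → (ℤ × ℤ) × (ℤ × ℤ)
  | 0 => ((boolSign (decide (s.Pos (.ofAdd (1, 0)))), 0),
      (0, boolSign (decide (s.Pos (.ofAdd (0, 1))))))
  | n + 1 => euclidStep
      (decide (s.Pos (.ofAdd ((orderBasis s n).1 - (orderBasis s n).2))), orderBasis s n)

open Classical in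
/-- The sequence of bits extracted from a bi-ordering on `ℤ²`. -/
noncomputable def orderBits (s : BiOrdering Z2) : ℕ → Bool
  | 0 => decide (s.Pos (.ofAdd (1, 0)))
  | 1 => decide (s.Pos (.ofAdd (0, 1)))
  | n + 2 => decide (s.Pos (.ofAdd ((orderBasis s n).1 - (orderBasis s n).2)))

theorem basisSeq_orderBits (s : BiOrdering Z2) (n : ℕ) :
    basisSeq (orderBits s) n = orderBasis s n := by
  induction n with
  | zero => rfl
  | succ n ih => rw [basisSeq, ih]; rfl

theorem pos_neg_of_not_pos {s : BiOrdering Z2} {u : ℤ × ℤ} (hu : u ≠ 0)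
    (h : ¬ s.Pos (Multiplicative.ofAdd u)) : s.Pos (Multiplicative.ofAdd (-u)) :=
  (BiOrdering.not_pos_iff.1 h).resolve_left fun h' => hu (congrArg Multiplicative.toAdd h')

theorem pos_basisSeq_orderBits (s : BiOrdering Z2) (n : ℕ) :
    s.Pos (.ofAdd (basisSeq (orderBits s) n).1) ∧
      s.Pos (.ofAdd (basisSeq (orderBits s) n).2) := by
  induction n with
  | zero =>
    constructor
    · by_cases h : s.Pos (.ofAdd (1, 0))
      · simp [basisSeq, orderBits, boolSign, h]
      · have := pos_neg_of_not_pos (by simp) h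
        simpa [basisSeq, orderBits, boolSign, h] using this
    · by_cases h : s.Pos (.ofAdd (0, 1))
      · simp [basisSeq, orderBits, boolSign, h]
      · have := pos_neg_of_not_pos (by simp) h
        simpa [basisSeq, orderBits, boolSign, h] using this
  | succ n ih =>
    have hne : (basisSeq (orderBits s) n).1 - (basisSeq (orderBits s) n).2 ≠ 0 := fun h => by
      have := basisSeq_indep (orderBits s) n 1 (-1) (by
        rw [one_smul, neg_one_smul]; rwa [← sub_eq_add_neg])
      omega
    rw [basisSeq, orderBits, ← basisSeq_orderBits]
    by_cases h : s.Pos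
      (.ofAdd ((basisSeq (orderBits s) n).1 - (basisSeq (orderBits s) n).2))
    · simp only [h, decide_true]
      exact ⟨h, ih.2⟩
    · simp only [h, decide_false]
      refine ⟨ih.1, ?_⟩
      have := pos_neg_of_not_pos hne h
      rwa [neg_sub] at this

theorem BiOrdering.Pos.pow_mul_pow {s : BiOrdering Z2} {g h : Z2} (hg : s.Pos g) (hh : s.Pos h)
    (x y : ℕ) (hne : g ^ x * h ^ y ≠ 1) : s.Pos (g ^ x * h ^ y) := by
  have hp : ∀ {k : Z2}, s.Pos k → ∀ n : ℕ, k ^ n = 1 ∨ s.Pos (k ^ n) := fun {k} hk n => by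
    induction n with
    | zero => simp
    | succ n ih =>
      right
      rw [pow_succ]
      rcases ih with h | h
      · rwa [h, one_mul]
      · exact h.mul hk
  rcases hp hg x with h1 | h1 <;> rcases hp hh y with h2 | h2
  · simp [h1, h2] at hne
  · simpa [h1] using h2
  · simpa [h2] using h1
  · exact h1.mul h2

/-- Choosing each bit by the sign of $u-v$ for `s` keeps both basis vectors positive for `s`. The
cone of the bits is then contained in that of `s`, and two positive cones of total orderings, one
inside the other, are equal. -/
theorem bitOrder_surjective : Function.Surjective bitOrder := by
  intro s
  refine ⟨orderBits s, (BiOrdering.ext_pos ?_).symm⟩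
  refine BiOrdering.pos_iff_of_imp (fun z hz => ?_) fun z hz => BiOrdering.pos_or_inv hz
  obtain ⟨hne, n, x, y, hx, hy, e⟩ := pos_bitOrder.1 hz
  obtain ⟨h1, h2⟩ := pos_basisSeq_orderBits s n
  lift x to ℕ using hx
  lift y to ℕ using hy
  have e' : z = Multiplicative.ofAdd (basisSeq (orderBits s) n).1 ^ x *
      Multiplicative.ofAdd (basisSeq (orderBits s) n).2 ^ y := by
    apply Multiplicative.toAdd.injective
    rw [e]
    simp
  rw [e'] at hne ⊢
  exact h1.pow_mul_pow h2 x y hne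

/-- The space of bi-orderings on `ℤ²` is a Cantor set. -/
noncomputable def bitOrderHomeomorph : (ℕ → Bool) ≃ₜ BiOrdering Z2 :=
  Continuous.homeoOfEquivCompactToT2
    (f := Equiv.ofBijective bitOrder ⟨bitOrder_injective, bitOrder_surjective⟩) continuous_bitOrder

/-! ### The eight special orderings -/

/-- The first germ of a product is that of the factor starting earlier; when both start at the same
point the exponents add, and they cannot cancel since they have the same sign. Conjugation keeps the
exponent, and it keeps whether the point is $0$, so the two signs may be chosen independently. -/
theorem exists_firstOrder {a b : ℤ} (ha : a ≠ 0) (hb : b ≠ 0) :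
    ∃ r : BiOrdering F, r.HasCone (firstCone a b) := by
  refine ⟨BiOrdering.ofCone (firstCone a b) ?_ ?_ ?_ ?_, BiOrdering.pos_ofCone⟩
  · rintro ⟨x, k, h, -⟩
    exact h.ne_one rfl
  · rintro f ⟨x, k, hf, h1⟩ g ⟨y, l, hg, h2⟩
    rcases lt_trichotomy x y with hxy | rfl | hxy
    · exact ⟨x, k, hf.mul_left_of_id hg.id_on hxy, h1⟩
    · have h3 : (x = 0 ∧ 0 < a * (k + l)) ∨ (x ≠ 0 ∧ 0 < b * (k + l)) := by
        rcases h1 with h1 | h1 <;> rcases h2 with h2 | h2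
        · exact .inl ⟨h1.1, mul_pos_of_same_sign h1.2 h2.2⟩
        · exact absurd h1.1 h2.1
        · exact absurd h2.1 h1.1
        · exact .inr ⟨h1.1, mul_pos_of_same_sign h1.2 h2.2⟩
      refine ⟨x, k + l, hf.mul_of_id hg.id_on hg.germ fun h0 => ?_, h3⟩
      simp [h0] at h3
    · exact ⟨y, l, hg.mul_right_of_id hf.id_on hxy, h2⟩
  · rintro f ⟨x, k, hf, h⟩ w
    refine ⟨_, _, hf.conj w, ?_⟩
    have : extendReal w x = 0 ↔ x = 0 := by
      rw [← (extendReal_strictMono w).injective.eq_iff (a := x), extendReal_zero]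
    rwa [ne_eq, this]
  · intro f hf
    obtain ⟨x, k, h⟩ := FirstGerm.exists_of_ne_one hf
    rw [h.mem_firstCone_iff, h.inv.mem_firstCone_iff]
    have h1 := mul_pos_or_mul_neg_pos ha h.ne_zero
    have h2 := mul_pos_or_mul_neg_pos hb h.ne_zero
    tauto

theorem exists_hasCone_flip {C : Set F} (h : ∃ r : BiOrdering F, r.HasCone C) :
    ∃ r : BiOrdering F, r.HasCone (flip ⁻¹' C) := by
  obtain ⟨r, hr⟩ := h
  exact ⟨r.comap flip flip_injective, fun g => BiOrdering.pos_comap.trans (hr _)⟩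

theorem exists_hasCone_isolCone (i : Main ⊕ Exotic) :
    ∃ r : BiOrdering F, r.HasCone (isolCone i) := by
  rcases i with (_ | _ | _ | _) | (_ | _ | _ | _) <;>
    simp only [isolCone, Sum.elim_inl, Sum.elim_inr, mainCone_xMinusPos, mainCone_xMinusNeg,
      mainCone_xPlusPos, mainCone_xPlusNeg, exoticCone_zeroPosNeg, exoticCone_zeroNegPos,
      exoticCone_onePosNeg, exoticCone_oneNegPos]
  on_goal 3 => apply exists_hasCone_flip
  on_goal 4 => apply exists_hasCone_flip
  on_goal 7 => apply exists_hasCone_flip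
  on_goal 8 => apply exists_hasCone_flip
  all_goals exact exists_firstOrder (by norm_num) (by norm_num)

/-- The eight special bi-orderings on `F`. -/
noncomputable def isolOrder (i : Main ⊕ Exotic) : BiOrdering F :=
  (exists_hasCone_isolCone i).choose

theorem hasCone_isolOrder (i : Main ⊕ Exotic) : (isolOrder i).HasCone (isolCone i) :=
  (exists_hasCone_isolCone i).choose_spec

theorem BOIsol_eq : BOIsol = Set.range isolOrder := by
  ext r
  constructor
  · rintro ⟨i, hi⟩
    exact ⟨i, (hasCone_isolOrder i).unique hi⟩
  · rintro ⟨i, rfl⟩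
    exact ⟨i, hasCone_isolOrder i⟩

/-- An element of `F` with prescribed slopes at the end points. -/
noncomputable def ofSlopes (k l : ℤ) : F := xZero ^ k * rightCopy xZero ^ (-(k + l))

@[simp] theorem slope_ofSlopes (k l : ℤ) : slope (ofSlopes k l) = k := by
  rw [ofSlopes, slope_mul, slope_zpow, slope_zpow, slope_xZero, slope_rightCopy]; ring

@[simp] theorem slope_flip_ofSlopes (k l : ℤ) : slope (flip (ofSlopes k l)) = l := by
  rw [ofSlopes, map_mul, map_zpow, map_zpow, slope_mul, slope_zpow, slope_zpow,
    slope_flip_rightCopy, slope_flip_xZero]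
  ring

theorem exists_logDerivs_eq (z : Z2) : ∃ f, logDerivs f = z :=
  ⟨ofSlopes z.toAdd.1 z.toAdd.2, by rw [logDerivs_eq, slope_ofSlopes, slope_flip_ofSlopes]; rfl⟩

/-! ### Elements that separate the special cones -/

theorem firstGerm_of_slope {f : F} {k : ℤ} (h : slope f = k) (hk : k ≠ 0) : FirstGerm f 0 k := by
  subst h; exact .of_slope_ne_zero hk

theorem ofSlopes_mem_firstCone {k l a b : ℤ} (hk : k ≠ 0) :
    ofSlopes k l ∈ firstCone a b ↔ 0 < a * k := by
  simp [(firstGerm_of_slope (slope_ofSlopes k l) hk).mem_firstCone_iff]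

theorem flip_ofSlopes_mem_firstCone {k l a b : ℤ} (hl : l ≠ 0) :
    flip (ofSlopes k l) ∈ firstCone a b ↔ 0 < a * l := by
  simp [(firstGerm_of_slope (slope_flip_ofSlopes k l) hl).mem_firstCone_iff]

theorem midCopy_mem_firstCone {k l a b : ℤ} (hk : k ≠ 0) :
    midCopy (ofSlopes k l) ∈ firstCone a b ↔ 0 < b * k := by
  simp [(firstGerm_copy (firstGerm_of_slope (slope_ofSlopes k l) hk)).mem_firstCone_iff]

theorem flip_midCopy_mem_firstCone {k l a b : ℤ} (hl : l ≠ 0) :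
    flip (midCopy (ofSlopes k l)) ∈ firstCone a b ↔ 0 < b * l := by
  rw [flip_midCopy]
  simp [(firstGerm_copy (firstGerm_of_slope (slope_flip_ofSlopes k l) hl)).mem_firstCone_iff]

/-- The eight cones are told apart by three elements. -/
theorem isolCone_separated {i j : Main ⊕ Exotic}
    (h1 : midCopy (ofSlopes 1 1) ∈ isolCone i ↔ midCopy (ofSlopes 1 1) ∈ isolCone j)
    (h2 : midCopy (ofSlopes 1 (-1)) ∈ isolCone i ↔ midCopy (ofSlopes 1 (-1)) ∈ isolCone j)
    (h3 : ofSlopes 1 1 ∈ isolCone i ↔ ofSlopes 1 1 ∈ isolCone j) : i = j := by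
  rcases i with (_ | _ | _ | _) | (_ | _ | _ | _) <;>
  rcases j with (_ | _ | _ | _) | (_ | _ | _ | _) <;>
  first
  | rfl
  | exfalso
    simp [isolCone, mainCone_xMinusPos, mainCone_xMinusNeg,
      mainCone_xPlusPos, mainCone_xPlusNeg, exoticCone_zeroPosNeg, exoticCone_zeroNegPos,
      exoticCone_onePosNeg, exoticCone_oneNegPos, midCopy_mem_firstCone,
      flip_midCopy_mem_firstCone, ofSlopes_mem_firstCone, flip_ofSlopes_mem_firstCone]
      at h1 h2 h3

/-- The four main cones are told apart by two elements of `F'`. -/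
theorem mainCone_separated {i j : Main}
    (h1 : midCopy (ofSlopes 1 1) ∈ mainCone i ↔ midCopy (ofSlopes 1 1) ∈ mainCone j)
    (h2 : midCopy (ofSlopes 1 (-1)) ∈ mainCone i ↔ midCopy (ofSlopes 1 (-1)) ∈ mainCone j) :
    i = j := by
  rcases i with _ | _ | _ | _ <;> rcases j with _ | _ | _ | _ <;>
  first
  | rfl
  | exfalso
    simp [mainCone_xMinusPos, mainCone_xMinusNeg, mainCone_xPlusPos, mainCone_xPlusNeg,
      midCopy_mem_firstCone, flip_midCopy_mem_firstCone] at h1 h2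

theorem isolOrder_injective : Function.Injective isolOrder := by
  intro i j h
  have key : ∀ g, g ∈ isolCone i ↔ g ∈ isolCone j := fun g => by
    rw [← hasCone_isolOrder i g, ← hasCone_isolOrder j g, h]
  exact isolCone_separated (key _) (key _) (key _)

/-- The labels of the main orderings are pairs of signs. -/
def mainEquiv : Main ≃ Bool × Bool where
  toFun
    | .xMinusPos => (true, true)
    | .xMinusNeg => (true, false)
    | .xPlusPos => (false, true)
    | .xPlusNeg => (false, false)
  invFun
    | (true, true) => .xMinusPos
    | (true, false) => .xMinusNeg
    | (false, true) => .xPlusPos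
    | (false, false) => .xPlusNeg
  left_inv := by rintro (_ | _ | _ | _) <;> rfl
  right_inv := by rintro ⟨_ | _, _ | _⟩ <;> rfl

/-- The labels of the exotic orderings are pairs of signs. -/
def exoticEquiv : Exotic ≃ Bool × Bool where
  toFun
    | .zeroPosNeg => (true, true)
    | .zeroNegPos => (true, false)
    | .onePosNeg => (false, true)
    | .oneNegPos => (false, false)
  invFun
    | (true, true) => .zeroPosNeg
    | (true, false) => .zeroNegPos
    | (false, true) => .onePosNeg
    | (false, false) => .oneNegPos
  left_inv := by rintro (_ | _ | _ | _) <;> rfl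
  right_inv := by rintro ⟨_ | _, _ | _⟩ <;> rfl

theorem ncard_BOIsol : BOIsol.ncard = 8 := by
  rw [BOIsol_eq, ← Nat.card_coe_set_eq, Nat.card_range_of_injective isolOrder_injective,
    Nat.card_congr (Equiv.sumCongr mainEquiv exoticEquiv)]
  simp [Nat.card_eq_fintype_card]

/-! ### Convexity of `F'` -/

/-- The derived subgroup is not convex. -/
def DerivedNotConvex (r : BiOrdering F) : Prop :=
  ∃ f g, f ∉ F' ∧ g ∈ F' ∧ r.Pos f ∧ r.Pos (f⁻¹ * g)

theorem DerivedNotConvex.comap_flip {r : BiOrdering F} (h : DerivedNotConvex r) :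
    DerivedNotConvex (r.comap flip flip_injective) := by
  obtain ⟨f, g, hf, hg, h1, h2⟩ := h
  refine ⟨flip f, flip g, fun h' => hf (by simpa using flip_mem h'), flip_mem hg, ?_, ?_⟩
  · rw [BiOrdering.pos_comap]; simpa using h1
  · rw [BiOrdering.pos_comap]; simpa using h2

/-- An element starting at $1/4$ dominates one starting at $1/2$. The former can be taken in the
middle copy, inside $F'$, and the latter in the right copy with nontrivial germ at $1$, outside
$F'$. -/
theorem notConvex_of_hasCone {r : BiOrdering F} {a b : ℤ} (hb : b ≠ 0)
    (h : r.HasCone (firstCone a b)) : DerivedNotConvex r := by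
  have hbb : 0 < b * b := mul_self_pos.2 hb
  have hf : FirstGerm (rightCopy (ofSlopes b 1)) (1 / 2) b :=
    firstGerm_copy (firstGerm_of_slope (slope_ofSlopes b 1) hb)
  have hg : FirstGerm (midCopy (ofSlopes b 1)) (1 / 4) b :=
    firstGerm_copy (firstGerm_of_slope (slope_ofSlopes b 1) hb)
  refine ⟨_, _, fun h' => ?_, midCopy_mem (ofSlopes b 1),
    (h _).2 ⟨_, _, hf, .inr ⟨by norm_num, hbb⟩⟩,
    (h _).2 ⟨_, _, hg.mul_right_of_id (id_inv hf.id_on) (by norm_num), .inr ⟨by norm_num, hbb⟩⟩⟩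
  have := slope_flip_eq_zero_of_mem h'
  rw [slope_flip_rightCopy, slope_flip_ofSlopes] at this
  omega

theorem notConvex_of_hasCone_flip {r : BiOrdering F} {a b : ℤ} (hb : b ≠ 0)
    (h : r.HasCone (flip ⁻¹' firstCone a b)) : DerivedNotConvex r := by
  have h1 : (r.comap flip flip_injective).HasCone (firstCone a b) := fun g => by
    rw [BiOrdering.pos_comap, h, Set.mem_preimage, flip_flip]
  obtain ⟨f, g, hf, hg, h2, h3⟩ := (notConvex_of_hasCone hb h1).comap_flip
  rw [BiOrdering.pos_comap, BiOrdering.pos_comap, flip_flip] at h2 h3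
  exact ⟨f, g, hf, hg, h2, h3⟩

theorem notConvex_of_mem_BOIsol {r : BiOrdering F} (h : r ∈ BOIsol) : DerivedNotConvex r := by
  obtain ⟨(_ | _ | _ | _) | (_ | _ | _ | _), h⟩ := h <;>
    simp only [isolCone, Sum.elim_inl, Sum.elim_inr, mainCone_xMinusPos, mainCone_xMinusNeg,
      mainCone_xPlusPos, mainCone_xPlusNeg, exoticCone_zeroPosNeg, exoticCone_zeroNegPos,
      exoticCone_onePosNeg, exoticCone_oneNegPos] at h
  on_goal 3 => exact notConvex_of_hasCone_flip (by norm_num) h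
  on_goal 3 => exact notConvex_of_hasCone_flip (by norm_num) h
  on_goal 5 => exact notConvex_of_hasCone_flip (by norm_num) h
  on_goal 5 => exact notConvex_of_hasCone_flip (by norm_num) h
  all_goals exact notConvex_of_hasCone (by norm_num) h

theorem mem_derived_iff_logDerivs {f : F} : f ∈ F' ↔ logDerivs f = 1 := by
  rw [mem_derived_iff, logDerivs_eq_one_iff]

/-- For $g\in F'$ the images of $f$ and $f^{-1}g$ in $\mathbb Z^2$ are opposite, so they cannot both
be positive. -/
theorem not_notConvex_of_mem_Lambda {r : BiOrdering F} {i : Main} (h : r ∈ Lambda i) :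
    ¬ DerivedNotConvex r := by
  obtain ⟨s, r', -, h⟩ := h
  rintro ⟨f, g, hf, hg, h1, h2⟩
  have hfg : f⁻¹ * g ∉ F' := fun h' => hf (by
    have := F'.mul_mem hg (F'.inv_mem h')
    simpa using this)
  have h1' := (((h f).1 h1).resolve_right fun ⟨h', _⟩ => hf h').2
  have h2' := (((h _).1 h2).resolve_right fun ⟨h', _⟩ => hfg h').2
  rw [logDerivs_mul, mem_derived_iff_logDerivs.1 hg, mul_one, logDerivs_inv] at h2'
  exact h1'.not_inv h2'

theorem exists_hasCone_firstCone {r : BiOrdering F} (hr : DerivedNotConvex r) {e : ℤ} (he : e ≠ 0)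
    (h : FirstRule (r.comap F'.subtype F'.subtype_injective) e) :
    ∃ d : ℤ, (d = 1 ∨ d = -1) ∧ r.HasCone (firstCone d e) := by
  let := r.toLinearOrder
  have := r.mulLeftMono
  have := r.mulRightMono
  obtain ⟨f, g, hf, hg, h1, h2⟩ := hr
  have hrule : DerivedRule e := fun f hf x k hfk hk =>
    r.pos_iff_lt.1 (BiOrdering.pos_comap.1 ((h ⟨f, hf⟩ x k hfk).2 hk))
  obtain ⟨d, hd, hc⟩ := exists_firstCone_of_not_convex he hrule hf hg (r.pos_iff_lt.1 h1)
    (lt_inv_mul_iff_lt.1 (r.pos_iff_lt.1 h2))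
  have hd0 : d ≠ 0 := by omega
  refine ⟨d, hd, fun g => BiOrdering.pos_iff_of_imp (P := fun g => g ∈ firstCone d e)
    (fun g hg => r.pos_iff_lt.2 (hc g hg)) (fun g hg => ?_) g⟩
  obtain ⟨s, hs⟩ := exists_firstOrder hd0 he
  rw [← hs, ← hs]
  exact BiOrdering.pos_or_inv hg

theorem FirstRule.pos_iff {r : BiOrdering F'} {e : ℤ} (h : FirstRule r e) (g : F') :
    r.Pos g ↔ (g : F) ∈ firstCone e e := by
  by_cases hg : g = 1
  · subst hg
    refine iff_of_false r.not_pos_one ?_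
    rintro ⟨x, k, hx, -⟩
    exact hx.ne_one rfl
  · obtain ⟨x, k, hx⟩ := FirstGerm.exists_of_ne_one (f := (g : F)) fun h => hg (Subtype.ext h)
    rw [h g x k hx, hx.mem_firstCone_self_iff]

theorem FirstRule.pos_iff_flip {r : BiOrdering F'} {e : ℤ}
    (h : FirstRule (r.comap flip' flip'_injective) e) (g : F') :
    r.Pos g ↔ flip (g : F) ∈ firstCone e e := by
  have := h.pos_iff (flip' g)
  rwa [BiOrdering.pos_comap, flip'_flip'] at this

theorem exists_isMainRestriction (r : BiOrdering F') : ∃ i, IsMainRestriction r i := by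
  rcases exists_firstRule r with (h | h) | (h | h)
  · exact ⟨.xMinusPos, fun g => by rw [mainCone_xMinusPos]; exact h.pos_iff g⟩
  · exact ⟨.xMinusNeg, fun g => by rw [mainCone_xMinusNeg]; exact h.pos_iff g⟩
  · exact ⟨.xPlusNeg, fun g => by rw [mainCone_xPlusNeg]; exact h.pos_iff_flip g⟩
  · exact ⟨.xPlusPos, fun g => by rw [mainCone_xPlusPos]; exact h.pos_iff_flip g⟩

theorem IsMainRestriction.unique {r : BiOrdering F'} {i j : Main} (hi : IsMainRestriction r i)
    (hj : IsMainRestriction r j) : i = j := by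
  have key : ∀ g : F', (g : F) ∈ mainCone i ↔ (g : F) ∈ mainCone j := fun g =>
    (hi g).symm.trans (hj g)
  exact mainCone_separated (key ⟨_, midCopy_mem _⟩) (key ⟨_, midCopy_mem _⟩)

/-- The sign `e` on $F'$ and the sign `d` at the end point are independent: equal signs give a main
ordering, opposite signs an exotic one. The rules read from the right end are obtained through the
flip. -/
theorem mem_BOIsol_of_notConvex {r : BiOrdering F} (hr : DerivedNotConvex r) : r ∈ BOIsol := by
  have hflip : FirstRule ((r.comap F'.subtype F'.subtype_injective).comap flip' flip'_injective) =
      FirstRule ((r.comap flip flip_injective).comap F'.subtype F'.subtype_injective) := by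
    congr 1
  have hcone : ∀ {a b : ℤ}, (r.comap flip flip_injective).HasCone (firstCone a b) →
      r.HasCone (flip ⁻¹' firstCone a b) := fun {a b} h g => by
    have := h (flip g)
    rwa [BiOrdering.pos_comap, flip_flip] at this
  rcases exists_firstRule (r.comap F'.subtype F'.subtype_injective) with (h | h) | h
  · obtain ⟨d, rfl | rfl, h'⟩ := exists_hasCone_firstCone hr (by norm_num) h
    · exact ⟨.inl .xMinusPos, by rw [← mainCone_xMinusPos] at h'; exact h'⟩
    · exact ⟨.inr .zeroNegPos, by rw [← exoticCone_zeroNegPos] at h'; exact h'⟩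
  · obtain ⟨d, rfl | rfl, h'⟩ := exists_hasCone_firstCone hr (by norm_num) h
    · exact ⟨.inr .zeroPosNeg, by rw [← exoticCone_zeroPosNeg] at h'; exact h'⟩
    · exact ⟨.inl .xMinusNeg, by rw [← mainCone_xMinusNeg] at h'; exact h'⟩
  rw [hflip] at h
  rcases h with h | h
  · obtain ⟨d, rfl | rfl, h'⟩ := exists_hasCone_firstCone hr.comap_flip (by norm_num) h <;>
      replace h' := hcone h'
    · exact ⟨.inl .xPlusNeg, by rw [← mainCone_xPlusNeg] at h'; exact h'⟩
    · exact ⟨.inr .onePosNeg, by rw [← exoticCone_onePosNeg] at h'; exact h'⟩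
  · obtain ⟨d, rfl | rfl, h'⟩ := exists_hasCone_firstCone hr.comap_flip (by norm_num) h <;>
      replace h' := hcone h'
    · exact ⟨.inr .oneNegPos, by rw [← exoticCone_oneNegPos] at h'; exact h'⟩
    · exact ⟨.inl .xPlusPos, by rw [← mainCone_xPlusPos] at h'; exact h'⟩

/-- Keeping positive one pair that witnesses non-convexity confines an ordering to the eight special
ones; fixing the signs of the three separating elements then leaves only `r`. -/
theorem isOpen_singleton_of_mem_BOIsol {r : BiOrdering F} (hr : r ∈ BOIsol) :
    IsOpen ({r} : Set (BiOrdering F)) := by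
  obtain ⟨f, g, hf, hg, h1, h2⟩ := notConvex_of_mem_BOIsol hr
  have hop : ∀ t, IsOpen {r' : BiOrdering F | r'.Pos t ↔ r.Pos t} :=
    BiOrdering.isOpen_pos_iff (φ := id) BiOrdering.isOpen_pos r
  convert ((BiOrdering.isOpen_pos f).inter (BiOrdering.isOpen_pos (f⁻¹ * g))).inter
    (((hop (midCopy (ofSlopes 1 1))).inter (hop (midCopy (ofSlopes 1 (-1))))).inter
      (hop (ofSlopes 1 1)))
  ext r'
  constructor
  · rintro rfl
    exact ⟨⟨h1, h2⟩, ⟨Iff.rfl, Iff.rfl⟩, Iff.rfl⟩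
  · rintro ⟨⟨h1', h2'⟩, ⟨e1, e2⟩, e3⟩
    obtain ⟨i, hi⟩ := hr
    obtain ⟨j, hj⟩ := mem_BOIsol_of_notConvex ⟨f, g, hf, hg, h1', h2'⟩
    have key : ∀ {t}, (r'.Pos t ↔ r.Pos t) → (t ∈ isolCone j ↔ t ∈ isolCone i) := fun {t} h => by
      rwa [← hi, ← hj]
    obtain rfl := isolCone_separated (key e1) (key e2) (key e3)
    exact hj.unique hi

/-! ### Extensions -/

/-- The lexicographic extension of a bi-ordering on `ℤ²` by the restriction to `F'` of a
bi-ordering on `F`. -/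
theorem exists_extension (s : BiOrdering Z2) (q : BiOrdering F) :
    ∃ r : BiOrdering F, ∀ f, r.Pos f ↔ s.Pos (logDerivs f) ∨ (logDerivs f = 1 ∧ q.Pos f) := by
  refine ⟨BiOrdering.ofCone {f | s.Pos (logDerivs f) ∨ (logDerivs f = 1 ∧ q.Pos f)} ?_ ?_ ?_ ?_,
    BiOrdering.pos_ofCone⟩
  · rintro (h | h)
    · rw [logDerivs_one] at h
      exact s.not_pos_one h
    · exact q.not_pos_one h.2
  · rintro f (hf | hf) g (hg | hg)
    · left; rw [logDerivs_mul]; exact hf.mul hg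
    · left; rwa [logDerivs_mul, hg.1, mul_one]
    · left; rwa [logDerivs_mul, hf.1, one_mul]
    · right; exact ⟨by rw [logDerivs_mul, hf.1, hg.1, one_mul], hf.2.mul hg.2⟩
  · rintro f hf w
    have : logDerivs (w * f * w⁻¹) = logDerivs f := by
      rw [logDerivs_mul, logDerivs_mul, logDerivs_inv, mul_comm, inv_mul_cancel_left]
    rcases hf with h | h
    · left; rwa [this]
    · right; exact ⟨this.trans h.1, h.2.conj w⟩
  · intro f hf
    by_cases h : logDerivs f = 1
    · rcases BiOrdering.pos_or_inv (r := q) hf with h' | h'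
      · exact .inl (.inr ⟨h, h'⟩)
      · exact .inr (.inr ⟨by rw [logDerivs_inv, h, inv_one], h'⟩)
    · rcases BiOrdering.pos_or_inv (r := s) h with h' | h'
      · exact .inl (.inl h')
      · exact .inr (.inl (by rwa [logDerivs_inv]))

/-- The extension to `F` of a bi-ordering on `ℤ²` and of a main bi-ordering. -/
noncomputable def extension (i : Main) (s : BiOrdering Z2) : BiOrdering F :=
  (exists_extension s (isolOrder (.inl i))).choose

theorem pos_extension {i : Main} {s : BiOrdering Z2} {f : F} : (extension i s).Pos f ↔
    s.Pos (logDerivs f) ∨ (logDerivs f = 1 ∧ f ∈ mainCone i) := by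
  have := (exists_extension s (isolOrder (.inl i))).choose_spec f
  rwa [hasCone_isolOrder] at this

theorem isExtension_extension {i : Main} {s : BiOrdering Z2} {r' : BiOrdering F'}
    (h : IsMainRestriction r' i) : IsExtension s r' (extension i s) := by
  intro f
  rw [pos_extension]
  refine or_congr ⟨fun h' => ⟨mem_derived_iff_logDerivs.not.2 h'.2, h'⟩, And.right⟩ ?_
  constructor
  · rintro ⟨h1, h2⟩
    exact ⟨mem_derived_iff_logDerivs.2 h1, (h _).2 h2⟩
  · rintro ⟨h1, h2⟩
    exact ⟨mem_derived_iff_logDerivs.1 h1, (h _).1 h2⟩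

theorem exists_isMainRestriction' (i : Main) : ∃ r', IsMainRestriction r' i :=
  ⟨(isolOrder (.inl i)).comap F'.subtype F'.subtype_injective, fun g => by
    rw [BiOrdering.pos_comap]; exact hasCone_isolOrder (.inl i) g⟩

theorem extension_mem_Lambda (i : Main) (s : BiOrdering Z2) : extension i s ∈ Lambda i := by
  obtain ⟨r', hr'⟩ := exists_isMainRestriction' i
  exact ⟨s, r', hr', isExtension_extension hr'⟩

theorem IsExtension.unique {s : BiOrdering Z2} {r' : BiOrdering F'} {r q : BiOrdering F}
    (hr : IsExtension s r' r) (hq : IsExtension s r' q) : r = q :=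
  BiOrdering.ext_pos fun f => (hr f).trans (hq f).symm

theorem exists_extension_eq {i : Main} {r : BiOrdering F} (h : r ∈ Lambda i) :
    ∃ s, extension i s = r := by
  obtain ⟨s, r', hr', hr⟩ := h
  exact ⟨s, (isExtension_extension hr').unique hr⟩

theorem extension_injective (i : Main) : Function.Injective (extension i) := by
  intro s t h
  refine BiOrdering.ext_pos fun z => ?_
  by_cases hz : z = 1
  · subst hz
    exact iff_of_false s.not_pos_one t.not_pos_one
  obtain ⟨f, rfl⟩ := exists_logDerivs_eq z
  have h1 := pos_extension (i := i) (s := s) (f := f)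
  have h2 := pos_extension (i := i) (s := t) (f := f)
  rw [h] at h1
  simpa [hz] using h1.symm.trans h2

theorem continuous_extension (i : Main) : Continuous (extension i) := by
  refine BiOrdering.continuous_of_isOpen_pos fun f => ?_
  simp only [pos_extension]
  exact (BiOrdering.isOpen_pos _).union isOpen_const

instance : CompactSpace (BiOrdering Z2) := bitOrderHomeomorph.compactSpace

/-- The extension procedure as a homeomorphism. -/
noncomputable def extensionHomeomorph (i : Main) : BiOrdering Z2 ≃ₜ Lambda i :=
  Continuous.homeoOfEquivCompactToT2
    (f := Equiv.ofBijective (fun s => ⟨extension i s, extension_mem_Lambda i s⟩)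
      ⟨fun s t h => extension_injective i (congrArg Subtype.val h), fun r => by
        obtain ⟨s, hs⟩ := exists_extension_eq r.2
        exact ⟨s, Subtype.ext hs⟩⟩)
    ((continuous_extension i).subtype_mk _)

/-- Convexity means that positivity outside $F'$ is constant on cosets of $F'$, so the ordering
descends to $F/F'$, which is $\mathbb Z^2$ through `logDerivs`. -/
theorem mem_Lambda_of_convex {r : BiOrdering F} (hr : ¬ DerivedNotConvex r) {i : Main}
    (hi : IsMainRestriction (r.comap F'.subtype F'.subtype_injective) i) : r ∈ Lambda i := by
  have hconv : ∀ {f g : F}, f ∉ F' → g ∈ F' → r.Pos f → r.Pos (g⁻¹ * f) := fun {f g} hf hg h => by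
    by_contra hn
    rcases BiOrdering.not_pos_iff.1 hn with h' | h'
    · rw [inv_mul_eq_one] at h'
      exact hf (h' ▸ hg)
    · exact hr ⟨f, g, hf, hg, h, by simpa using h'⟩
  obtain ⟨s, hs⟩ : ∃ s : BiOrdering Z2, ∀ z, s.Pos z ↔ ∃ f, logDerivs f = z ∧ f ∉ F' ∧ r.Pos f := by
    refine ⟨BiOrdering.ofCone {z | ∃ f, logDerivs f = z ∧ f ∉ F' ∧ r.Pos f} ?_ ?_ ?_ ?_,
      BiOrdering.pos_ofCone⟩
    · rintro ⟨f, h1, h2, -⟩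
      exact h2 (mem_derived_iff_logDerivs.2 h1)
    · rintro _ ⟨f, rfl, hf, hf'⟩ _ ⟨g, rfl, hg, hg'⟩
      -- If $fg$ were in $F'$, dividing the positive $f\notin F'$ by it would make
      -- $(fg)^{-1}f=g^{-1}$ positive.
      refine ⟨f * g, logDerivs_mul f g, fun h => ?_, hf'.mul hg'⟩
      have h1 := hconv hf h hf'
      rw [mul_inv_rev, inv_mul_cancel_right] at h1
      exact hg'.not_inv h1
    · rintro z hz a
      rwa [mul_inv_cancel_comm]
    · intro z hz
      obtain ⟨f, rfl⟩ := exists_logDerivs_eq z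
      have hf : f ∉ F' := fun h => hz (mem_derived_iff_logDerivs.1 h)
      have hf1 : f ≠ 1 := fun h => hz (h ▸ logDerivs_one)
      rcases BiOrdering.pos_or_inv (r := r) hf1 with h | h
      · exact .inl ⟨f, rfl, hf, h⟩
      · exact .inr ⟨f⁻¹, logDerivs_inv f, fun h' => hf (by simpa using F'.inv_mem h'), h⟩
  refine ⟨s, _, hi, fun f => ?_⟩
  by_cases hf : f ∈ F'
  · simp [hf, BiOrdering.pos_comap]
  · simp only [hf, not_false_eq_true, true_and, IsEmpty.exists_iff, or_false, hs]
    refine ⟨fun h => ⟨f, rfl, hf, h⟩, ?_⟩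
    rintro ⟨g, hg, hg', hpos⟩
    have hmem : g * f⁻¹ ∈ F' := by
      rw [mem_derived_iff_logDerivs, logDerivs_mul, logDerivs_inv, hg, mul_inv_cancel]
    simpa using hconv hg' hmem hpos

end ThompsonBO

/-- The space of bi-orderings of Thompson's group `F` is the disjoint union of the set of eight
special bi-orderings, which are isolated, and of four natural copies of the Cantor set. -/
theorem mainTheorem1 :
    -- the eight cones define eight distinct bi-orderings on `F`
    ((∀ i, ∃! r : ThompsonBO.BiOrdering ThompsonBO.F, r.HasCone (ThompsonBO.isolCone i)) ∧
      ThompsonBO.BOIsol.ncard = 8) ∧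
    -- which are isolated points of the space of bi-orderings
    (∀ r ∈ ThompsonBO.BOIsol, IsOpen ({r} : Set (ThompsonBO.BiOrdering ThompsonBO.F))) ∧
    -- the derived subgroup has exactly four bi-orderings
    ((∀ i, ∃! r' : ThompsonBO.BiOrdering ThompsonBO.F', ThompsonBO.IsMainRestriction r' i) ∧
      ∀ r' : ThompsonBO.BiOrdering ThompsonBO.F', ∃! i, ThompsonBO.IsMainRestriction r' i) ∧
    -- each `Λ` is a copy of the Cantor set, parametrised by the bi-orderings on `ℤ²`
    (∀ i, (∃ e : ThompsonBO.BiOrdering ThompsonBO.Z2 ≃ₜ ThompsonBO.Lambda i,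
        ∀ s r', ThompsonBO.IsMainRestriction r' i → ThompsonBO.IsExtension s r' (e s)) ∧
      Nonempty (ThompsonBO.Lambda i ≃ₜ cantorSet)) ∧
    -- the space of bi-orderings is the disjoint union of these five sets
    (ThompsonBO.BOIsol ∪ ⋃ i, ThompsonBO.Lambda i = Set.univ ∧
      (∀ i, Disjoint ThompsonBO.BOIsol (ThompsonBO.Lambda i)) ∧
      Pairwise fun i j => Disjoint (ThompsonBO.Lambda i) (ThompsonBO.Lambda j)) := by
  open ThompsonBO in
  refine ⟨⟨fun i => ⟨_, hasCone_isolOrder i, fun r hr => hr.unique (hasCone_isolOrder i)⟩,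
    ncard_BOIsol⟩, fun r hr => isOpen_singleton_of_mem_BOIsol hr, ⟨fun i => ?_, fun r' => ?_⟩,
    fun i => ⟨⟨extensionHomeomorph i, fun s r' h => isExtension_extension h⟩,
      ⟨((extensionHomeomorph i).symm.trans bitOrderHomeomorph.symm).trans
        cantorSetHomeomorphNatToBool.symm⟩⟩, ?_, fun i => ?_, fun i j hij => ?_⟩
  · obtain ⟨r', hr'⟩ := exists_isMainRestriction' i
    exact ⟨r', hr', fun q hq => BiOrdering.HasCone.unique hq hr'⟩
  · obtain ⟨i, hi⟩ := exists_isMainRestriction r'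
    exact ⟨i, hi, fun j hj => hj.unique hi⟩
  · refine Set.eq_univ_of_forall fun r => ?_
    by_cases h : DerivedNotConvex r
    · exact .inl (mem_BOIsol_of_notConvex h)
    · obtain ⟨i, hi⟩ := exists_isMainRestriction (r.comap F'.subtype F'.subtype_injective)
      exact .inr (Set.mem_iUnion.2 ⟨i, mem_Lambda_of_convex h hi⟩)
  · exact Set.disjoint_left.2 fun r h1 h2 =>
      not_notConvex_of_mem_Lambda h2 (notConvex_of_mem_BOIsol h1)
  -- An ordering of $F$ in some $\Lambda$ recovers the ordering of $F'$ by restriction, and the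
  -- latter has only one label.
  · refine Set.disjoint_left.2 ?_
    rintro r ⟨s, r', hr', hs⟩ ⟨t, q', hq', ht⟩
    refine hij (hr'.unique (j := j) fun g => ?_)
    have h1 : ∀ {u : BiOrdering Z2} {p : BiOrdering F'}, IsExtension u p r →
        (r.Pos g ↔ p.Pos g) := fun {u p} h => by
      rw [h g]
      simp
    exact ((h1 hs).symm.trans (h1 ht)).trans (hq' g)
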